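/- **Setting.** Let $N\ge 2$ be an integer, $M\in\mathbb Z$, and let $\zeta,\tau,c\in\mathbb C$. Put $q=e^{i\pi\zeta}$, $p=e^{2i\pi\tau}$, $p^*=pq^{-2c}$, with $|q|<1$, $|p|<1$, $|p^*|<1$, $q^2\notin p^{\mathbb Z}$ and $q^2\notin (p^*)^{\mathbb Z}$. Spectral parameters are written $z=e^{i\pi\xi}$; all fractional powers are taken with respect to the logarithms $\xi,\zeta,\tau$: $z^s=e^{i\pi\xi s}$, $q^s=e^{i\pi\zeta s}$, $-p^{1/2}=e^{i\pi(\tau+1)}$, and functions of $z$ below are functions of $\xi$ (so that $z\mapsto -p^{1/2}z$ means $\xi\mapsto\xi+\tau+1$ and $z\mapsto q^sz$ means $\xi\mapsto \xi+s\zeta$). Write $(z;p_1,\dots,p_m)_\infty=\prod_{n_i\ge0}(1-zp_1^{n_1}\cdots p_m^{n_m})$, $\Theta_p(z)=(z;p)_\infty(pz^{-1};p)_\infty(p;p)_\infty$, and $\vartheta\big[{\gamma_1\atop\gamma_2}\big](\xi,\tau)=\sum_{m\in\mathbb Z}\exp\big(i\pi(m+\gamma_1)^2\tau+2i\pi(m+\gamma_1)(\xi+\gamma_2)\big)$.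 **The $R$-matrix.** Let $\omega=e^{2i\pi/N}$, let $g,h$ be the $N\times N$ matrices $g_{ij}=\omega^i\delta_{ij}$, $h_{ij}=\delta_{i+1,j}$ (indices modulo $N$), $g^{1/2}=\mathrm{diag}(e^{i\pi j/N})_{0\le j<N}$, $I_{(\alpha_1,\alpha_2)}=g^{\alpha_2}h^{\alpha_1}$, and $$W_{(\alpha_1,\alpha_2)}=\frac{\vartheta\big[{1/2+\alpha_1/N\atop 1/2+\alpha_2/N}\big](\xi+\zeta/N,\tau)}{N\,\vartheta\big[{1/2+\alpha_1/N\atop 1/2+\alpha_2/N}\big](\zeta/N,\tau)},$$ $$\frac1{\kappa(z^2)}=\frac{(q^{2N}z^{-2};p,q^{2N})_\infty(q^2z^2;p,q^{2N})_\infty(pz^{-2};p,q^{2N})_\infty(pq^{2N-2}z^2;p,q^{2N})_\infty}{(q^{2N}z^{2};p,q^{2N})_\infty(q^2z^{-2};p,q^{2N})_\infty(pz^{2};p,q^{2N})_\infty(pq^{2N-2}z^{-2};p,q^{2N})_\infty},$$ $$\widetilde R(z)=\frac{z^{2/N-2}}{\kappa(z^2)}\,\frac{\vartheta\big[{1/2\atop1/2}\big](\zeta,\tau)}{\vartheta\big[{1/2\atop1/2}\big](\xi+\zeta,\tau)}\sum_{0\le\alpha_1,\alpha_2<N}W_{(\alpha_1,\alpha_2)}\,I_{(\alpha_1,\alpha_2)}\otimes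 I_{(\alpha_1,\alpha_2)}^{-1},$$ $$\tau_N(z)=z^{2/N-2}\frac{\Theta_{q^{2N}}(qz^2)}{\Theta_{q^{2N}}(qz^{-2})},\qquad \widehat R(z)=\tau_N(q^{1/2}z^{-1})\,(g^{1/2}\otimes g^{1/2})\widetilde R(z)(g^{1/2}\otimes g^{1/2})^{-1}.$$ Let $\widehat R^*(z)$ be $\widehat R(z)$ with $p$ replaced by $p^*$ (i.e. $\tau$ by $\tau-c\zeta$). Call a ratio $x$ *generic* if $x^2\notin q^{2\mathbb Z}p^{\mathbb Z}(p^*)^{\mathbb Z}$. **The algebra.** $\mathcal A_{q,p}(\widehat{gl}(N)_c)$ is the unital associative $\mathbb C$-algebra generated by the entries of the $N\times N$ matrices $L(z)$ and $L(z)^{-1}$, with $L(z)L(z)^{-1}=L(z)^{-1}L(z)=1$ and, for generic $z/w$, $$\widehat R_{12}(z/w)\,L_1(z)\,L_2(w)=L_2(w)\,L_1(z)\,\widehat R^*_{12}(z/w),\qquad L_1=L\otimes\mathbb I,\; L_2=\mathbb I\otimes L,$$ and $\mathcal A_{q,p}(\widehat{sl}(N)_c)$ is its quotient by the relations $q\text{-}\det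 L(z)=q^{c/2}$, where $q\text{-}\det L(z)=\sum_{\sigma\in\mathfrak S_N}\varepsilon(\sigma)\,L_{N,\sigma(N)}(zq^{-1})\cdots L_{2,\sigma(2)}(zq^{1-N})\,L_{1,\sigma(1)}(zq^{-N})$. Put $L^+(z)=L(q^{c/2}z)$, $L^-(z)=(g^{1/2}hg^{1/2})\,L(-p^{1/2}z)\,(g^{1/2}hg^{1/2})^{-1}$ and $$t(z)=\mathrm{Tr}\big(L^+(q^{c/2}z)\,L^-(z)^{-1}\big).$$ **Theorem 4.** Suppose that $(p,q,c)$ lies on the surface $\Sigma_{N,M}$: $(-p^{1/2})^{NM}=q^{-c-N}$, where the equation is understood on the Riemann surface of $z^{2/N}$ (on which $\widehat R$ is single-valued), that is, together with $(-p^{1/2})^{2M}=q^{-2(c+N)/N}$ (for $N=2$ this is the same equation). Then for all $z,w$ with $w/z$ generic, in $\mathcal A_{q,p}(\widehat{sl}(N)_c)$ (and already in $\mathcal A_{q,p}(\widehat{gl}(N)_c)$), $$t(z)\,L(w)=F\Big(M,\frac wz\Big)\,L(w)\,t(z)$$ (entrywise in $L(w)$), where $$F(M,x)=q^{2M(N-1)}\prod_{k=0}^{NM-1}\frac{\Theta_{q^{2N}}(x^{-2}p^{-k})\,\Theta_{q^{2N}}(x^2p^{k})}{\Theta_{q^{2N}}(x^{-2}q^2p^{-k})\,\Theta_{q^{2N}}(x^2q^2p^{k})}\quad\text{for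 } M>0,$$ $$F(M,x)=q^{-2|M|(N-1)}\prod_{k=1}^{N|M|}\frac{\Theta_{q^{2N}}(x^{-2}q^2p^{k})\,\Theta_{q^{2N}}(x^2q^2p^{-k})}{\Theta_{q^{2N}}(x^{-2}p^{k})\,\Theta_{q^{2N}}(x^2p^{-k})}\quad\text{for } M<0,$$ and $F(0,x)=1$. -/

import Mathlib

open scoped Kronecker

namespace EllipticAlgebra

noncomputable section

/-! ## Multiplicative variables and special functions

Everything is parametrised by the logarithmic variables `ξ`, `ζ`, `τ`:
`z = e^{iπξ}`, `q = e^{iπζ}`, `p = e^{2iπτ}`.  All fractional powers are read off from these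
logarithms: `z^s = e^{iπξs}`, `q^s = e^{iπζs}`, `p^{1/2} = e^{iπτ}`, `-p^{1/2} = e^{iπ(τ+1)}`. -/

/-- `e^{iπx}`. -/
def ePi (x : ℂ) : ℂ := Complex.exp (Complex.I * Real.pi * x)

/-- The infinite product `(z; p)_∞ = ∏_{n ≥ 0} (1 - z pⁿ)`. -/
def qPoch (z p : ℂ) : ℂ := ∏' n : ℕ, (1 - z * p ^ n)

/-- The infinite double product `(z; p₁, p₂)_∞ = ∏_{m, n ≥ 0} (1 - z p₁ᵐ p₂ⁿ)`. -/
def qPoch₂ (z p₁ p₂ : ℂ) : ℂ := ∏' n : ℕ × ℕ, (1 - z * p₁ ^ n.1 * p₂ ^ n.2)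

/-- The Jacobi theta function `Θ_p(z) = (z; p)_∞ (p z⁻¹; p)_∞ (p; p)_∞`. -/
def bigTheta (p z : ℂ) : ℂ := qPoch z p * qPoch (p * z⁻¹) p * qPoch p p

/-- The Jacobi theta function with characteristics `(γ₁, γ₂)`,
`∑_{m ∈ ℤ} exp (iπ (m + γ₁)² τ + 2iπ (m + γ₁)(ξ + γ₂))`. -/
def thetaChar (γ₁ γ₂ ξ τ : ℂ) : ℂ :=
  ∑' m : ℤ, Complex.exp (Complex.I * Real.pi * ((m : ℂ) + γ₁) ^ 2 * τ
    + 2 * Complex.I * Real.pi * ((m : ℂ) + γ₁) * (ξ + γ₂))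

/-! ## The elliptic `R`-matrix of the `ℤ_N`-vertex model -/

/-- `g_{ij} = ω^i δ_{ij}` with `ω = e^{2iπ/N}`. -/
def gMat (N : ℕ) : Matrix (Fin N) (Fin N) ℂ :=
  Matrix.diagonal fun i => ePi (2 / N) ^ (i : ℕ)

/-- The square root `g^{1/2}`, with entries `e^{iπ i/N} δ_{ij}`. -/
def gHalf (N : ℕ) : Matrix (Fin N) (Fin N) ℂ :=
  Matrix.diagonal fun i => ePi (1 / N) ^ (i : ℕ)

/-- `h_{ij} = δ_{i+1, j}`, indices modulo `N`. -/
def hMat (N : ℕ) : Matrix (Fin N) (Fin N) ℂ :=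
  Matrix.of fun i j => if (j : ℕ) = ((i : ℕ) + 1) % N then 1 else 0

/-- The matrix `g^{1/2} h g^{1/2}`. -/
def twist (N : ℕ) : Matrix (Fin N) (Fin N) ℂ := gHalf N * hMat N * gHalf N

/-- `I_{(α₁, α₂)} = g^{α₂} h^{α₁}`. -/
def iMat (N : ℕ) (α : Fin N × Fin N) : Matrix (Fin N) (Fin N) ℂ :=
  gMat N ^ (α.2 : ℕ) * hMat N ^ (α.1 : ℕ)

/-- `W_{(α₁, α₂)}(ξ, ζ, τ)`. -/
def wFun (N : ℕ) (α : Fin N × Fin N) (ξ ζ τ : ℂ) : ℂ :=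
  thetaChar (1 / 2 + (α.1 : ℕ) / N) (1 / 2 + (α.2 : ℕ) / N) (ξ + ζ / N) τ /
    (N * thetaChar (1 / 2 + (α.1 : ℕ) / N) (1 / 2 + (α.2 : ℕ) / N) (ζ / N) τ)

/-- The normalisation factor `1 / κ`, as a function of `Z = z²`. -/
def invKappa (N : ℕ) (q p Z : ℂ) : ℂ :=
  (qPoch₂ (q ^ (2 * N) * Z⁻¹) p (q ^ (2 * N)) * qPoch₂ (q ^ 2 * Z) p (q ^ (2 * N))
      * qPoch₂ (p * Z⁻¹) p (q ^ (2 * N)) * qPoch₂ (p * q ^ (2 * N - 2) * Z) p (q ^ (2 * N))) /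
    (qPoch₂ (q ^ (2 * N) * Z) p (q ^ (2 * N)) * qPoch₂ (q ^ 2 * Z⁻¹) p (q ^ (2 * N))
      * qPoch₂ (p * Z) p (q ^ (2 * N)) * qPoch₂ (p * q ^ (2 * N - 2) * Z⁻¹) p (q ^ (2 * N)))

/-- The `R`-matrix of the `ℤ_N`-vertex model, in `End(ℂ^N) ⊗ End(ℂ^N)`. -/
def rTilde (N : ℕ) (ζ τ ξ : ℂ) : Matrix (Fin N × Fin N) (Fin N × Fin N) ℂ :=
  (ePi (ξ * (2 / N - 2)) * invKappa N (ePi ζ) (ePi (2 * τ)) (ePi ξ ^ 2)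
      * (thetaChar (1 / 2) (1 / 2) ζ τ / thetaChar (1 / 2) (1 / 2) (ξ + ζ) τ)) •
    ∑ α : Fin N × Fin N, wFun N α ξ ζ τ • (iMat N α ⊗ₖ (iMat N α)⁻¹)

/-- The gauge-transformed matrix
`R = (g^{1/2} ⊗ g^{1/2}) R̃ (g^{-1/2} ⊗ g^{-1/2})`. -/
def rMat (N : ℕ) (ζ τ ξ : ℂ) : Matrix (Fin N × Fin N) (Fin N × Fin N) ℂ :=
  (gHalf N ⊗ₖ gHalf N) * rTilde N ζ τ ξ * ((gHalf N)⁻¹ ⊗ₖ (gHalf N)⁻¹)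

/-- `τ_N(y) = y^{2/N - 2} Θ_{q^{2N}}(q y²) / Θ_{q^{2N}}(q y⁻²)` at `y = e^{iπv}`. -/
def tauN (N : ℕ) (ζ v : ℂ) : ℂ :=
  ePi (v * (2 / N - 2)) *
    (bigTheta (ePi ζ ^ (2 * N)) (ePi ζ * ePi v ^ 2) /
      bigTheta (ePi ζ ^ (2 * N)) (ePi ζ * (ePi v ^ 2)⁻¹))

/-- `R̂(z) = τ_N(q^{1/2} z⁻¹) R(z)`. -/
def rHat (N : ℕ) (ζ τ ξ : ℂ) : Matrix (Fin N × Fin N) (Fin N × Fin N) ℂ :=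
  tauN N ζ (ζ / 2 - ξ) • rMat N ζ τ ξ

/-- `R̂*(z) = R̂(z)` with `p` replaced by `p* = p q^{-2c}`, that is, `τ` by `τ - cζ`. -/
def rHatStar (N : ℕ) (ζ τ c ξ : ℂ) : Matrix (Fin N × Fin N) (Fin N × Fin N) ℂ :=
  rHat N ζ (τ - c * ζ) ξ

/-! ## Matrices of operators -/

section Operators

variable {A : Type*} [Ring A] [Algebra ℂ A]

/-- A matrix of complex numbers as a matrix over the algebra `A`. -/
def scal (A : Type*) [Ring A] [Algebra ℂ A] {n : Type*} (X : Matrix n n ℂ) : Matrix n n A :=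
  X.map (algebraMap ℂ A)

/-- `X₁ = X ⊗ 𝕀`. -/
def leg₁ {N : ℕ} (X : Matrix (Fin N) (Fin N) A) :
    Matrix (Fin N × Fin N) (Fin N × Fin N) A := X ⊗ₖ (1 : Matrix (Fin N) (Fin N) A)

/-- `X₂ = 𝕀 ⊗ X`. -/
def leg₂ {N : ℕ} (X : Matrix (Fin N) (Fin N) A) :
    Matrix (Fin N × Fin N) (Fin N × Fin N) A := (1 : Matrix (Fin N) (Fin N) A) ⊗ₖ X

/-- `L⁺(z) = L(q^{c/2} z)`. -/
def lPlus {N : ℕ} (ζ c : ℂ) (L : ℂ → Matrix (Fin N) (Fin N) A) (ξ : ℂ) :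
    Matrix (Fin N) (Fin N) A := L (ξ + c * ζ / 2)

/-- `L⁻(z) = (g^{1/2} h g^{1/2}) L(-p^{1/2} z) (g^{1/2} h g^{1/2})⁻¹`. -/
def lMinus {N : ℕ} (τ : ℂ) (L : ℂ → Matrix (Fin N) (Fin N) A) (ξ : ℂ) :
    Matrix (Fin N) (Fin N) A :=
  scal A (twist N) * L (ξ + (τ + 1)) * scal A (twist N)⁻¹

/-- `t(z) = Tr (L⁺(q^{c/2} z) L⁻(z)⁻¹)`; the inverse is taken in the ring of matrices over `A`. -/
def tOp {N : ℕ} (ζ τ c : ℂ) (L : ℂ → Matrix (Fin N) (Fin N) A) (ξ : ℂ) : A :=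
  Matrix.trace (lPlus ζ c L (ξ + c * ζ / 2) * Ring.inverse (lMinus τ L ξ))

/-- The `q`-determinant `∑_σ ε(σ) ∏_{i=1}^N L_{i,σ(i)}(z q^{i-N-1})`, the noncommuting factors
being written from left to right in the order `i = N, …, 1`.  (The index `i : Fin N` stands for
the label `i + 1`.) -/
def qDet {N : ℕ} (ζ : ℂ) (L : ℂ → Matrix (Fin N) (Fin N) A) (ξ : ℂ) : A :=
  ∑ σ : Equiv.Perm (Fin N), (Equiv.Perm.sign σ : ℤ) •
    ((List.finRange N).reverse.map fun i : Fin N =>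
      L (ξ + (((i : ℕ) : ℂ) + 1 - N - 1) * ζ) i (σ i)).prod

end Operators

/-! ## The elliptic quantum algebras -/

/-- A ratio `z = e^{iπu}` of spectral parameters is generic if
`z² ∉ q^{2ℤ} p^ℤ (p*)^ℤ`, where `p* = p q^{-2c}`.  All poles of the entries of `R̂(z)`, `R̂*(z)`
and all zeros of their determinants are at non-generic ratios. -/
def Generic (ζ τ c u : ℂ) : Prop :=
  ∀ a b d : ℤ, ePi u ^ 2 ≠
    ePi ζ ^ (2 * a) * ePi (2 * τ) ^ b * ePi (2 * (τ - c * ζ)) ^ d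

/-- The symbols `L_{ij}(z)` and `(L(z)⁻¹)_{ij}`, where `z = e^{iπξ}`. -/
inductive Gen (N : ℕ) : Type
  | L (ξ : ℂ) (i j : Fin N) : Gen N
  | Linv (ξ : ℂ) (i j : Fin N) : Gen N

/-- The matrix of symbols `L(z)` in the free algebra. -/
def freeL (N : ℕ) (ξ : ℂ) : Matrix (Fin N) (Fin N) (FreeAlgebra ℂ (Gen N)) :=
  Matrix.of fun i j => FreeAlgebra.ι ℂ (Gen.L ξ i j)

/-- The matrix of symbols `L(z)⁻¹` in the free algebra. -/
def freeLinv (N : ℕ) (ξ : ℂ) : Matrix (Fin N) (Fin N) (FreeAlgebra ℂ (Gen N)) :=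
  Matrix.of fun i j => FreeAlgebra.ι ℂ (Gen.Linv ξ i j)

/-- The defining relations: the exchange relation
`R̂₁₂(z/w) L₁(z) L₂(w) = L₂(w) L₁(z) R̂*₁₂(z/w)`, an identity between meromorphic functions
of `z/w`, imposed at all generic ratios `z/w`, and invertibility of `L(z)`. -/
inductive RelGL (N : ℕ) (ζ τ c : ℂ) : FreeAlgebra ℂ (Gen N) → FreeAlgebra ℂ (Gen N) → Prop
  | exchange (ξ η : ℂ) (hgen : Generic ζ τ c (ξ - η)) (a b : Fin N × Fin N) :
      RelGL N ζ τ c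
        ((scal (FreeAlgebra ℂ (Gen N)) (rHat N ζ τ (ξ - η))
          * leg₁ (freeL N ξ) * leg₂ (freeL N η)) a b)
        ((leg₂ (freeL N η) * leg₁ (freeL N ξ)
          * scal (FreeAlgebra ℂ (Gen N)) (rHatStar N ζ τ c (ξ - η))) a b)
  | mul_inv (ξ : ℂ) (i j : Fin N) :
      RelGL N ζ τ c ((freeL N ξ * freeLinv N ξ) i j)
        ((1 : Matrix (Fin N) (Fin N) (FreeAlgebra ℂ (Gen N))) i j)
  | inv_mul (ξ : ℂ) (i j : Fin N) :
      RelGL N ζ τ c ((freeLinv N ξ * freeL N ξ) i j)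
        ((1 : Matrix (Fin N) (Fin N) (FreeAlgebra ℂ (Gen N))) i j)

/-- The elliptic quantum algebra of type `gl(N)` at level `c`. -/
abbrev EllGL (N : ℕ) (ζ τ c : ℂ) : Type := RingQuot (RelGL N ζ τ c)

/-- The generating operators `L(z)` of the algebra of type `gl(N)`. -/
def glL (N : ℕ) (ζ τ c : ℂ) (ξ : ℂ) : Matrix (Fin N) (Fin N) (EllGL N ζ τ c) :=
  (freeL N ξ).map (RingQuot.mkAlgHom ℂ (RelGL N ζ τ c))

/-- The relation `q-det L(z) = q^{c/2}`. -/
inductive RelSL (N : ℕ) (ζ τ c : ℂ) : EllGL N ζ τ c → EllGL N ζ τ c → Prop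
  | qdet (ξ : ℂ) :
      RelSL N ζ τ c (qDet ζ (glL N ζ τ c) ξ)
        (algebraMap ℂ (EllGL N ζ τ c) (ePi (ζ * (c / 2))))

/-- The elliptic quantum algebra of type `sl(N)` at level `c`: the quotient of the algebra of type
`gl(N)` by the two-sided ideal generated by `q-det L - q^{c/2}`. -/
abbrev EllSL (N : ℕ) (ζ τ c : ℂ) : Type := RingQuot (RelSL N ζ τ c)

/-- The generating operators `L(z)` of the algebra of type `sl(N)`. -/
def slL (N : ℕ) (ζ τ c : ℂ) (ξ : ℂ) : Matrix (Fin N) (Fin N) (EllSL N ζ τ c) :=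
  (glL N ζ τ c ξ).map (RingQuot.mkAlgHom ℂ (RelSL N ζ τ c))

/-! ## The surface and the structure function -/

/-- The surface `(-p^{1/2})^{NM} = q^{-c-N}`.  The matrix `R̂(z)` is a single-valued function
of `z^{2/N}` only (not of `z`, if `N > 2`), so the equation is understood on the Riemann surface
of `z^{2/N}`: the `2/N`-th powers of the two sides, `(-p^{1/2})^{2M}` and `q^{-2(c+N)/N}`,
agree as well.  For `N = 2` the second equation is the first one. -/
def OnSurface (N : ℕ) (M : ℤ) (ζ τ c : ℂ) : Prop :=
  ePi (τ + 1) ^ ((N : ℤ) * M) = ePi (ζ * (-c - N)) ∧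
    ePi (τ + 1) ^ (2 * M) = ePi (ζ * (2 * (-c - N) / N))

/-- The structure function `F(M, x)`, for given `N`, `q`, `p`.  (For `M = 0` it is the empty
product `1`.) -/
def structF (N : ℕ) (q p : ℂ) (M : ℤ) (x : ℂ) : ℂ :=
  if 0 ≤ M then
    q ^ (2 * M * ((N : ℤ) - 1)) * ∏ k ∈ Finset.range (N * M.natAbs),
      (bigTheta (q ^ (2 * N)) ((x ^ 2)⁻¹ * (p ^ k)⁻¹) * bigTheta (q ^ (2 * N)) (x ^ 2 * p ^ k)) /
        (bigTheta (q ^ (2 * N)) ((x ^ 2)⁻¹ * q ^ 2 * (p ^ k)⁻¹)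
          * bigTheta (q ^ (2 * N)) (x ^ 2 * q ^ 2 * p ^ k))
  else
    q ^ (-(2 * |M| * ((N : ℤ) - 1))) * ∏ k ∈ Finset.Icc 1 (N * M.natAbs),
      (bigTheta (q ^ (2 * N)) ((x ^ 2)⁻¹ * q ^ 2 * p ^ k)
          * bigTheta (q ^ (2 * N)) (x ^ 2 * q ^ 2 * (p ^ k)⁻¹)) /
        (bigTheta (q ^ (2 * N)) ((x ^ 2)⁻¹ * p ^ k)
          * bigTheta (q ^ (2 * N)) (x ^ 2 * (p ^ k)⁻¹))

end

end EllipticAlgebra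

/-! Write s = ξ - η, u = s + cζ, and let U(Z), with Z = e^{2iπs}, be the scalar `shiftFactor`. The
theorem rests on three properties of R̂, all governed by this one scalar. Quasi-periodicity
(`twist_conj_rHat`): conjugating the first leg of R̂(s + τ + 1) by g^{1/2} h g^{1/2} gives U(Z)
R̂(s). Unitarity (`rHat_mul_flip`): R̂₁₂(s) R̂₂₁(-s) = U(Z)⁻¹. Crossing (`rHat_crossing`): after
transposition in the first space, R̂₁₂(s - Nζ) and R̂₂₁(-s) are inverse to each other up to U(Z)⁻¹.

Put P = L(ξ + cζ) and B = L⁻(ξ)⁻¹, so that t = Tr(PB). The shift τ + 1 contained in L⁻ is a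
quasi-period of R̂ starting from s. With τ* = τ - cζ one has s + τ + 1 = u + τ* + 1, so it is also a
quasi-period of R̂* starting from u. Hence L⁻ and P are exchanged with L(η) through the same matrix
R̂*(u), up to a scalar. Combining the two relations and using unitarity of R̂* gives R̂(u) (PB)₁
R̂₂₁(-s) L₂(η) = U(e^{2iπu})⁻¹ L₂(η) (PB)₁. The partial trace over the first space collapses the
left side by crossing if R̂(u) can be replaced by R̂(s - Nζ). On the surface these arguments differ
by NM(τ + 1) modulo Nℤ. An N-fold quasi-period acts on R̂ by a scalar only, since the N-th powers of
the phases produced by the twist are 1, and N is a period of R̂. So R̂(s - Nζ) = V R̂(u) with V a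
product of values of U or the inverse of one, and U(Z) V U(e^{2iπu})⁻¹ telescopes to F
(`rHat_crossing_shift`, `tOp_mul_apply`).

For the properties of R̂, write R̂ = ρ ∑ w_β I_β ⊗ I_β⁻¹ with Weyl operators I_β (`rHat_eq`). Their
commutation relations turn unitarity and crossing into identities for sums of the theta quotients
w_β over β in (ℤ/N)². A sum over torsion labels, multiplied by θ(Nu), is an entire function of Nu
with the multipliers of a single theta function up to a twist, and Liouville's theorem determines it
(`fourier_thetaN`, `unitarity_thetaN`). The finite Fourier transform of w is again a theta quotient,
so Parseval's identity yields crossing (`crossing_wInt`) and the one special value missing for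
unitarity (`sum_wInt_mul_self`). The scalar ρ is handled by the functional equations of 1/κ under Z
↦ Z⁻¹, pZ and q^{-2N}Z. -/

namespace EllipticAlgebra

/-! ## Entire functions with simple zeros -/

/-- An entire function all of whose zeros are simple. -/
structure SimpleZeros (T : ℂ → ℂ) : Prop where
  differentiable : Differentiable ℂ T
  deriv_ne_zero : ∀ x, T x = 0 → deriv T x ≠ 0

open Filter Topology in
theorem SimpleZeros.eventually_ne {T : ℂ → ℂ} (hT : SimpleZeros T) (x : ℂ) :
    ∀ᶠ z in 𝓝[≠] x, T z ≠ 0 := by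
  by_cases h : T x = 0
  · exact (hT.differentiable x).hasDerivAt.eventually_ne (hT.deriv_ne_zero x h)
  · exact ((hT.differentiable x).continuousAt.eventually_ne h).filter_mono nhdsWithin_le_nhds

-- The zeros of T are isolated, so T can be cancelled off a discrete set and the identity extends by
-- continuity.
open Filter Topology in
theorem SimpleZeros.cancel {T : ℂ → ℂ} (hT : SimpleZeros T) {G H : ℂ → ℂ}
    (hG : Continuous G) (hH : Continuous H) (h : ∀ x, G x * T x = H x * T x) (x : ℂ) :
    G x = H x := by
  have h1 : ∀ᶠ z in 𝓝[≠] x, G z = H z := by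
    filter_upwards [hT.eventually_ne x] with z hz
    exact mul_right_cancel₀ hz (h z)
  have hg : Tendsto G (𝓝[≠] x) (𝓝 (G x)) := hG.continuousAt.tendsto.mono_left nhdsWithin_le_nhds
  have hh : Tendsto H (𝓝[≠] x) (𝓝 (H x)) := hH.continuousAt.tendsto.mono_left nhdsWithin_le_nhds
  exact tendsto_nhds_unique (hg.congr' h1) hh

open Filter Topology in
/-- Division of an entire function by an entire function with simple zeros. -/
theorem SimpleZeros.exists_quotient {T f : ℂ → ℂ} (hT : SimpleZeros T)
    (hf : Differentiable ℂ f) (h : ∀ x, T x = 0 → f x = 0) :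
    ∃ E : ℂ → ℂ, Differentiable ℂ E ∧ ∀ x, f x = E x * T x := by
  -- At a common zero x both functions are (z - x) times their difference quotients, and that of T
  -- does not vanish at x; the quotient of the derivatives is the value that removes the
  -- singularity.
  refine ⟨fun x => if T x = 0 then deriv f x / deriv T x else f x / T x, fun x => ?_, fun x => ?_⟩
  · by_cases hx : T x = 0
    · have hdT : DifferentiableAt ℂ (dslope T x) x :=
        ((Complex.differentiableOn_dslope (s := Set.univ) Filter.univ_mem).mpr
          hT.differentiable.differentiableOn).differentiableAt Filter.univ_mem
      have hdf : DifferentiableAt ℂ (dslope f x) x :=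
        ((Complex.differentiableOn_dslope (s := Set.univ) Filter.univ_mem).mpr
          hf.differentiableOn).differentiableAt Filter.univ_mem
      have hne : dslope T x x ≠ 0 := by rw [dslope_same]; exact hT.deriv_ne_zero x hx
      refine (hdf.div hdT hne).congr_of_eventuallyEq ?_
      filter_upwards [hdT.continuousAt.eventually_ne hne] with z hz
      by_cases hzx : z = x
      · subst hzx
        simp [hx, dslope_same]
      · have hT' : T z = (z - x) * dslope T x z := by
          have := sub_smul_dslope T x z
          rw [smul_eq_mul, hx, sub_zero] at this
          exact this.symm
        have hf' : f z = (z - x) * dslope f x z := by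
          have := sub_smul_dslope f x z
          rw [smul_eq_mul, h x hx, sub_zero] at this
          exact this.symm
        have hzx' : z - x ≠ 0 := sub_ne_zero.mpr hzx
        have : T z ≠ 0 := by rw [hT']; exact mul_ne_zero hzx' hz
        simp only [this, if_false]
        rw [hT', hf', mul_div_mul_left _ _ hzx']
        rfl
    · have := ((hf x).div (hT.differentiable x) hx)
      refine this.congr_of_eventuallyEq ?_
      filter_upwards [(hT.differentiable x).continuousAt.eventually_ne hx] with z hz
      simp [hz]
  · by_cases hx : T x = 0
    · simp [hx, h x hx]
    · simp [hx]

/-- The product of functions with disjoint simple zeros. -/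
theorem SimpleZeros.mul {S T : ℂ → ℂ} (hS : SimpleZeros S) (hT : SimpleZeros T)
    (h : ∀ x, S x = 0 → T x ≠ 0) : SimpleZeros fun x => S x * T x := by
  refine ⟨hS.differentiable.mul hT.differentiable, fun x hx => ?_⟩
  have hd : deriv (fun x => S x * T x) x = deriv S x * T x + S x * deriv T x :=
    deriv_fun_mul (hS.differentiable x) (hT.differentiable x)
  rw [hd]
  rcases mul_eq_zero.mp hx with h1 | h1
  · rw [h1, zero_mul, add_zero]
    exact mul_ne_zero (hS.deriv_ne_zero x h1) (h x h1)
  · rw [h1, mul_zero, zero_add]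
    exact mul_ne_zero (fun h2 => h x h2 h1) (hT.deriv_ne_zero x h1)

/-- Multiplication by a nowhere vanishing function and translation preserve simple zeros. -/
theorem SimpleZeros.twist {T : ℂ → ℂ} (hT : SimpleZeros T) {e : ℂ → ℂ} (he : Differentiable ℂ e)
    (he0 : ∀ x, e x ≠ 0) (s : ℂ) : SimpleZeros fun x => e x * T (x + s) := by
  have hTs : Differentiable ℂ fun x => T (x + s) :=
    hT.differentiable.comp (differentiable_id.add_const s)
  refine SimpleZeros.mul ⟨he, fun x hx => absurd hx (he0 x)⟩ ⟨hTs, fun x hx => ?_⟩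
    fun x hx => absurd hx (he0 x)
  rw [deriv_comp_add_const]
  exact hT.deriv_ne_zero _ hx

/-! ## Entire functions with unimodular multipliers -/

/-- An entire function whose absolute value is doubly periodic is constant. -/
theorem exists_const_of_norm_periodic {τ : ℂ} (hτ : 0 < τ.im) {E : ℂ → ℂ}
    (hE : Differentiable ℂ E) (h1 : ∀ v, ‖E (v + 1)‖ = ‖E v‖) (h2 : ∀ v, ‖E (v + τ)‖ = ‖E v‖) :
    ∃ C, ∀ v, E v = C := by
  have p1 : Function.Periodic (fun v => ‖E v‖) 1 := h1
  have p2 : Function.Periodic (fun v => ‖E v‖) τ := h2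
  let K : Set ℂ := (fun x : ℝ × ℝ => (x.1 : ℂ) + x.2 * τ) '' (Set.Icc 0 1 ×ˢ Set.Icc 0 1)
  have hK : IsCompact K :=
    (isCompact_Icc.prod isCompact_Icc).image (by fun_prop)
  obtain ⟨B, hB⟩ := hK.exists_bound_of_continuousOn hE.continuous.continuousOn
  refine hE.exists_const_forall_eq_of_bounded ?_
  rw [isBounded_iff_forall_norm_le]
  refine ⟨B, ?_⟩
  rintro _ ⟨v, rfl⟩
  set b : ℝ := v.im / τ.im with hb
  set a : ℝ := v.re - b * τ.re with ha
  have hv : v = (a : ℂ) + b * τ := by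
    apply Complex.ext
    · simp [ha]
    · simp [hb, hτ.ne']
  have key : ‖E v‖ = ‖E (((Int.fract a : ℝ) : ℂ) + ((Int.fract b : ℝ) : ℂ) * τ)‖ := by
    have e1 := p1.int_mul ⌊a⌋ (((Int.fract a : ℝ) : ℂ) + ((Int.fract b : ℝ) : ℂ) * τ + ⌊b⌋ * τ)
    have e2 := p2.int_mul ⌊b⌋ (((Int.fract a : ℝ) : ℂ) + ((Int.fract b : ℝ) : ℂ) * τ)
    rw [← e2, ← e1]
    congr 2
    rw [hv]
    have ea : (a : ℂ) = ⌊a⌋ + ((Int.fract a : ℝ) : ℂ) := by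
      exact_mod_cast (Int.floor_add_fract a).symm
    have eb : (b : ℂ) = ⌊b⌋ + ((Int.fract b : ℝ) : ℂ) := by
      exact_mod_cast (Int.floor_add_fract b).symm
    rw [ea, eb]
    simp
    ring
  rw [key]
  exact hB _ ⟨(Int.fract a, Int.fract b),
    ⟨⟨Int.fract_nonneg _, (Int.fract_lt_one _).le⟩, ⟨Int.fract_nonneg _, (Int.fract_lt_one _).le⟩⟩,
    rfl⟩

/-- An entire function `T` with the quasi-periods `1` and `τ`, of order one: it changes sign under
`v ↦ v + 1`, it is multiplied by a nowhere vanishing function `m` under `v ↦ v + τ`, and its zeros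
are simple and form the lattice `ℤ + ℤτ`. -/
structure OrderOne (τ : ℂ) (m T : ℂ → ℂ) : Prop where
  im_pos : 0 < τ.im
  simple : SimpleZeros T
  mult_ne_zero : ∀ v, m v ≠ 0
  mult_cont : Continuous m
  add_one : ∀ v, T (v + 1) = -T v
  add_tau : ∀ v, T (v + τ) = m v * T v
  zero : T 0 = 0
  exists_of_eq_zero : ∀ v, T v = 0 → ∃ a b : ℤ, v = a + b * τ

/-- The predicate f v = 0 is genuinely periodic although f is not, so no multiplier has to be
iterated over the lattice. -/
theorem eq_zero_of_quasiPeriodic {τ : ℂ} {f : ℂ → ℂ}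
    (h1 : ∀ v, f v = 0 ↔ f (v + 1) = 0) (h2 : ∀ v, f v = 0 ↔ f (v + τ) = 0) (v : ℂ) (a b : ℤ) :
    f (v + a + b * τ) = 0 ↔ f v = 0 := by
  have p1 : Function.Periodic (fun v => f v = 0) 1 := fun v => propext (h1 v).symm
  have p2 : Function.Periodic (fun v => f v = 0) τ := fun v => propext (h2 v).symm
  have e1 := p1.int_mul a v
  have e2 := p2.int_mul b (v + a)
  simp only [mul_one] at e1 e2
  rw [e2, e1]

theorem OrderOne.eq_zero {τ : ℂ} {m T : ℂ → ℂ} (hT : OrderOne τ m T) (a b : ℤ) :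
    T (a + b * τ) = 0 := by
  have := eq_zero_of_quasiPeriodic (τ := τ) (f := T) (fun v => by rw [hT.add_one]; simp)
    (fun v => by rw [hT.add_tau]; simp [hT.mult_ne_zero]) 0 a b
  rw [zero_add] at this
  exact this.mpr hT.zero

theorem OrderOne.eq_zero_iff {τ : ℂ} {m T : ℂ → ℂ} (hT : OrderOne τ m T) (v : ℂ) :
    T v = 0 ↔ ∃ a b : ℤ, v = a + b * τ :=
  ⟨hT.exists_of_eq_zero v, by rintro ⟨a, b, rfl⟩; exact hT.eq_zero a b⟩

/-- An entire function with the multipliers of `T`, up to unimodular constants, which vanishes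
at the origin, is a multiple of `T`; it vanishes if one of the constants is not trivial. -/
theorem OrderOne.eq_const_mul {τ : ℂ} {m T f : ℂ → ℂ} (hT : OrderOne τ m T)
    (hf : Differentiable ℂ f) {μ₁ μ₂ : ℂ} (hμ₁ : ‖μ₁‖ = 1) (hμ₂ : ‖μ₂‖ = 1)
    (h1 : ∀ v, f (v + 1) = -μ₁ * f v) (h2 : ∀ v, f (v + τ) = μ₂ * (m v * f v)) (h0 : f 0 = 0) :
    ∃ C, (∀ v, f v = C * T v) ∧ (μ₁ = 1 ∧ μ₂ = 1 ∨ C = 0) := by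
  have hμ₁' : μ₁ ≠ 0 := by rintro rfl; simp at hμ₁
  have hμ₂' : μ₂ ≠ 0 := by rintro rfl; simp at hμ₂
  have hz : ∀ v, T v = 0 → f v = 0 := by
    intro v hv
    obtain ⟨a, b, rfl⟩ := hT.exists_of_eq_zero v hv
    have := eq_zero_of_quasiPeriodic (τ := τ) (f := f) (fun v => by rw [h1]; simp [hμ₁'])
      (fun v => by rw [h2]; simp [hT.mult_ne_zero, hμ₂']) 0 a b
    rw [zero_add] at this
    exact this.mpr h0
  -- The quotient f/T is entire with the constant multipliers μ₁ and μ₂ of modulus 1, hence constant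
  -- by Liouville; a nonzero constant forces both multipliers to be 1.
  obtain ⟨E, hE, hfE⟩ := hT.simple.exists_quotient hf hz
  have hEc := hE.continuous
  have e1 : ∀ v, E (v + 1) = μ₁ * E v := by
    refine hT.simple.cancel (G := fun v => E (v + 1)) (H := fun v => μ₁ * E v)
      (by fun_prop) (by fun_prop) fun v => ?_
    have h := hfE (v + 1)
    rw [hT.add_one, h1, hfE] at h
    linear_combination h
  have e2 : ∀ v, E (v + τ) = μ₂ * E v := by
    refine hT.simple.cancel (G := fun v => E (v + τ)) (H := fun v => μ₂ * E v)
      (by fun_prop) (by fun_prop) fun v => ?_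
    have h := hfE (v + τ)
    rw [hT.add_tau, h2, hfE] at h
    refine mul_left_cancel₀ (hT.mult_ne_zero v) ?_
    linear_combination -h
  obtain ⟨C, hC⟩ := exists_const_of_norm_periodic hT.im_pos hE
    (fun v => by rw [e1, norm_mul, hμ₁, one_mul]) (fun v => by rw [e2, norm_mul, hμ₂, one_mul])
  refine ⟨C, fun v => by rw [hfE, hC], ?_⟩
  by_cases hC0 : C = 0
  · exact Or.inr hC0
  · left
    have a1 := e1 0
    have a2 := e2 0
    rw [hC, hC] at a1 a2
    exact ⟨mul_right_cancel₀ hC0 (by rw [← a1, one_mul]),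
      mul_right_cancel₀ hC0 (by rw [← a2, one_mul])⟩

theorem OrderOne.eq_zero_of_ne {τ : ℂ} {m T f : ℂ → ℂ} (hT : OrderOne τ m T)
    (hf : Differentiable ℂ f) {μ₁ μ₂ : ℂ} (hμ₁ : ‖μ₁‖ = 1) (hμ₂ : ‖μ₂‖ = 1)
    (h1 : ∀ v, f (v + 1) = -μ₁ * f v) (h2 : ∀ v, f (v + τ) = μ₂ * (m v * f v)) (h0 : f 0 = 0)
    (hne : μ₁ ≠ 1 ∨ μ₂ ≠ 1) (v : ℂ) : f v = 0 := by
  obtain ⟨C, hC, h⟩ := hT.eq_const_mul hf hμ₁ hμ₂ h1 h2 h0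
  rcases h with ⟨a, b⟩ | rfl
  · rcases hne with h | h <;> contradiction
  · rw [hC, zero_mul]

/-- Here f is not assumed to vanish at 0. Translation by 1/2 changes the sign of m, so f - CT, moved
by 1/2 and with C chosen so that it vanishes at the origin, has the nontrivial constant μ₂ = -1 and
is therefore zero. The division is legitimate because 1/2 is not a lattice point. -/
theorem OrderOne.proportional {τ : ℂ} {m T f : ℂ → ℂ} (hT : OrderOne τ m T)
    (hm : ∀ v, m (v + 1 / 2) = -m v)
    (hf : Differentiable ℂ f) (h1 : ∀ v, f (v + 1) = -f v) (h2 : ∀ v, f (v + τ) = m v * f v) :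
    ∃ C, ∀ v, f v = C * T v := by
  have hhalf : T (1 / 2) ≠ 0 := by
    intro h
    obtain ⟨a, b, hab⟩ := hT.exists_of_eq_zero _ h
    have him := congrArg Complex.im hab
    have hb : b = 0 := by
      have : (b : ℝ) * τ.im = 0 := by simpa using him.symm
      exact_mod_cast (mul_eq_zero.mp this).resolve_right hT.im_pos.ne'
    subst hb
    have : (1 : ℂ) = ((2 * a : ℤ) : ℂ) := by
      push_cast
      linear_combination 2 * hab
    have h3 : (1 : ℤ) = 2 * a := by exact_mod_cast this
    omega
  have hTd := hT.simple.differentiable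
  refine ⟨f (1 / 2) / T (1 / 2), fun v => ?_⟩
  have key := hT.eq_zero_of_ne
    (f := fun v => f (v + 1 / 2) - f (1 / 2) / T (1 / 2) * T (v + 1 / 2)) (by fun_prop)
    (μ₁ := 1) (μ₂ := -1) (by simp) (by simp)
    (fun v => by
      rw [add_right_comm, h1, hT.add_one]
      ring)
    (fun v => by
      rw [add_right_comm, h2, hT.add_tau, hm]
      ring)
    (by
      rw [zero_add]
      field_simp
      ring) (Or.inr (by norm_num)) (v - 1 / 2)
  simp only [sub_add_cancel] at key
  linear_combination key

/-! ## The exponential `e^{iπx}` -/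

theorem ePi_add (x y : ℂ) : ePi (x + y) = ePi x * ePi y := by
  simp only [ePi, mul_add, Complex.exp_add]

theorem ePi_zero : ePi 0 = 1 := by simp [ePi]

theorem ePi_ne_zero (x : ℂ) : ePi x ≠ 0 := Complex.exp_ne_zero _

theorem ePi_neg (x : ℂ) : ePi (-x) = (ePi x)⁻¹ := by
  simp only [ePi, mul_neg, Complex.exp_neg]

theorem ePi_sub (x y : ℂ) : ePi (x - y) = ePi x / ePi y := by
  rw [sub_eq_add_neg, ePi_add, ePi_neg, div_eq_mul_inv]

theorem ePi_one : ePi 1 = -1 := by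
  rw [ePi, mul_one, mul_comm, Complex.exp_pi_mul_I]

theorem ePi_two : ePi 2 = 1 := by
  rw [← one_add_one_eq_two, ePi_add, ePi_one]
  norm_num

theorem ePi_nat_mul (n : ℕ) (x : ℂ) : ePi (n * x) = ePi x ^ n := by
  rw [ePi, ePi, ← Complex.exp_nat_mul]
  congr 1
  ring

theorem ePi_int_mul (n : ℤ) (x : ℂ) : ePi (n * x) = ePi x ^ n := by
  rw [ePi, ePi, ← Complex.exp_int_mul]
  congr 1
  ring

theorem ePi_two_mul_int (n : ℤ) : ePi (2 * n) = 1 := by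
  rw [mul_comm, ePi_int_mul, ePi_two, one_zpow]

theorem ePi_eq_one_iff (x : ℂ) : ePi x = 1 ↔ ∃ n : ℤ, x = 2 * n := by
  rw [ePi, Complex.exp_eq_one_iff]
  have hpi : Complex.I * (Real.pi : ℂ) ≠ 0 :=
    mul_ne_zero Complex.I_ne_zero (by exact_mod_cast Real.pi_ne_zero)
  refine exists_congr fun n => ⟨fun h => mul_left_cancel₀ hpi ?_, ?_⟩
  · rw [h]; ring
  · rintro rfl; ring

theorem ePi_eq_iff (x y : ℂ) : ePi x = ePi y ↔ ∃ n : ℤ, x = y + 2 * n := by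
  rw [← div_eq_one_iff_eq (ePi_ne_zero y), ← ePi_sub, ePi_eq_one_iff]
  exact exists_congr fun n => by rw [sub_eq_iff_eq_add']

theorem norm_ePi (x : ℂ) : ‖ePi x‖ = Real.exp (-(Real.pi * x.im)) := by
  rw [ePi, Complex.norm_exp]
  congr 1
  simp

theorem norm_ePi_ofReal (x : ℝ) : ‖ePi x‖ = 1 := by
  rw [norm_ePi]
  simp

theorem norm_ePi_lt_one {x : ℂ} (hx : 0 < x.im) : ‖ePi x‖ < 1 := by
  rw [norm_ePi, Real.exp_lt_one_iff]
  have := mul_pos Real.pi_pos hx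
  linarith

theorem differentiable_ePi : Differentiable ℂ ePi := by
  unfold ePi
  fun_prop

theorem hasDerivAt_ePi (x : ℂ) : HasDerivAt ePi (Complex.I * Real.pi * ePi x) x := by
  have h0 : HasDerivAt (fun y : ℂ => Complex.I * Real.pi * y) (Complex.I * Real.pi) x := by
    simpa using (hasDerivAt_id x).const_mul (Complex.I * (Real.pi : ℂ))
  exact h0.cexp.congr_deriv (mul_comm _ _)

/-! ## Infinite products -/

theorem summable_qPoch (z : ℂ) {p : ℂ} (hp : ‖p‖ < 1) : Summable fun n : ℕ => ‖-(z * p ^ n)‖ := by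
  simp only [norm_neg, norm_mul, norm_pow]
  exact (summable_geometric_of_lt_one (norm_nonneg _) hp).mul_left _

theorem multipliable_qPoch (z : ℂ) {p : ℂ} (hp : ‖p‖ < 1) :
    Multipliable fun n : ℕ => (1 - z * p ^ n) := by
  simpa only [sub_eq_add_neg] using multipliable_one_add_of_summable (summable_qPoch z hp)

theorem qPoch_ne_zero {z p : ℂ} (hp : ‖p‖ < 1) (h : ∀ n : ℕ, z * p ^ n ≠ 1) : qPoch z p ≠ 0 := by
  simp only [qPoch, sub_eq_add_neg]
  refine tprod_one_add_ne_zero_of_summable (fun n => ?_) (summable_qPoch z hp)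
  rw [← sub_eq_add_neg]
  exact sub_ne_zero.mpr (h n).symm

theorem qPoch_step (z : ℂ) {p : ℂ} (hp : ‖p‖ < 1) : qPoch z p = (1 - z) * qPoch (z * p) p := by
  have e : (fun n : ℕ => 1 - z * p * p ^ n) = fun n : ℕ => 1 - z * p ^ (n + 1) :=
    funext fun n => by rw [pow_succ', mul_assoc]
  have h := multipliable_qPoch (z * p) hp
  rw [e] at h
  have h2 := tprod_eq_zero_mul' (f := fun n : ℕ => 1 - z * p ^ n) h
  rw [pow_zero, mul_one] at h2
  rw [qPoch, qPoch, e, h2]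

theorem qPoch_differentiable {p : ℂ} (hp : ‖p‖ < 1) : Differentiable ℂ fun z => qPoch z p := by
  intro z₀
  -- On a ball the factors differ from 1 by at most a geometric series, so the partial products
  -- converge locally uniformly.
  have hd : DifferentiableOn ℂ (fun z => ∏' n : ℕ, (1 + -(z * p ^ n)))
      (Metric.ball 0 (‖z₀‖ + 1)) := by
    refine TendstoLocallyUniformlyOn.differentiableOn
      (Summable.hasProdLocallyUniformlyOn_nat_one_add (f := fun n z => -(z * p ^ n))
        Metric.isOpen_ball
        ((summable_geometric_of_lt_one (norm_nonneg _) hp).mul_left (‖z₀‖ + 1))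
        (Filter.Eventually.of_forall fun n x hx => ?_) (fun n => by fun_prop))
      (Filter.Eventually.of_forall fun s => ?_) Metric.isOpen_ball
    · rw [norm_neg, norm_mul, norm_pow]
      rw [mem_ball_zero_iff] at hx
      gcongr
    · simpa [Finset.prod_fn] using DifferentiableOn.finsetProd (fun _ _ => by fun_prop)
  simp only [qPoch, sub_eq_add_neg]
  exact hd.differentiableAt (Metric.isOpen_ball.mem_nhds (by simp))

/-! ## The multiplicative theta function -/

theorem bigTheta_mul_self {p z : ℂ} (hp : ‖p‖ < 1) (hp0 : p ≠ 0) (hz : z ≠ 0) :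
    bigTheta p (p * z) = -z⁻¹ * bigTheta p z := by
  have e1 : p * (p * z)⁻¹ = z⁻¹ := by field_simp
  have e2 : 1 - z⁻¹ = -z⁻¹ * (1 - z) := by field_simp; ring
  rw [bigTheta, bigTheta, e1, qPoch_step z⁻¹ hp, qPoch_step z hp, e2, mul_comm z⁻¹ p, mul_comm z p]
  ring

theorem bigTheta_inv {p z : ℂ} (hp : ‖p‖ < 1) (hz : z ≠ 0) :
    bigTheta p z⁻¹ = -z⁻¹ * bigTheta p z := by
  have e2 : 1 - z⁻¹ = -z⁻¹ * (1 - z) := by field_simp; ring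
  rw [bigTheta, bigTheta, inv_inv, qPoch_step z⁻¹ hp, qPoch_step z hp, e2, mul_comm z⁻¹ p,
    mul_comm z p]
  ring

theorem qPoch_self_ne_zero {p : ℂ} (hp : ‖p‖ < 1) : qPoch p p ≠ 0 := by
  refine qPoch_ne_zero hp fun n h => ?_
  have h2 : ‖p ^ (n + 1)‖ = 1 := by rw [pow_succ', h, norm_one]
  rw [norm_pow] at h2
  exact absurd h2 (pow_lt_one₀ (norm_nonneg _) hp (by omega)).ne

theorem bigTheta_ne_zero {p z : ℂ} (hp : ‖p‖ < 1) (hp0 : p ≠ 0) (h : ∀ n : ℤ, z ≠ p ^ n) :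
    bigTheta p z ≠ 0 := by
  refine mul_ne_zero (mul_ne_zero (qPoch_ne_zero hp fun n hn => ?_)
    (qPoch_ne_zero hp fun n hn => ?_)) (qPoch_self_ne_zero hp)
  · refine h (-n) ?_
    rw [zpow_neg, zpow_natCast]
    exact eq_inv_of_mul_eq_one_left hn
  · have hz : z ≠ 0 := by rintro rfl; simp at hn
    refine h (n + 1) ?_
    rw [zpow_add₀ hp0, zpow_natCast, zpow_one]
    field_simp at hn
    rw [mul_comm] at hn
    exact hn.symm

/-- The multiplier of the odd theta function under `v ↦ v + τ`. -/
noncomputable def thetaMult (τ v : ℂ) : ℂ := ePi (-τ - 2 * v - 1)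

theorem thetaMult_add_half (τ v : ℂ) : thetaMult τ (v + 1 / 2) = -thetaMult τ v := by
  rw [thetaMult, thetaMult,
    show -τ - 2 * (v + 1 / 2) - 1 = (-τ - 2 * v - 1) + 1 - 2 * (1 : ℤ) by push_cast; ring,
    ePi_sub, ePi_two_mul_int, ePi_add, ePi_one]
  ring

/-- The prefactor e^{-iπv} produces the sign change under v ↦ v + 1. The zero at the origin comes
from the single factor 1 - e^{2iπv} and is simple; the multipliers carry this to the whole lattice.
-/
theorem orderOne_bigTheta {τ : ℂ} (hτ : 0 < τ.im) :
    OrderOne τ (thetaMult τ) fun v => ePi (-v) * bigTheta (ePi (2 * τ)) (ePi (2 * v)) := by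
  have hτ2 : 0 < (2 * τ).im := by simpa using hτ
  have hp := norm_ePi_lt_one hτ2
  have hp0 := ePi_ne_zero (2 * τ)
  have hq := qPoch_differentiable hp
  have hdiff : Differentiable ℂ fun v => ePi (-v) * bigTheta (ePi (2 * τ)) (ePi (2 * v)) := by
    have he := differentiable_ePi
    have h1 : Differentiable ℂ fun v => qPoch (ePi (2 * v)) (ePi (2 * τ)) :=
      hq.comp (he.comp (differentiable_id.const_mul 2))
    have h2 : Differentiable ℂ fun v =>
        qPoch (ePi (2 * τ) * (ePi (2 * v))⁻¹) (ePi (2 * τ)) := by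
      simp only [← ePi_neg]
      exact hq.comp ((he.comp (differentiable_id.const_mul 2).neg).const_mul _)
    exact (he.comp differentiable_neg).mul ((h1.mul h2).mul_const _)
  have h1 : ∀ v, ePi (-(v + 1)) * bigTheta (ePi (2 * τ)) (ePi (2 * (v + 1))) =
      -(ePi (-v) * bigTheta (ePi (2 * τ)) (ePi (2 * v))) := by
    intro v
    rw [show -(v + 1) = -v - 1 by ring, show 2 * (v + 1) = 2 * v + 2 by ring, ePi_sub, ePi_add,
      ePi_one, ePi_two, mul_one]
    ring
  have h2 : ∀ v, ePi (-(v + τ)) * bigTheta (ePi (2 * τ)) (ePi (2 * (v + τ))) =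
      thetaMult τ v * (ePi (-v) * bigTheta (ePi (2 * τ)) (ePi (2 * v))) := by
    intro v
    rw [show 2 * (v + τ) = 2 * τ + 2 * v by ring, ePi_add (2 * τ),
      bigTheta_mul_self hp hp0 (ePi_ne_zero _), thetaMult, ← ePi_neg,
      show -τ - 2 * v - 1 = -τ + -(2 * v) - 1 by ring, ePi_sub, ePi_one, ePi_add,
      show -(v + τ) = -v + -τ by ring, ePi_add]
    ring
  have hz : ∀ v, ePi (-v) * bigTheta (ePi (2 * τ)) (ePi (2 * v)) = 0 →
      ∃ a b : ℤ, v = a + b * τ := by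
    intro v hv
    by_contra hcon
    refine mul_ne_zero (ePi_ne_zero _) (bigTheta_ne_zero hp hp0 fun n hn => hcon ?_) hv
    rw [← ePi_int_mul, ePi_eq_iff] at hn
    obtain ⟨k, hk⟩ := hn
    exact ⟨k, n, by linear_combination hk / 2⟩
  have h0 : ePi (-0) * bigTheta (ePi (2 * τ)) (ePi (2 * 0)) = 0 := by
    rw [bigTheta, mul_zero, ePi_zero, qPoch_step 1 hp]
    simp
  -- the derivative at the origin
  have hd0 : deriv (fun v => ePi (-v) * bigTheta (ePi (2 * τ)) (ePi (2 * v))) 0 ≠ 0 := by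
    set G : ℂ → ℂ := fun v => ePi (-v) * (qPoch (ePi (2 * v) * ePi (2 * τ)) (ePi (2 * τ)) *
      qPoch (ePi (2 * τ) * (ePi (2 * v))⁻¹) (ePi (2 * τ)) * qPoch (ePi (2 * τ)) (ePi (2 * τ)))
    have hG0 : G 0 ≠ 0 := by
      simp only [G, mul_zero, neg_zero, ePi_zero, one_mul, inv_one, mul_one]
      have := qPoch_self_ne_zero hp
      exact mul_ne_zero (mul_ne_zero this this) this
    have hG : Differentiable ℂ G := by
      have he := differentiable_ePi
      have h1 : Differentiable ℂ fun v => qPoch (ePi (2 * v) * ePi (2 * τ)) (ePi (2 * τ)) :=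
        hq.comp ((he.comp (differentiable_id.const_mul 2)).mul_const _)
      have h2 : Differentiable ℂ fun v =>
          qPoch (ePi (2 * τ) * (ePi (2 * v))⁻¹) (ePi (2 * τ)) := by
        simp only [← ePi_neg]
        exact hq.comp ((he.comp (differentiable_id.const_mul 2).neg).const_mul _)
      exact (he.comp differentiable_neg).mul ((h1.mul h2).mul_const _)
    have heq : (fun v => ePi (-v) * bigTheta (ePi (2 * τ)) (ePi (2 * v))) =
        fun v => (1 - ePi (2 * v)) * G v := by
      funext v
      simp only [G, bigTheta]
      rw [qPoch_step (ePi (2 * v)) hp]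
      ring
    have hlin : HasDerivAt (fun v => 1 - ePi (2 * v)) (-(2 * (Complex.I * Real.pi))) 0 := by
      have h2 : HasDerivAt (fun v : ℂ => 2 * v) 2 0 := by
        simpa using (hasDerivAt_id (0 : ℂ)).const_mul 2
      have h3 := (HasDerivAt.comp (0 : ℂ) (hasDerivAt_ePi (2 * 0)) h2).const_sub 1
      rw [mul_zero, ePi_zero] at h3
      exact h3.congr_deriv (by ring)
    have h4 := hlin.mul (hG 0).hasDerivAt
    rw [heq]
    have h5 : deriv (fun v => (1 - ePi (2 * v)) * G v) 0 = -(2 * (Complex.I * Real.pi)) * G 0 := by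
      have h6 := h4.deriv
      simp only [mul_zero, ePi_zero, sub_self, zero_mul, add_zero] at h6
      exact h6
    rw [h5]
    refine mul_ne_zero (neg_ne_zero.mpr (mul_ne_zero two_ne_zero
      (mul_ne_zero Complex.I_ne_zero ?_))) hG0
    exact_mod_cast Real.pi_ne_zero
  have hmd : Differentiable ℂ (thetaMult τ) :=
    differentiable_ePi.comp (((differentiable_const _).sub (differentiable_id.const_mul 2)).sub_const 1)
  set T : ℂ → ℂ := fun v => ePi (-v) * bigTheta (ePi (2 * τ)) (ePi (2 * v)) with hT
  -- simplicity of the zeros propagates along the lattice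
  have hs : ∀ v, (T v = 0 ∧ deriv T v = 0) → False := by
    intro v hv
    obtain ⟨a, b, rfl⟩ := hz v hv.1
    -- A function with values 0 and 1 whose zeros are the multiple zeros of T, so that
    -- `eq_zero_of_quasiPeriodic` can move such a zero back to the origin.
    let f : ℂ → ℂ := fun v => if (T v = 0 ∧ deriv T v = 0) then 0 else 1
    have d1 : ∀ v, deriv T (v + 1) = -deriv T v := by
      intro v
      rw [← deriv_comp_add_const, ← deriv.fun_neg]
      congr 1
      exact funext h1
    have d2 : ∀ v, T v = 0 → deriv T (v + τ) = thetaMult τ v * deriv T v := by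
      intro v hv
      rw [← deriv_comp_add_const, show (fun x => T (x + τ)) = fun x => thetaMult τ x * T x from
        funext h2, deriv_fun_mul (hmd v) (hdiff v), hv]
      ring
    have key := eq_zero_of_quasiPeriodic (τ := τ) (f := f) (fun v => by
        have e1 : T (v + 1) = -T v := h1 v
        simp only [f, e1, d1, neg_eq_zero]) (fun v => by
        have e1 : T (v + τ) = thetaMult τ v * T v := h2 v
        have hm : thetaMult τ v ≠ 0 := ePi_ne_zero _
        have : (T (v + τ) = 0 ∧ deriv T (v + τ) = 0) ↔ (T v = 0 ∧ deriv T v = 0) := by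
          constructor
          · rintro ⟨a1, a2⟩
            rw [e1] at a1
            have a3 := (mul_eq_zero.mp a1).resolve_left hm
            rw [d2 v a3] at a2
            exact ⟨a3, (mul_eq_zero.mp a2).resolve_left hm⟩
          · rintro ⟨a1, a2⟩
            rw [e1, d2 v a1, a1, a2, mul_zero]
            exact ⟨rfl, rfl⟩
        simp only [f, this]) 0 a b
    rw [zero_add] at key
    have : f 0 = 0 := key.mp (by simp only [f, hv, and_self, if_true])
    by_cases h : T 0 = 0 ∧ deriv T 0 = 0
    · exact hd0 h.2
    · simp only [f, h, if_false] at this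
      exact one_ne_zero this
  exact ⟨hτ, ⟨hdiff, fun x hx hx' => hs x ⟨hx, hx'⟩⟩, fun v => ePi_ne_zero _, hmd.continuous, h1, h2,
    h0, hz⟩

/-! ## Theta functions with characteristics -/

theorem thetaChar_eq (γ₁ γ₂ ξ τ : ℂ) : thetaChar γ₁ γ₂ ξ τ =
    ePi (γ₁ ^ 2 * τ + 2 * γ₁ * (ξ + γ₂)) * jacobiTheta₂ (ξ + γ₂ + γ₁ * τ) τ := by
  rw [thetaChar, jacobiTheta₂, ← tsum_mul_left]
  refine tsum_congr fun m => ?_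
  rw [jacobiTheta₂_term, ePi, ← Complex.exp_add]
  congr 1
  ring

theorem thetaChar_shift (γ₁ γ₂ x y ξ τ : ℂ) : thetaChar (γ₁ + x) (γ₂ + y) ξ τ =
    ePi (x ^ 2 * τ + 2 * x * (ξ + γ₂ + y)) * thetaChar γ₁ γ₂ (ξ + y + x * τ) τ := by
  rw [thetaChar_eq, thetaChar_eq, ← mul_assoc, ← ePi_add]
  congr 2
  · ring
  · ring

theorem thetaChar_add_one_left (γ₁ γ₂ ξ τ : ℂ) :
    thetaChar (γ₁ + 1) γ₂ ξ τ = thetaChar γ₁ γ₂ ξ τ := by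
  rw [thetaChar, thetaChar, ← (Equiv.addRight (1 : ℤ)).tsum_eq fun m : ℤ =>
    Complex.exp (Complex.I * Real.pi * ((m : ℂ) + γ₁) ^ 2 * τ
    + 2 * Complex.I * Real.pi * ((m : ℂ) + γ₁) * (ξ + γ₂))]
  refine tsum_congr fun m => ?_
  simp only [Equiv.coe_addRight, Int.cast_add, Int.cast_one]
  congr 1
  ring

theorem thetaChar_add_one (γ₁ γ₂ ξ τ : ℂ) :
    thetaChar γ₁ γ₂ (ξ + 1) τ = ePi (2 * γ₁) * thetaChar γ₁ γ₂ ξ τ := by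
  rw [thetaChar_eq, thetaChar_eq, show ξ + 1 + γ₂ + γ₁ * τ = ξ + γ₂ + γ₁ * τ + 1 by ring,
    jacobiTheta₂_add_left, ← mul_assoc, ← ePi_add]
  congr 2
  ring

theorem thetaChar_add_tau (γ₁ γ₂ ξ τ : ℂ) :
    thetaChar γ₁ γ₂ (ξ + τ) τ = ePi (-τ - 2 * (ξ + γ₂)) * thetaChar γ₁ γ₂ ξ τ := by
  -- Raising γ₁ by 1 relabels the summation index; read as a shift of the characteristic it is the
  -- translation by τ.
  have h := thetaChar_shift γ₁ γ₂ 1 0 ξ τ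
  rw [add_zero, thetaChar_add_one_left] at h
  rw [h, ← mul_assoc, ← ePi_add]
  simp only [add_zero, one_mul]
  rw [show -τ - 2 * (ξ + γ₂) + (1 ^ 2 * τ + 2 * 1 * (ξ + γ₂)) = 0 by ring, ePi_zero, one_mul]

theorem thetaChar_add_one_right (γ₁ γ₂ ξ τ : ℂ) :
    thetaChar γ₁ (γ₂ + 1) ξ τ = ePi (2 * γ₁) * thetaChar γ₁ γ₂ ξ τ := by
  have h := thetaChar_shift γ₁ γ₂ 0 1 ξ τ
  rw [add_zero] at h
  rw [h, zero_mul, add_zero, thetaChar_add_one]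
  rw [show (0 : ℂ) ^ 2 * τ + 2 * 0 * (ξ + γ₂ + 1) = 0 by ring, ePi_zero, one_mul]

theorem thetaChar_neg (γ₁ γ₂ ξ τ : ℂ) :
    thetaChar (-γ₁) (-γ₂) (-ξ) τ = thetaChar γ₁ γ₂ ξ τ := by
  rw [thetaChar, thetaChar, ← (Equiv.neg ℤ).tsum_eq fun m : ℤ =>
    Complex.exp (Complex.I * Real.pi * ((m : ℂ) + γ₁) ^ 2 * τ
    + 2 * Complex.I * Real.pi * ((m : ℂ) + γ₁) * (ξ + γ₂))]
  refine tsum_congr fun m => ?_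
  simp only [Equiv.neg_apply, Int.cast_neg]
  congr 1
  ring

theorem differentiable_thetaChar (γ₁ γ₂ : ℂ) {τ : ℂ} (hτ : 0 < τ.im) :
    Differentiable ℂ fun ξ => thetaChar γ₁ γ₂ ξ τ := by
  simp only [thetaChar_eq]
  have h1 : Differentiable ℂ fun z => jacobiTheta₂ z τ :=
    fun z => differentiableAt_jacobiTheta₂_fst z hτ
  have h2 : Differentiable ℂ fun ξ : ℂ => jacobiTheta₂ (ξ + γ₂ + γ₁ * τ) τ :=
    h1.comp ((differentiable_id.add_const _).add_const _)
  have h3 : Differentiable ℂ fun ξ : ℂ => ePi (γ₁ ^ 2 * τ + 2 * γ₁ * (ξ + γ₂)) :=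
    differentiable_ePi.comp (((differentiable_id.add_const _).const_mul _).const_add _)
  exact h3.mul h2

/-- The theta function does not vanish identically: its zeroth Fourier coefficient is `1`. -/
theorem exists_jacobiTheta₂_ne_zero {τ : ℂ} (hτ : 0 < τ.im) : ∃ z, jacobiTheta₂ z τ ≠ 0 := by
  by_contra hcon
  push Not at hcon
  -- Termwise integration over one period: every index other than 0 integrates to 0, and the index 0
  -- gives 1.
  have hsum : HasSum (fun n : ℤ => ∫ x in (0 : ℝ)..1, jacobiTheta₂_term n (x : ℂ) τ)
      (∫ x in (0 : ℝ)..1, jacobiTheta₂ (x : ℂ) τ) := by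
    have hc : ∀ n : ℤ, Continuous fun x : ℝ => jacobiTheta₂_term n (x : ℂ) τ := fun n => by
      unfold jacobiTheta₂_term
      fun_prop
    have hnorm : ∀ (n : ℤ) (x : ℝ), ‖jacobiTheta₂_term n (x : ℂ) τ‖ =
        ‖jacobiTheta₂_term n 0 τ‖ := fun n x => by
      rw [norm_jacobiTheta₂_term, norm_jacobiTheta₂_term]
      simp
    refine intervalIntegral.hasSum_integral_of_dominated_convergence
      (fun n _ => ‖jacobiTheta₂_term n 0 τ‖)
      (fun n => (hc n).aestronglyMeasurable) (fun n => .of_forall fun x _ => (hnorm n x).le)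
      (.of_forall fun x _ => ((summable_jacobiTheta₂_term_iff 0 τ).mpr hτ).norm)
      (by simp) (.of_forall fun x _ => hasSum_jacobiTheta₂_term _ hτ)
  have hint : ∀ n : ℤ, n ≠ 0 → ∫ x in (0 : ℝ)..1, jacobiTheta₂_term n (x : ℂ) τ = 0 := by
    intro n hn
    have hc : 2 * (Real.pi : ℂ) * Complex.I * n ≠ 0 := by
      simp [hn, Real.pi_ne_zero, Complex.I_ne_zero]
    have : ∀ x : ℝ, jacobiTheta₂_term n (x : ℂ) τ =
        Complex.exp (Real.pi * Complex.I * n ^ 2 * τ) *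
          Complex.exp (2 * Real.pi * Complex.I * n * x) := fun x => by
      rw [jacobiTheta₂_term, ← Complex.exp_add, add_comm]
    simp only [this]
    rw [intervalIntegral.integral_const_mul, integral_exp_mul_complex hc]
    have h1 : Complex.exp (2 * Real.pi * Complex.I * n) = 1 := by
      rw [show 2 * (Real.pi : ℂ) * Complex.I * n = n * (2 * Real.pi * Complex.I) by ring]
      exact Complex.exp_int_mul_two_pi_mul_I n
    simp [h1]
  have h2 := hsum.unique (hasSum_single 0 hint)
  simp [hcon, jacobiTheta₂_term] at h2

/-- Series and product have the same multipliers, hence are proportional. This is Jacobi's triple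
product with an undetermined constant; later only its being nonzero matters. -/
theorem orderOne_thetaChar {τ : ℂ} (hτ : 0 < τ.im) :
    (∃ C, C ≠ 0 ∧ ∀ v, thetaChar (1 / 2) (1 / 2) v τ =
      C * (ePi (-v) * bigTheta (ePi (2 * τ)) (ePi (2 * v)))) ∧
    OrderOne τ (thetaMult τ) fun v => thetaChar (1 / 2) (1 / 2) v τ := by
  have hP := orderOne_bigTheta hτ
  have hd := differentiable_thetaChar (1 / 2) (1 / 2) hτ
  have h1 : ∀ v, thetaChar (1 / 2) (1 / 2) (v + 1) τ = -thetaChar (1 / 2) (1 / 2) v τ := fun v => by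
    rw [thetaChar_add_one, show (2 : ℂ) * (1 / 2) = 1 by norm_num, ePi_one]
    ring
  have h2 : ∀ v, thetaChar (1 / 2) (1 / 2) (v + τ) τ =
      thetaMult τ v * thetaChar (1 / 2) (1 / 2) v τ := fun v => by
    rw [thetaChar_add_tau, thetaMult]
    congr 2
    ring
  obtain ⟨C, hC⟩ := hP.proportional (thetaMult_add_half τ) hd h1 h2
  have hC0 : C ≠ 0 := by
    rintro rfl
    obtain ⟨z, hz⟩ := exists_jacobiTheta₂_ne_zero hτ
    refine hz ?_
    have h3 := hC (z - 1 / 2 - 1 / 2 * τ)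
    rw [zero_mul, thetaChar_eq] at h3
    rw [show z - 1 / 2 - 1 / 2 * τ + 1 / 2 + 1 / 2 * τ = z by ring] at h3
    exact (mul_eq_zero.mp h3).resolve_left (ePi_ne_zero _)
  refine ⟨⟨C, hC0, hC⟩, hτ, ?_, hP.mult_ne_zero, hP.mult_cont, h1, h2, ?_, fun v hv => ?_⟩
  · have h3 := hP.simple.twist (e := fun _ => C) (differentiable_const C) (fun _ => hC0) 0
    simp only [add_zero, ← hC] at h3
    exact h3
  · rw [hC, hP.zero, mul_zero]
  · rw [hC] at hv
    exact hP.exists_of_eq_zero v ((mul_eq_zero.mp hv).resolve_left hC0)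

/-! ### Characteristics in (1/N)ℤ²: shifts, symmetries and zeros -/

/-- The theta function with characteristics `(1/2 + a/N, 1/2 + b/N)`. -/
noncomputable def thetaN (N : ℕ) (τ : ℂ) (β : ℤ × ℤ) (v : ℂ) : ℂ :=
  thetaChar (1 / 2 + β.1 / N) (1 / 2 + β.2 / N) v τ

/-- The odd theta function. -/
noncomputable abbrev oddTheta (τ v : ℂ) : ℂ := thetaChar (1 / 2) (1 / 2) v τ

theorem thetaN_zero (N : ℕ) (τ v : ℂ) : thetaN N τ 0 v = oddTheta τ v := by
  simp [thetaN, oddTheta]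

theorem oddTheta_neg (τ v : ℂ) : oddTheta τ (-v) = -oddTheta τ v := by
  have h := thetaChar_neg (-(1 / 2)) (-(1 / 2)) v τ
  rw [neg_neg] at h
  rw [oddTheta, h]
  have h2 := thetaChar_add_one_left (-(1 / 2)) (-(1 / 2)) v τ
  have h3 := thetaChar_add_one_right (-(1 / 2) + 1) (-(1 / 2)) v τ
  rw [show (-(1 / 2) + 1 : ℂ) = 1 / 2 by norm_num] at h2 h3
  rw [← h2, oddTheta, h3, show (2 : ℂ) * (1 / 2) = 1 by norm_num, ePi_one]
  ring

section

variable {N : ℕ} (τ : ℂ) (β : ℤ × ℤ) (v : ℂ)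

theorem thetaN_add_one : thetaN N τ β (v + 1) = -ePi (2 * β.1 / N) * thetaN N τ β v := by
  rw [thetaN, thetaChar_add_one,
    show (2 : ℂ) * (1 / 2 + β.1 / N) = 1 + 2 * β.1 / N by ring, ePi_add, ePi_one]
  simp only [thetaN]
  ring

theorem thetaN_add_tau :
    thetaN N τ β (v + τ) = ePi (-(2 * β.2 / N)) * (thetaMult τ v * thetaN N τ β v) := by
  rw [thetaN, thetaChar_add_tau, thetaMult, ← mul_assoc, ← ePi_add, thetaN]
  congr 2
  ring

theorem thetaN_add_inv :
    thetaN N τ β (v + 1 / N) = thetaN N τ (β + (0, 1)) v := by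
  have h := thetaChar_shift (1 / 2 + β.1 / N) (1 / 2 + β.2 / N) 0 (1 / N) v τ
  rw [show (0 : ℂ) ^ 2 * τ + 2 * 0 * (v + (1 / 2 + β.2 / N) + 1 / N) = 0 by ring, ePi_zero, one_mul,
    zero_mul, add_zero, add_zero] at h
  rw [thetaN, ← h, thetaN]
  congr 1
  · simp
  · simp
    ring

theorem thetaN_add_tau_div :
    thetaN N τ β (v + τ / N) =
      ePi (-τ / N ^ 2 - 2 / N * (v + 1 / 2 + β.2 / N)) * thetaN N τ (β + (1, 0)) v := by
  have h := thetaChar_shift (1 / 2 + β.1 / N) (1 / 2 + β.2 / N) (1 / N) 0 v τ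
  rw [add_zero, add_zero, add_zero, show 1 / (N : ℂ) * τ = τ / N by ring] at h
  have h2 : thetaN N τ (β + (1, 0)) v =
      thetaChar (1 / 2 + β.1 / N + 1 / N) (1 / 2 + β.2 / N) v τ := by
    rw [thetaN]
    congr 1
    · simp
      ring
    · simp
  rw [h2, h, ← mul_assoc, ← ePi_add, thetaN,
    show -τ / (N : ℂ) ^ 2 - 2 / N * (v + 1 / 2 + β.2 / N) +
      ((1 / (N : ℂ)) ^ 2 * τ + 2 * (1 / N) * (v + (1 / 2 + β.2 / N))) = 0 by ring,
    ePi_zero, one_mul]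

theorem thetaN_add_left [NeZero N] : thetaN N τ (β + ((N : ℤ), 0)) v = thetaN N τ β v := by
  have hN : (N : ℂ) ≠ 0 := NeZero.ne _
  rw [thetaN, thetaN, ← thetaChar_add_one_left (1 / 2 + β.1 / N)]
  congr 1
  · simp only [Prod.fst_add, Int.cast_add, Int.cast_natCast]
    field_simp
    ring
  · simp

/-- The label lives in ℤ² rather than (ℤ/N)² because of this factor; it does not depend on v, so
quotients of values of the same theta function are periodic in the label. -/
theorem thetaN_add_right [NeZero N] :
    thetaN N τ (β + (0, (N : ℤ))) v = -ePi (2 * β.1 / N) * thetaN N τ β v := by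
  have hN : (N : ℂ) ≠ 0 := NeZero.ne _
  rw [← thetaN_add_one, thetaN, thetaN, thetaChar_add_one,
    ← thetaChar_add_one_right (1 / 2 + β.1 / N)]
  congr 1
  · simp
  · simp only [Prod.snd_add, Int.cast_add, Int.cast_natCast]
    field_simp
    ring

theorem thetaN_neg : thetaN N τ (-β) (-v) = -ePi (-(2 * β.1 / N)) * thetaN N τ β v := by
  have h := thetaChar_neg (-(1 / 2) + β.1 / N) (-(1 / 2) + β.2 / N) v τ
  have h1 : thetaN N τ (-β) (-v) =
      thetaChar (-(1 / 2) + β.1 / N) (-(1 / 2) + β.2 / N) v τ := by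
    rw [← h, thetaN]
    congr 1 <;> simp <;> ring
  have h2 := thetaChar_add_one_left (-(1 / 2) + β.1 / N) (-(1 / 2) + β.2 / N) v τ
  have h3 := thetaChar_add_one_right (1 / 2 + β.1 / N) (-(1 / 2) + β.2 / N) v τ
  rw [show (-(1 / 2) + β.1 / N + 1 : ℂ) = 1 / 2 + β.1 / N by ring] at h2
  rw [show (-(1 / 2) + β.2 / N + 1 : ℂ) = 1 / 2 + β.2 / N by ring,
    show (2 : ℂ) * (1 / 2 + β.1 / N) = 1 + 2 * β.1 / N by ring, ePi_add, ePi_one] at h3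
  rw [h1, ← h2, thetaN, h3, ePi_neg]
  have := ePi_ne_zero (2 * β.1 / N)
  field_simp

/-- The point `(aτ + b)/N`. -/
noncomputable def torsion (N : ℕ) (τ : ℂ) (β : ℤ × ℤ) : ℂ := (β.1 * τ + β.2) / N

theorem thetaN_eq : thetaN N τ β v =
    ePi ((β.1 / N) ^ 2 * τ + 2 * (β.1 / N) * (v + 1 / 2 + β.2 / N)) *
      oddTheta τ (v + torsion N τ β) := by
  rw [thetaN, thetaChar_shift, torsion]
  congr 2
  ring

variable {τ}

theorem simpleZeros_thetaN (hτ : 0 < τ.im) : SimpleZeros (thetaN N τ β) := by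
  have h : thetaN N τ β = fun v => _ := funext fun v => thetaN_eq τ β v
  rw [h]
  refine (orderOne_thetaChar hτ).2.simple.twist
    (e := fun v => ePi ((β.1 / N) ^ 2 * τ + 2 * (β.1 / N) * (v + 1 / 2 + β.2 / N)))
    (differentiable_ePi.comp ?_) (fun v => ePi_ne_zero _) (torsion N τ β)
  exact (((differentiable_id.add_const _).add_const _).const_mul _).const_add _

theorem thetaN_eq_zero_iff [NeZero N] (hτ : 0 < τ.im) : thetaN N τ β v = 0 ↔
    ∃ a b : ℤ, N * v = (N * b - β.2) + (N * a - β.1) * τ := by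
  have hN : (N : ℂ) ≠ 0 := NeZero.ne _
  rw [thetaN_eq, mul_eq_zero, or_iff_right (ePi_ne_zero _),
    (orderOne_thetaChar hτ).2.eq_zero_iff, exists_comm]
  refine exists_congr fun a => exists_congr fun b => ?_
  rw [torsion]
  constructor
  · intro h
    have : v = b + a * τ - (β.1 * τ + β.2) / N := by linear_combination h
    rw [this]
    field_simp
    ring
  · intro h
    have : v = ((N * b - β.2) + (N * a - β.1) * τ) / N := by rw [← h]; field_simp
    rw [this]
    field_simp
    ring

theorem oddTheta_eq_zero_iff (hτ : 0 < τ.im) : oddTheta τ v = 0 ↔ ∃ a b : ℤ, v = a + b * τ :=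
  (orderOne_thetaChar hτ).2.eq_zero_iff v

end

/-! ## Sums over `(ℤ/N)²` -/

theorem sum_fin_shift {M : Type*} [AddCommMonoid M] (N : ℕ) {f : ℤ → M}
    (hf : Function.Periodic f N) (n : ℤ) : ∑ i : Fin N, f (i + n) = ∑ i : Fin N, f i := by
  have step : ∀ g : ℤ → M, Function.Periodic g N →
      ∑ i : Fin N, g (i + 1) = ∑ i : Fin N, g i := by
    intro g hg
    have e1 := Fin.sum_univ_eq_sum_range (fun i : ℕ => g ((i : ℤ) + 1)) N
    have e2 := Fin.sum_univ_eq_sum_range (fun i : ℕ => g (i : ℤ)) N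
    rw [e1, e2]
    cases N with
    | zero => rfl
    | succ k =>
      rw [Finset.sum_range_succ, Finset.sum_range_succ']
      have h0 := hg 0
      rw [zero_add] at h0
      push_cast at h0 ⊢
      rw [h0]
  induction n with
  | zero => simp
  | succ k ih =>
    rw [← ih, ← step (fun i => f (i + k)) fun x => ?_]
    · exact Finset.sum_congr rfl fun i _ => by rw [add_assoc, add_comm (1 : ℤ)]
    · change f (x + N + k) = f (x + k)
      rw [add_right_comm, hf]
  | pred k ih =>
    rw [← ih, ← step (fun i => f (i + (-k - 1))) fun x => ?_]
    · exact Finset.sum_congr rfl fun i _ => by congr 1; ring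
    · change f (x + N + (-k - 1)) = f (x + (-k - 1))
      rw [add_right_comm, hf]

theorem sum_fin_neg {M : Type*} [AddCommMonoid M] (N : ℕ) {f : ℤ → M}
    (hf : Function.Periodic f N) : ∑ i : Fin N, f (-i) = ∑ i : Fin N, f i := by
  -- The reversal sends i to N - 1 - i, whose negative is i + (1 - N).
  rw [← Equiv.sum_comp Fin.revPerm, ← sum_fin_shift N hf (1 - N)]
  refine Finset.sum_congr rfl fun i _ => ?_
  congr 1
  have := i.2
  rw [Fin.revPerm_apply, Fin.val_rev]
  omega

/-- The integer representatives of an element of `Fin N × Fin N`. -/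
def finInt {N : ℕ} (β : Fin N × Fin N) : ℤ × ℤ := ((β.1 : ℤ), (β.2 : ℤ))

/-- Periodicity with respect to `N ℤ²`. -/
structure LatticePeriodic {M : Type*} (N : ℕ) (φ : ℤ × ℤ → M) : Prop where
  left : ∀ β, φ (β + ((N : ℤ), 0)) = φ β
  right : ∀ β, φ (β + (0, (N : ℤ))) = φ β

section

variable {M : Type*} [AddCommMonoid M] {N : ℕ} {φ : ℤ × ℤ → M}

theorem LatticePeriodic.sum_shift (h : LatticePeriodic N φ) (γ : ℤ × ℤ) :
    ∑ β : Fin N × Fin N, φ (finInt β + γ) = ∑ β : Fin N × Fin N, φ (finInt β) := by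
  rw [Fintype.sum_prod_type, Fintype.sum_prod_type]
  have h1 : ∀ a : ℤ, Function.Periodic (fun b => φ (a, b)) N := fun a b => by
    simpa using h.right (a, b)
  have h2 : Function.Periodic (fun a => ∑ y : Fin N, φ (a, y)) N := fun a =>
    Finset.sum_congr rfl fun y _ => by simpa using h.left (a, y)
  change ∑ x : Fin N, ∑ y : Fin N, φ ((x : ℤ) + γ.1, (y : ℤ) + γ.2) =
    ∑ x : Fin N, ∑ y : Fin N, φ ((x : ℤ), (y : ℤ))
  rw [← sum_fin_shift N h2 γ.1]
  exact Finset.sum_congr rfl fun x _ => sum_fin_shift N (h1 (x + γ.1)) γ.2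

theorem LatticePeriodic.sum_neg (h : LatticePeriodic N φ) :
    ∑ β : Fin N × Fin N, φ (-finInt β) = ∑ β : Fin N × Fin N, φ (finInt β) := by
  rw [Fintype.sum_prod_type, Fintype.sum_prod_type]
  have h1 : ∀ a : ℤ, Function.Periodic (fun b => φ (a, b)) N := fun a b => by
    simpa using h.right (a, b)
  have h2 : Function.Periodic (fun a => ∑ y : Fin N, φ (a, y)) N := fun a =>
    Finset.sum_congr rfl fun y _ => by simpa using h.left (a, y)
  change ∑ x : Fin N, ∑ y : Fin N, φ (-(x : ℤ), -(y : ℤ)) =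
    ∑ x : Fin N, ∑ y : Fin N, φ ((x : ℤ), (y : ℤ))
  rw [← sum_fin_neg N h2]
  exact Finset.sum_congr rfl fun x _ => sum_fin_neg N (h1 (-x))

end

/-- The symplectic character `ω^{β₁δ₂ - β₂δ₁}`. -/
noncomputable def chi (N : ℕ) (β δ : ℤ × ℤ) : ℂ := ePi (2 * (β.1 * δ.2 - β.2 * δ.1) / N)

section

variable {N : ℕ} (β γ δ : ℤ × ℤ)

theorem chi_ne_zero : chi N β δ ≠ 0 := ePi_ne_zero _

theorem chi_add_left : chi N (β + γ) δ = chi N β δ * chi N γ δ := by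
  simp only [chi, ← ePi_add, Prod.fst_add, Prod.snd_add, Int.cast_add]
  congr 1
  ring

theorem chi_neg_left : chi N (-β) δ = (chi N β δ)⁻¹ := by
  simp only [chi, ← ePi_neg, Prod.fst_neg, Prod.snd_neg, Int.cast_neg]
  congr 1
  ring

theorem chi_swap : chi N δ β = (chi N β δ)⁻¹ := by
  simp only [chi, ← ePi_neg]
  congr 1
  ring

theorem chi_neg_right : chi N β (-δ) = (chi N β δ)⁻¹ := by
  rw [chi_swap (-δ) β, chi_neg_left, inv_inv, chi_swap β δ]

theorem chi_self : chi N β β = 1 := by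
  rw [chi, show (2 * ((β.1 : ℂ) * β.2 - β.2 * β.1) / N) = 0 by ring, ePi_zero]

theorem chi_zero_left : chi N 0 δ = 1 := by
  simp [chi, ePi_zero]

theorem chi_unit_left : chi N (1, 0) δ = ePi (2 * δ.2 / N) := by
  simp [chi]

theorem chi_unit_right : chi N (0, 1) δ = ePi (-(2 * δ.1 / N)) := by
  rw [chi]
  congr 1
  simp
  ring

theorem chi_left_period [NeZero N] : chi N ((N : ℤ), 0) δ = 1 := by
  have hN : (N : ℂ) ≠ 0 := NeZero.ne _
  rw [chi, show (2 * ((((N : ℤ), (0 : ℤ)).1 : ℂ) * δ.2 - (((N : ℤ), (0 : ℤ)).2 : ℂ) * δ.1) / N) =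
    2 * (δ.2 : ℤ) by simp; field_simp]
  exact ePi_two_mul_int _

theorem chi_right_period [NeZero N] : chi N (0, (N : ℤ)) δ = 1 := by
  have hN : (N : ℂ) ≠ 0 := NeZero.ne _
  rw [chi, show (2 * ((((0 : ℤ), (N : ℤ)).1 : ℂ) * δ.2 - (((0 : ℤ), (N : ℤ)).2 : ℂ) * δ.1) / N) =
    2 * ((-δ.1 : ℤ) : ℂ) by simp; field_simp]
  exact ePi_two_mul_int _

end

/-- Two complex numbers `a + bτ` with integer coordinates agree only if the coordinates do. -/
theorem lattice_inj {τ : ℂ} (hτ : 0 < τ.im) {a b a' b' : ℤ}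
    (h : (a : ℂ) + b * τ = a' + b' * τ) : a = a' ∧ b = b' := by
  have him := congrArg Complex.im h
  have hb : b = b' := by
    have h1 : (b : ℝ) * τ.im = b' * τ.im := by simpa using him
    exact_mod_cast mul_right_cancel₀ hτ.ne' h1
  subst hb
  exact ⟨by exact_mod_cast add_right_cancel h, rfl⟩

/-! ## Sums of quotients of theta functions over torsion points -/

section

variable {N : ℕ} {τ : ℂ}

theorem differentiable_thetaN (hτ : 0 < τ.im) (β : ℤ × ℤ) : Differentiable ℂ (thetaN N τ β) :=
  differentiable_thetaChar _ _ hτ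

theorem differentiable_oddTheta (hτ : 0 < τ.im) : Differentiable ℂ (oddTheta τ) :=
  differentiable_thetaChar _ _ hτ

/-- Compare derivatives at the simple zero 0: the quotient θ(Nu)/θ(u) tends to N. -/
theorem quotient_at_zero (hτ : 0 < τ.im) {H : ℂ → ℂ} (hH : Differentiable ℂ H)
    (h : ∀ u, oddTheta τ (N * u) = H u * oddTheta τ u) : H 0 = N := by
  have hO := (orderOne_thetaChar hτ).2
  have hd := differentiable_oddTheta hτ
  have h1 : deriv (fun u => oddTheta τ (N * u)) 0 = N * deriv (oddTheta τ) 0 := by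
    have := deriv_comp_mul_left (N : ℂ) (oddTheta τ) 0
    simpa using this
  have h2 : deriv (fun u => H u * oddTheta τ u) 0 = deriv H 0 * oddTheta τ 0 +
      H 0 * deriv (oddTheta τ) 0 := deriv_fun_mul (hH 0) (hd 0)
  have h0 : oddTheta τ 0 = 0 := hO.zero
  rw [funext h, h2, h0, mul_zero, zero_add] at h1
  exact mul_right_cancel₀ (hO.simple.deriv_ne_zero 0 h0) h1

variable [NeZero N]

/-- All zeros of θ_β are N-torsion points of ℂ/(ℤ + ℤτ). Hence θ(Nu) is a common multiple of the
denominators θ_β(u), and multiplying by it makes sums of such quotients entire. -/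
theorem oddTheta_natMul_eq_zero (hτ : 0 < τ.im) {β : ℤ × ℤ} {v : ℂ} (h : thetaN N τ β v = 0) :
    oddTheta τ (N * v) = 0 := by
  obtain ⟨a, b, hab⟩ := (thetaN_eq_zero_iff β v hτ).mp h
  exact (oddTheta_eq_zero_iff _ hτ).mpr ⟨N * b - β.2, N * a - β.1, by push_cast; exact hab⟩

theorem thetaN_finInt_zero_ne (hτ : 0 < τ.im) {β : Fin N × Fin N} (hβ : β ≠ 0) :
    thetaN N τ (finInt β) 0 ≠ 0 := by
  intro h
  obtain ⟨a, b, hab⟩ := (thetaN_eq_zero_iff _ _ hτ).mp h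
  have h2 := lattice_inj hτ (a := 0) (b := 0) (a' := N * b - (finInt β).2)
    (b' := N * a - (finInt β).1) (by push_cast; rw [← hab]; ring)
  simp only [finInt] at h2
  refine hβ (Prod.ext (Fin.ext ?_) (Fin.ext ?_))
  · have h3 : ((β.1 : ℕ) : ℤ) = N * a := by linarith [h2.2]
    have : N ∣ (β.1 : ℕ) := by exact_mod_cast Dvd.intro _ h3.symm
    simpa using Nat.eq_zero_of_dvd_of_lt this β.1.2
  · have h3 : ((β.2 : ℕ) : ℤ) = N * b := by linarith [h2.1]
    have : N ∣ (β.2 : ℕ) := by exact_mod_cast Dvd.intro _ h3.symm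
    simpa using Nat.eq_zero_of_dvd_of_lt this β.2.2

/-- Moving v = Nu by 1 or τ moves u by 1/N or τ/N, which only permutes the labels β; the sum over
all labels absorbs the permutation and keeps the scalars c₁, c₂. The identities are obtained off the
zeros of θ and extended by `SimpleZeros.cancel`. -/
theorem torsionSum_multipliers (hτ : 0 < τ.im) {φ : ℂ → ℤ × ℤ → ℂ}
    (hφ : ∀ u, LatticePeriodic N (φ u)) {c₁ c₂ : ℂ}
    (h1 : ∀ u β, φ (u + 1 / N) β = c₁ * φ u (β + (0, 1)))
    (h2 : ∀ u β, φ (u + τ / N) β = c₂ * φ u (β + (1, 0))) {f : ℂ → ℂ} (hf : Continuous f)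
    (hfφ : ∀ u, oddTheta τ (N * u) ≠ 0 →
      f (N * u) = (∑ β : Fin N × Fin N, φ u (finInt β)) * oddTheta τ (N * u)) :
    (∀ v, f (v + 1) = -c₁ * f v) ∧ ∀ v, f (v + τ) = c₂ * (thetaMult τ v * f v) := by
  have hN : (N : ℂ) ≠ 0 := NeZero.ne _
  have hO := (orderOne_thetaChar hτ).2
  have hm := hO.mult_cont
  have hfv : ∀ v, oddTheta τ v ≠ 0 →
      f v = (∑ β : Fin N × Fin N, φ (v / N) (finInt β)) * oddTheta τ v := by
    intro v hv
    have := hfφ (v / N)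
    rw [mul_div_cancel₀ _ hN] at this
    exact this hv
  have a1 : ∀ v, oddTheta τ (v + 1) = -oddTheta τ v := hO.add_one
  have a2 : ∀ v, oddTheta τ (v + τ) = thetaMult τ v * oddTheta τ v := hO.add_tau
  constructor
  · refine hO.simple.cancel (G := fun v => f (v + 1)) (H := fun v => -c₁ * f v)
      (by fun_prop) (by fun_prop) fun v => ?_
    change f (v + 1) * oddTheta τ v = -c₁ * f v * oddTheta τ v
    by_cases hv : oddTheta τ v = 0
    · rw [hv, mul_zero, mul_zero]
    · rw [hfv v hv, hfv (v + 1) (by rw [a1]; exact neg_ne_zero.mpr hv), a1, add_div]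
      simp only [h1, ← Finset.mul_sum]
      rw [(hφ (v / N)).sum_shift]
      ring
  · refine hO.simple.cancel (G := fun v => f (v + τ)) (H := fun v => c₂ * (thetaMult τ v * f v))
      (by fun_prop) (by fun_prop) fun v => ?_
    change f (v + τ) * oddTheta τ v = c₂ * (thetaMult τ v * f v) * oddTheta τ v
    by_cases hv : oddTheta τ v = 0
    · rw [hv, mul_zero, mul_zero]
    · rw [hfv v hv, hfv (v + τ) (by rw [a2]; exact mul_ne_zero (hO.mult_ne_zero v) hv), a2, add_div]
      simp only [h2, ← Finset.mul_sum]
      rw [(hφ (v / N)).sum_shift]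
      ring

/-- The finite Fourier transform of the quotients `θ_β(u + ξ) / θ_β(u)`. -/
theorem fourier_thetaN (hτ : 0 < τ.im) (δ : ℤ × ℤ) (ξ u : ℂ) (hu : oddTheta τ (N * u) ≠ 0) :
    (∑ β : Fin N × Fin N, chi N (finInt β) δ *
      (thetaN N τ (finInt β) (u + ξ) / thetaN N τ (finInt β) u)) *
      (oddTheta τ (N * u) * thetaN N τ δ (ξ / N)) =
    N * oddTheta τ ξ * thetaN N τ δ (N * u + ξ / N) := by
  have hN : (N : ℂ) ≠ 0 := NeZero.ne _
  have hO := (orderOne_thetaChar hτ).2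
  have hd := differentiable_oddTheta hτ
  have hdN := fun β => differentiable_thetaN (N := N) hτ β
  have hquot : ∀ β : ℤ × ℤ, ∃ D : ℂ → ℂ, Differentiable ℂ D ∧
      ∀ u, oddTheta τ (N * u) = D u * thetaN N τ β u := fun β =>
    (simpleZeros_thetaN β hτ).exists_quotient (f := fun u => oddTheta τ (N * u))
      (hd.comp (differentiable_id.const_mul _)) fun x hx => oddTheta_natMul_eq_zero hτ hx
  choose D hDd hD using hquot
  set φ : ℂ → ℤ × ℤ → ℂ := fun u β => chi N β δ * (thetaN N τ β (u + ξ) / thetaN N τ β u) with hφdef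
  -- The torsion sum times θ(Nu) as an entire function of v = Nu, with D_β(u) = θ(Nu)/θ_β(u) in
  -- place of the denominators.
  set f : ℂ → ℂ := fun v => ∑ β : Fin N × Fin N,
    chi N (finInt β) δ * (thetaN N τ (finInt β) (v / N + ξ) * D (finInt β) (v / N)) with hfdef
  have hfd : Differentiable ℂ f := by
    refine Differentiable.fun_sum fun β _ => ?_
    have e1 : Differentiable ℂ fun v : ℂ => v / N := differentiable_id.div_const _
    exact (((hdN _).comp (e1.add_const ξ)).mul ((hDd _).comp e1)).const_mul _
  have hfφ : ∀ u, oddTheta τ (N * u) ≠ 0 →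
      f (N * u) = (∑ β : Fin N × Fin N, φ u (finInt β)) * oddTheta τ (N * u) := by
    intro u hu
    simp only [hfdef, hφdef]
    rw [Finset.sum_mul]
    refine Finset.sum_congr rfl fun β _ => ?_
    have h0 : thetaN N τ (finInt β) u ≠ 0 := fun h => hu (by rw [hD (finInt β) u, h, mul_zero])
    rw [mul_div_cancel_left₀ _ hN, hD (finInt β) u]
    field_simp
  have hφp : ∀ u, LatticePeriodic N (φ u) := by
    refine fun u => ⟨fun β => ?_, fun β => ?_⟩
    · simp only [hφdef]
      rw [chi_add_left, chi_left_period, mul_one, thetaN_add_left, thetaN_add_left]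
    · simp only [hφdef]
      rw [chi_add_left, chi_right_period, mul_one, thetaN_add_right, thetaN_add_right,
        mul_div_mul_left _ _ (neg_ne_zero.mpr (ePi_ne_zero _))]
  obtain ⟨m1, m2⟩ := torsionSum_multipliers hτ hφp (c₁ := ePi (2 * δ.1 / N))
    (c₂ := ePi (-(2 * ξ / N) - 2 * δ.2 / N))
    (fun u β => by
      simp only [hφdef]
      rw [show u + 1 / N + ξ = u + ξ + 1 / N by ring, thetaN_add_inv, thetaN_add_inv, chi_add_left,
        chi_unit_right, ePi_neg]
      have := ePi_ne_zero (2 * δ.1 / N)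
      field_simp)
    (fun u β => by
      simp only [hφdef]
      rw [show u + τ / N + ξ = u + ξ + τ / N by ring, thetaN_add_tau_div, thetaN_add_tau_div,
        chi_add_left, chi_unit_left,
        show -τ / (N : ℂ) ^ 2 - 2 / N * (u + ξ + 1 / 2 + β.2 / N) =
          (-τ / (N : ℂ) ^ 2 - 2 / N * (u + 1 / 2 + β.2 / N)) - 2 * ξ / N by ring,
        ePi_sub (-τ / (N : ℂ) ^ 2 - 2 / N * (u + 1 / 2 + β.2 / N)), ePi_sub (-(2 * ξ / N)), ePi_neg]
      have := ePi_ne_zero (2 * δ.2 / N)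
      have := ePi_ne_zero (2 * ξ / N)
      have := ePi_ne_zero (-τ / (N : ℂ) ^ 2 - 2 / N * (u + 1 / 2 + β.2 / N))
      generalize ePi (-τ / (N : ℂ) ^ 2 - 2 / N * (u + 1 / 2 + β.2 / N)) = e at *
      rw [div_mul_eq_mul_div, mul_div_assoc e, mul_div_mul_left _ _ this]
      field_simp)
    hfd.continuous hfφ
  -- comparison with the shifted odd theta function
  set s : ℂ := ξ / N + torsion N τ δ with hs
  set e : ℂ → ℂ := fun v => ePi ((δ.1 / N) ^ 2 * τ + 2 * (δ.1 / N) * (v + ξ / N + 1 / 2 + δ.2 / N))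
    with he
  have hed : Differentiable ℂ e := differentiable_ePi.comp
    (((((differentiable_id.add_const _).add_const _).add_const _).const_mul _).const_add _)
  have he0 : ∀ v, e v ≠ 0 := fun v => ePi_ne_zero _
  have hg : ∀ v, thetaN N τ δ (v + ξ / N) = e v * oddTheta τ (v + s) := fun v => by
    rw [thetaN_eq, add_assoc v (ξ / N) (torsion N τ δ)]
  have hsub : Differentiable ℂ fun v : ℂ => v - s := differentiable_id.sub_const s
  -- Dividing by the exponential e and translating by s removes the twist from the multipliers of f,
  -- leaving exactly those of the odd theta function.
  obtain ⟨C, hC⟩ := hO.proportional (thetaMult_add_half τ) (f := fun v => f (v - s) / e (v - s))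
    ((hfd.comp hsub).div (hed.comp hsub) fun v => he0 _)
    (fun v => by
      have h1 : e (v - s + 1) = ePi (2 * δ.1 / N) * e (v - s) := by
        simp only [he, ← ePi_add]
        congr 1
        ring
      rw [show v + 1 - s = v - s + 1 by ring, m1, h1, neg_mul, neg_div,
        mul_div_mul_left _ _ (ePi_ne_zero _)])
    (fun v => by
      have h1 : e (v - s + τ) = ePi (2 * δ.1 * τ / N) * e (v - s) := by
        simp only [he, ← ePi_add]
        congr 1
        ring
      have h2 : ePi (-(2 * ξ / N) - 2 * δ.2 / N) * (thetaMult τ (v - s)) =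
          ePi (2 * δ.1 * τ / N) * thetaMult τ v := by
        simp only [thetaMult, ← ePi_add, hs, torsion]
        congr 1
        ring
      rw [show v + τ - s = v - s + τ by ring, m2, h1, ← mul_assoc, h2, mul_assoc,
        mul_div_mul_left _ _ (ePi_ne_zero _), mul_div_assoc])
  have hfC : ∀ v, f v = C * thetaN N τ δ (v + ξ / N) := fun v => by
    have h := hC (v + s)
    simp only [add_sub_cancel_right] at h
    rw [hg, div_eq_iff (he0 _)] at *
    rw [h]
    ring
  -- The constant is read off at v = 0, where only β = 0 survives: the other θ_β do not vanish
  -- there, so D_β does.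
  have hf0 : f 0 = N * oddTheta τ ξ := by
    have hz : ∀ β : Fin N × Fin N, β ≠ 0 → D (finInt β) 0 = 0 := fun β hβ => by
      have h := hD (finInt β) 0
      rw [mul_zero, show oddTheta τ 0 = 0 from hO.zero] at h
      exact (mul_eq_zero.mp h.symm).resolve_right (thetaN_finInt_zero_ne hτ hβ)
    simp only [hfdef]
    rw [Finset.sum_eq_single (0 : Fin N × Fin N)]
    · have h0 : finInt (0 : Fin N × Fin N) = 0 := by
        simp [finInt]
      have hD0 : D 0 0 = N := quotient_at_zero hτ (hDd 0) fun u => by rw [hD 0 u, thetaN_zero]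
      rw [h0, chi_zero_left, zero_div, zero_add, thetaN_zero, hD0]
      ring
    · intro β _ hβ
      rw [zero_div, hz β hβ]
      ring
    · intro h
      exact absurd (Finset.mem_univ _) h
  have hfu := hfφ u hu
  have h0 := hfC 0
  rw [zero_add, hf0] at h0
  rw [hfC] at hfu
  rw [h0]
  simp only [hφdef] at hfu
  linear_combination -thetaN N τ δ (ξ / N) * hfu

/-- The vanishing of the off-diagonal terms in the unitarity relation. -/
theorem unitarity_thetaN (hτ : 0 < τ.im) {γ : Fin N × Fin N} (hγ : γ ≠ 0) (ξ u : ℂ)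
    (hu : oddTheta τ (N * u) ≠ 0) :
    ∑ β : Fin N × Fin N, chi N (finInt β) (-finInt γ) *
      ((thetaN N τ (finInt β - finInt γ) (u + ξ) / thetaN N τ (finInt β - finInt γ) u) *
        (thetaN N τ (finInt β) (u - ξ) / thetaN N τ (finInt β) u)) = 0 := by
  have hN : (N : ℂ) ≠ 0 := NeZero.ne _
  have hO := (orderOne_thetaChar hτ).2
  have hd := differentiable_oddTheta hτ
  have hdN := fun β => differentiable_thetaN (N := N) hτ β
  set g := finInt γ with hg
  -- A common zero of θ_{β-γ} and θ_β would put γ into Nℤ². Hence the product of the two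
  -- denominators still has simple zeros and divides θ(Nu).
  have hdisj : ∀ (β : ℤ × ℤ) (x : ℂ), thetaN N τ (β - g) x = 0 → thetaN N τ β x ≠ 0 := by
    intro β x h1 h2
    obtain ⟨a, b, hab⟩ := (thetaN_eq_zero_iff _ _ hτ).mp h1
    obtain ⟨a', b', hab'⟩ := (thetaN_eq_zero_iff _ _ hτ).mp h2
    refine thetaN_finInt_zero_ne hτ hγ ((thetaN_eq_zero_iff _ _ hτ).mpr ⟨a' - a, b' - b, ?_⟩)
    have h3 := hab.symm.trans hab'
    simp only [Prod.fst_sub, Prod.snd_sub, Int.cast_sub] at h3 ⊢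
    linear_combination h3
  have hquot : ∀ β : ℤ × ℤ, ∃ D : ℂ → ℂ, Differentiable ℂ D ∧
      ∀ u, oddTheta τ (N * u) = D u * (thetaN N τ (β - g) u * thetaN N τ β u) := fun β =>
    ((simpleZeros_thetaN (β - g) hτ).mul (simpleZeros_thetaN β hτ) (hdisj β)).exists_quotient
      (f := fun u => oddTheta τ (N * u)) (hd.comp (differentiable_id.const_mul _)) fun x hx => by
        rcases mul_eq_zero.mp hx with h | h <;> exact oddTheta_natMul_eq_zero hτ h
  choose D hDd hD using hquot
  set φ : ℂ → ℤ × ℤ → ℂ := fun u β => chi N β (-g) *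
    ((thetaN N τ (β - g) (u + ξ) / thetaN N τ (β - g) u) *
      (thetaN N τ β (u - ξ) / thetaN N τ β u)) with hφdef
  set f : ℂ → ℂ := fun v => ∑ β : Fin N × Fin N, chi N (finInt β) (-g) *
    ((thetaN N τ (finInt β - g) (v / N + ξ) * thetaN N τ (finInt β) (v / N - ξ)) *
      D (finInt β) (v / N)) with hfdef
  have hfd : Differentiable ℂ f := by
    refine Differentiable.fun_sum fun β _ => ?_
    have e1 : Differentiable ℂ fun v : ℂ => v / N := differentiable_id.div_const _
    exact ((((hdN _).comp (e1.add_const ξ)).mul ((hdN _).comp (e1.sub_const ξ))).mul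
      ((hDd _).comp e1)).const_mul _
  have hfφ : ∀ u, oddTheta τ (N * u) ≠ 0 →
      f (N * u) = (∑ β : Fin N × Fin N, φ u (finInt β)) * oddTheta τ (N * u) := by
    intro u hu
    simp only [hfdef, hφdef]
    rw [Finset.sum_mul]
    refine Finset.sum_congr rfl fun β _ => ?_
    have h0 : thetaN N τ (finInt β - g) u ≠ 0 :=
      fun h => hu (by rw [hD (finInt β) u, h, zero_mul, mul_zero])
    have h1 : thetaN N τ (finInt β) u ≠ 0 :=
      fun h => hu (by rw [hD (finInt β) u, h, mul_zero, mul_zero])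
    rw [mul_div_cancel_left₀ _ hN, hD (finInt β) u]
    field_simp
  have hφp : ∀ u, LatticePeriodic N (φ u) := by
    refine fun u => ⟨fun β => ?_, fun β => ?_⟩
    · simp only [hφdef]
      rw [chi_add_left, chi_left_period, mul_one, add_sub_right_comm, thetaN_add_left,
        thetaN_add_left, thetaN_add_left, thetaN_add_left]
    · simp only [hφdef]
      rw [chi_add_left, chi_right_period, mul_one, add_sub_right_comm, thetaN_add_right,
        thetaN_add_right, thetaN_add_right, thetaN_add_right,
        mul_div_mul_left _ _ (neg_ne_zero.mpr (ePi_ne_zero _)),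
        mul_div_mul_left _ _ (neg_ne_zero.mpr (ePi_ne_zero _))]
  -- The contributions of +ξ and -ξ to the multipliers cancel, so only the roots of unity ω^{-γ₁}
  -- and ω^{γ₂} remain.
  obtain ⟨m1, m2⟩ := torsionSum_multipliers hτ hφp (c₁ := ePi (-(2 * g.1 / N)))
    (c₂ := ePi (2 * g.2 / N))
    (fun u β => by
      simp only [hφdef]
      rw [show u + 1 / N + ξ = u + ξ + 1 / N by ring, show u + 1 / N - ξ = u - ξ + 1 / N by ring,
        thetaN_add_inv, thetaN_add_inv, thetaN_add_inv, thetaN_add_inv, chi_add_left,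
        chi_unit_right, show -(2 * (((-g).1 : ℤ) : ℂ) / N) = 2 * g.1 / N by simp; ring,
        add_sub_right_comm,
        ePi_neg]
      have := ePi_ne_zero (2 * g.1 / N)
      field_simp)
    (fun u β => by
      simp only [hφdef]
      rw [show u + τ / N + ξ = u + ξ + τ / N by ring, show u + τ / N - ξ = u - ξ + τ / N by ring,
        thetaN_add_tau_div, thetaN_add_tau_div, thetaN_add_tau_div, thetaN_add_tau_div,
        chi_add_left, chi_unit_left,
        show 2 * (((-g).2 : ℤ) : ℂ) / N = -(2 * g.2 / N) by simp; ring,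
        show -τ / (N : ℂ) ^ 2 - 2 / N * (u + ξ + 1 / 2 + (β - g).2 / N) =
          (-τ / (N : ℂ) ^ 2 - 2 / N * (u + 1 / 2 + (β - g).2 / N)) - 2 * ξ / N by ring,
        show -τ / (N : ℂ) ^ 2 - 2 / N * (u - ξ + 1 / 2 + β.2 / N) =
          (-τ / (N : ℂ) ^ 2 - 2 / N * (u + 1 / 2 + β.2 / N)) + 2 * ξ / N by ring,
        ePi_sub, ePi_add _ (2 * ξ / N), ePi_neg, add_sub_right_comm]
      have := ePi_ne_zero (2 * g.2 / N)
      have := ePi_ne_zero (2 * ξ / N)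
      have h1 := ePi_ne_zero (-τ / (N : ℂ) ^ 2 - 2 / N * (u + 1 / 2 + (β - g).2 / N))
      have h2 := ePi_ne_zero (-τ / (N : ℂ) ^ 2 - 2 / N * (u + 1 / 2 + β.2 / N))
      generalize ePi (-τ / (N : ℂ) ^ 2 - 2 / N * (u + 1 / 2 + (β - g).2 / N)) = e at *
      generalize ePi (-τ / (N : ℂ) ^ 2 - 2 / N * (u + 1 / 2 + β.2 / N)) = e' at *
      rw [div_eq_mul_inv e, mul_assoc e, mul_div_mul_left _ _ h1, mul_assoc e',
        mul_div_mul_left _ _ h2]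
      field_simp)
    hfd.continuous hfφ
  have hnorm : ∀ k : ℤ, ‖ePi (2 * k / N)‖ = 1 := fun k => by
    have := norm_ePi_ofReal (2 * k / N)
    push_cast at this
    exact this
  have hz : ∀ β : Fin N × Fin N, β ≠ 0 → β ≠ γ → D (finInt β) 0 = 0 := fun β hβ hβγ => by
    have h := hD (finInt β) 0
    rw [mul_zero, show oddTheta τ 0 = 0 from hO.zero] at h
    refine (mul_eq_zero.mp h.symm).resolve_right
      (mul_ne_zero (fun h3 => ?_) (thetaN_finInt_zero_ne hτ hβ))
    obtain ⟨a, b, hab⟩ := (thetaN_eq_zero_iff _ _ hτ).mp h3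
    have h2 := lattice_inj hτ (a := 0) (b := 0) (a' := N * b - (finInt β - g).2)
      (b' := N * a - (finInt β - g).1) (by push_cast; rw [← hab]; ring)
    simp only [hg, finInt, Prod.fst_sub, Prod.snd_sub] at h2
    have hlt : ∀ (x y : Fin N) (a : ℤ), (x : ℤ) - y = N * a → x = y := by
      intro x y a hxy
      have hx := x.2
      have hy := y.2
      refine Fin.ext ?_
      have : (x : ℤ) - y = 0 := Int.eq_zero_of_abs_lt_dvd (m := N) ⟨a, hxy⟩
        (by rw [abs_lt]; omega)
      omega
    exact hβγ (Prod.ext (hlt _ _ a (by linarith [h2.2])) (hlt _ _ b (by linarith [h2.1])))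
  have hf0 : f 0 = 0 := by
    simp only [hfdef]
    -- At the origin only β = 0 and β = γ contribute, and their contributions cancel because θ is
    -- odd.
    rw [← Finset.sum_subset (Finset.subset_univ {0, γ}), Finset.sum_pair hγ.symm]
    · have h0 : finInt (0 : Fin N × Fin N) = 0 := by simp [finInt]
      have hθγ := thetaN_finInt_zero_ne hτ hγ
      rw [← hg] at hθγ
      have hD0 : D 0 0 * thetaN N τ (-g) 0 = N :=
        quotient_at_zero hτ (H := fun u => D 0 u * thetaN N τ (-g) u) ((hDd 0).mul (hdN _))
          fun u => by rw [hD 0 u, thetaN_zero, zero_sub]; ring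
      have hDg : D g 0 * thetaN N τ g 0 = N :=
        quotient_at_zero hτ (H := fun u => D g u * thetaN N τ g u) ((hDd g).mul (hdN _))
          fun u => by rw [hD g u, sub_self, thetaN_zero]; ring
      have hk := ePi_ne_zero (-(2 * g.1 / N))
      have hn1 := thetaN_neg (N := N) τ g 0
      have hn2 := thetaN_neg (N := N) τ g (-ξ)
      rw [neg_zero] at hn1
      rw [neg_neg] at hn2
      rw [h0, ← hg, chi_zero_left, zero_div, zero_add, zero_sub, zero_sub, sub_self, thetaN_zero,
        thetaN_zero, chi_neg_right, chi_self, inv_one, hn2, oddTheta_neg]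
      rw [hn1] at hD0
      generalize ePi (-(2 * g.1 / N)) = k at *
      have e1 : D g 0 = N / thetaN N τ g 0 := by rw [← hDg]; field_simp
      have e2 : D 0 0 = -(N / (k * thetaN N τ g 0)) := by
        rw [← hD0]
        field_simp
      rw [e1, e2]
      field_simp
      ring
    · intro β _ hβ
      simp only [Finset.mem_insert, Finset.mem_singleton, not_or] at hβ
      rw [zero_div, hz β hβ.1 hβ.2, mul_zero, mul_zero]
  -- Since γ ≠ 0 has coordinates between 0 and N - 1, one of the two roots of unity is nontrivial;
  -- this makes the order-one function vanish.
  have hne : ePi (-(2 * g.1 / N)) ≠ 1 ∨ ePi (2 * g.2 / N) ≠ 1 := by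
    by_contra hcon
    push Not at hcon
    have hlt : ∀ x : Fin N, ePi (2 * ((x : ℤ) : ℂ) / N) = 1 → x = 0 := by
      intro x hx
      obtain ⟨n, hn⟩ := (ePi_eq_one_iff _).mp hx
      have h1 : ((x : ℤ) : ℂ) = ((N * n : ℤ) : ℂ) := by
        push_cast
        field_simp at hn
        exact_mod_cast hn
      have h2 : ((x : ℕ) : ℤ) = N * n := by exact_mod_cast h1
      have : N ∣ (x : ℕ) := by exact_mod_cast Dvd.intro _ h2.symm
      exact Fin.ext (by simpa using Nat.eq_zero_of_dvd_of_lt this x.2)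
    refine hγ (Prod.ext (hlt _ ?_) (hlt _ hcon.2))
    have h := hcon.1
    rw [ePi_neg, inv_eq_one] at h
    exact h
  have hf := hO.eq_zero_of_ne hfd (μ₁ := ePi (-(2 * g.1 / N))) (μ₂ := ePi (2 * g.2 / N))
    (by rw [ePi_neg, norm_inv, hnorm, inv_one]) (hnorm _) m1 m2 hf0 hne (N * u)
  rw [hfφ u hu] at hf
  exact (mul_eq_zero.mp hf).resolve_right hu

end

/-- An even entire function with the multipliers of `T²` which vanishes at the origin and at a
further point that is not a zero of `T` is zero. -/
theorem OrderOne.eq_zero_of_even {τ : ℂ} {m T D : ℂ → ℂ} (hT : OrderOne τ m T)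
    (hodd : ∀ v, T (-v) = -T v) (hD : Differentiable ℂ D) (h1 : ∀ v, D (v + 1) = D v)
    (h2 : ∀ v, D (v + τ) = m v ^ 2 * D v) (heven : ∀ v, D (-v) = D v) (h0 : D 0 = 0) {x : ℂ}
    (hx : T x ≠ 0) (hDx : D x = 0) (v : ℂ) : D v = 0 := by
  have hz : ∀ v, T v = 0 → D v = 0 := by
    intro v hv
    obtain ⟨a, b, rfl⟩ := hT.exists_of_eq_zero v hv
    have := eq_zero_of_quasiPeriodic (τ := τ) (f := D) (fun v => by rw [h1])
      (fun v => by rw [h2]; simp [hT.mult_ne_zero]) 0 a b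
    rw [zero_add] at this
    exact this.mpr h0
  obtain ⟨E, hE, hDE⟩ := hT.simple.exists_quotient hD hz
  have hEc := hE.continuous
  have hmc := hT.mult_cont
  have e1 : ∀ v, E (v + 1) = -1 * E v := by
    refine hT.simple.cancel (G := fun v => E (v + 1)) (H := fun v => -1 * E v)
      (by fun_prop) (by fun_prop) fun v => ?_
    have h := hDE (v + 1)
    rw [hT.add_one, h1, hDE] at h
    linear_combination h
  have e2 : ∀ v, E (v + τ) = 1 * (m v * E v) := by
    refine hT.simple.cancel (G := fun v => E (v + τ)) (H := fun v => 1 * (m v * E v))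
      (by fun_prop) (by fun_prop) fun v => ?_
    have h := hDE (v + τ)
    rw [hT.add_tau, h2, hDE] at h
    refine mul_left_cancel₀ (hT.mult_ne_zero v) ?_
    linear_combination -h
  -- As D is even and T is odd, the quotient E = D/T is odd and so has a zero of its own at the
  -- origin; this forces D = CT².
  have e3 : ∀ v, E (-v) = -E v := by
    refine hT.simple.cancel (G := fun v => E (-v)) (H := fun v => -E v)
      (by fun_prop) (by fun_prop) fun v => ?_
    have h := hDE (-v)
    rw [hodd, heven, hDE] at h
    linear_combination h
  have e0 : E 0 = 0 := by
    have h := e3 0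
    rw [neg_zero] at h
    linear_combination h / 2
  obtain ⟨C, hC, -⟩ := hT.eq_const_mul hE (μ₁ := 1) (μ₂ := 1) (by simp) (by simp) e1 e2 e0
  have hC0 : C = 0 := by
    rw [hDE, hC] at hDx
    simpa [hx] using hDx
  rw [hDE, hC, hC0]
  ring

/-! ## Fourier analysis on `(ℤ/N)²` -/

section

variable {N : ℕ} [NeZero N]

/-- Shifting the index by one multiplies the sum by a root of unity different from 1. -/
theorem sum_fin_ePi (k : ℤ) (hk : ¬ (N : ℤ) ∣ k) :
    ∑ i : Fin N, ePi (2 * (k * (i : ℤ)) / N) = 0 := by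
  have hN : (N : ℂ) ≠ 0 := NeZero.ne _
  have hp : Function.Periodic (fun i : ℤ => ePi (2 * (k * i) / N)) N := fun i => by
    have : 2 * ((k : ℂ) * ((i + N : ℤ) : ℂ)) / N = 2 * (k * i) / N + 2 * (k : ℤ) := by
      push_cast
      field_simp
    simp only [this, ePi_add, ePi_two_mul_int, mul_one]
  have h := sum_fin_shift N hp 1
  have h2 : ∀ i : ℤ, ePi (2 * (k * ((i + 1 : ℤ) : ℂ)) / N) =
      ePi (2 * k / N) * ePi (2 * (k * i) / N) := fun i => by
    rw [← ePi_add]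
    congr 1
    push_cast
    ring
  simp only [h2, ← Finset.mul_sum] at h
  have hne : ePi (2 * k / N) ≠ 1 := by
    intro h3
    obtain ⟨n, hn⟩ := (ePi_eq_one_iff _).mp h3
    refine hk ⟨n, ?_⟩
    field_simp at hn
    exact_mod_cast hn
  have h4 : (ePi (2 * k / N) - 1) * ∑ i : Fin N, ePi (2 * (k * (i : ℤ)) / N) = 0 := by
    rw [sub_mul, h, one_mul, sub_self]
  exact (mul_eq_zero.mp h4).resolve_left (sub_ne_zero.mpr hne)

theorem not_dvd_of_fin_ne_zero {x : Fin N} (hx : x ≠ 0) : ¬ (N : ℤ) ∣ ((x : ℕ) : ℤ) := by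
  intro h
  have : N ∣ (x : ℕ) := by exact_mod_cast h
  exact hx (Fin.ext (by simpa using Nat.eq_zero_of_dvd_of_lt this x.2))

theorem sum_chi (γ : Fin N × Fin N) :
    ∑ δ : Fin N × Fin N, chi N (finInt γ) (finInt δ) = if γ = 0 then (N : ℂ) ^ 2 else 0 := by
  have h : ∑ δ : Fin N × Fin N, chi N (finInt γ) (finInt δ) =
      (∑ x : Fin N, ePi (2 * (((-(γ.2 : ℕ) : ℤ) : ℂ) * (x : ℤ)) / N)) *
        ∑ y : Fin N, ePi (2 * ((((γ.1 : ℕ) : ℤ) : ℂ) * (y : ℤ)) / N) := by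
    rw [Fintype.sum_prod_type, Finset.sum_mul_sum]
    refine Finset.sum_congr rfl fun x _ => Finset.sum_congr rfl fun y _ => ?_
    rw [chi, ← ePi_add]
    congr 1
    simp only [finInt]
    push_cast
    ring
  rw [h]
  split_ifs with h0
  · subst h0
    simp [ePi_zero, sq]
  · by_cases h1 : γ.1 = 0
    · have h2 : γ.2 ≠ 0 := fun h2 => h0 (Prod.ext h1 h2)
      rw [sum_fin_ePi _ (by rw [dvd_neg]; exact not_dvd_of_fin_ne_zero h2), zero_mul]
    · rw [sum_fin_ePi (γ.1 : ℕ) (not_dvd_of_fin_ne_zero h1), mul_zero]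

/-- Replacing α by α + β - γ turns the dependence on δ into the single character χ(α, δ), and
summing over δ selects α = 0. -/
theorem parseval {a b : ℤ × ℤ → ℂ} (ha : LatticePeriodic N a) (γ : ℤ × ℤ) :
    ∑ δ : Fin N × Fin N, chi N γ (finInt δ) *
      ((∑ α : Fin N × Fin N, chi N (finInt α) (finInt δ) * a (finInt α)) *
        ∑ β : Fin N × Fin N, chi N (finInt β) (-finInt δ) * b (finInt β)) =
    N ^ 2 * ∑ β : Fin N × Fin N, a (finInt β - γ) * b (finInt β) := by
  have h1 : ∀ δ : Fin N × Fin N, chi N γ (finInt δ) *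
      ((∑ α : Fin N × Fin N, chi N (finInt α) (finInt δ) * a (finInt α)) *
        ∑ β : Fin N × Fin N, chi N (finInt β) (-finInt δ) * b (finInt β)) =
      ∑ β : Fin N × Fin N, ∑ α : Fin N × Fin N,
        chi N (finInt α) (finInt δ) * (a (finInt α + (finInt β - γ)) * b (finInt β)) := by
    intro δ
    rw [Finset.mul_sum, Finset.mul_sum]
    refine Finset.sum_congr rfl fun β _ => ?_
    have hper : LatticePeriodic N fun α => chi N α (finInt δ) * a α :=
      ⟨fun α => by
        simp only [ha.left]
        rw [chi_add_left, chi_left_period, mul_one],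
      fun α => by
        simp only [ha.right]
        rw [chi_add_left, chi_right_period, mul_one]⟩
    rw [← hper.sum_shift (finInt β - γ), Finset.sum_mul, Finset.mul_sum]
    refine Finset.sum_congr rfl fun α _ => ?_
    rw [sub_eq_add_neg, chi_add_left, chi_add_left, chi_neg_left, chi_neg_right]
    have e1 := chi_ne_zero (N := N) γ (finInt δ)
    have e2 := chi_ne_zero (N := N) (finInt β) (finInt δ)
    field_simp
  simp only [h1]
  rw [Finset.sum_comm, Finset.mul_sum]
  refine Finset.sum_congr rfl fun β _ => ?_
  rw [Finset.sum_comm]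
  simp only [← Finset.sum_mul, sum_chi]
  rw [Finset.sum_eq_single (0 : Fin N × Fin N)]
  · have h0 : finInt (0 : Fin N × Fin N) = 0 := by simp [finInt]
    rw [if_pos rfl, h0, zero_add]
  · intro α _ hα
    rw [if_neg hα, zero_mul]
  · intro h
    exact absurd (Finset.mem_univ _) h

end

/-! ## The coefficients of the elliptic `R`-matrix -/

/-- The coefficients `W_β`, for `β ∈ ℤ²`. -/
noncomputable def wInt (N : ℕ) (ζ τ : ℂ) (β : ℤ × ℤ) (ξ : ℂ) : ℂ :=
  thetaN N τ β (ξ + ζ / N) / (N * thetaN N τ β (ζ / N))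

section

variable {N : ℕ} {ζ τ : ℂ}

theorem wFun_eq_wInt (α : Fin N × Fin N) (ξ : ℂ) : wFun N α ξ ζ τ = wInt N ζ τ (finInt α) ξ := by
  simp [wFun, wInt, thetaN, finInt]

theorem wInt_add_one (β : ℤ × ℤ) (ξ : ℂ) :
    wInt N ζ τ β (ξ + 1) = -ePi (2 * β.1 / N) * wInt N ζ τ β ξ := by
  rw [wInt, add_right_comm, thetaN_add_one, mul_div_assoc, wInt]

theorem wInt_add_tau (β : ℤ × ℤ) (ξ : ℂ) :
    wInt N ζ τ β (ξ + τ) =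
      ePi (-(2 * β.2 / N)) * thetaMult τ (ξ + ζ / N) * wInt N ζ τ β ξ := by
  rw [wInt, add_right_comm, thetaN_add_tau, ← mul_assoc, mul_div_assoc, wInt]

variable [NeZero N]

theorem wInt_periodic (ξ : ℂ) : LatticePeriodic N fun β => wInt N ζ τ β ξ := by
  refine ⟨fun β => ?_, fun β => ?_⟩
  · simp only [wInt, thetaN_add_left]
  · simp only [wInt, thetaN_add_right]
    rw [mul_left_comm, mul_div_mul_left _ _ (neg_ne_zero.mpr (ePi_ne_zero _))]

theorem thetaN_div_ne_zero (hτ : 0 < τ.im) {x : ℂ} (hx : oddTheta τ x ≠ 0) (β : ℤ × ℤ) :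
    thetaN N τ β (x / N) ≠ 0 := fun h => hx <| by
  have := oddTheta_natMul_eq_zero hτ h
  rwa [mul_div_cancel₀ _ (NeZero.ne (N : ℂ))] at this

/-- The theta identity `fourier_thetaN` at the point u = ζ/N. -/
theorem fourier_wInt (hτ : 0 < τ.im) (hζ : oddTheta τ ζ ≠ 0) (δ : ℤ × ℤ) {ξ : ℂ}
    (hξ : oddTheta τ ξ ≠ 0) :
    ∑ β : Fin N × Fin N, chi N (finInt β) δ * wInt N ζ τ (finInt β) ξ =
      oddTheta τ ξ * thetaN N τ δ (ζ + ξ / N) / (oddTheta τ ζ * thetaN N τ δ (ξ / N)) := by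
  have hN : (N : ℂ) ≠ 0 := NeZero.ne _
  have hNζ : (N : ℂ) * (ζ / N) = ζ := mul_div_cancel₀ _ hN
  have h := fourier_thetaN (N := N) hτ δ ξ (ζ / N) (by rwa [hNζ])
  rw [hNζ] at h
  have hδ := thetaN_div_ne_zero (N := N) hτ hξ δ
  have h2 : ∀ β : Fin N × Fin N, chi N (finInt β) δ * wInt N ζ τ (finInt β) ξ =
      (N : ℂ)⁻¹ * (chi N (finInt β) δ *
        (thetaN N τ (finInt β) (ζ / N + ξ) / thetaN N τ (finInt β) (ζ / N))) := fun β => by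
    rw [wInt, add_comm ξ, mul_comm (N : ℂ), ← div_div]
    ring
  simp only [h2, ← Finset.mul_sum]
  rw [eq_div_iff (mul_ne_zero hζ hδ), mul_assoc, h]
  field_simp

theorem unitarity_wInt_off (hτ : 0 < τ.im) (hζ : oddTheta τ ζ ≠ 0) {γ : Fin N × Fin N}
    (hγ : γ ≠ 0) (ξ : ℂ) :
    ∑ β : Fin N × Fin N, chi N (finInt β) (-finInt γ) *
      (wInt N ζ τ (finInt β - finInt γ) ξ * wInt N ζ τ (finInt β) (-ξ)) = 0 := by
  have hN : (N : ℂ) ≠ 0 := NeZero.ne _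
  have hNζ : (N : ℂ) * (ζ / N) = ζ := mul_div_cancel₀ _ hN
  have h := unitarity_thetaN (N := N) hτ hγ ξ (ζ / N) (by rwa [hNζ])
  have h2 : ∀ β : Fin N × Fin N, chi N (finInt β) (-finInt γ) *
      (wInt N ζ τ (finInt β - finInt γ) ξ * wInt N ζ τ (finInt β) (-ξ)) =
      ((N : ℂ) ^ 2)⁻¹ * (chi N (finInt β) (-finInt γ) *
      ((thetaN N τ (finInt β - finInt γ) (ζ / N + ξ) / thetaN N τ (finInt β - finInt γ) (ζ / N)) *
        (thetaN N τ (finInt β) (ζ / N - ξ) / thetaN N τ (finInt β) (ζ / N)))) := fun β => by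
    rw [wInt, wInt, add_comm ξ, show -ξ + ζ / N = ζ / N - ξ by ring]
    simp only [mul_comm (N : ℂ), ← div_div]
    ring
  simp only [h2, ← Finset.mul_sum]
  rw [h, mul_zero]

/-- At ξ = ζ the coefficients are self-dual: the Fourier transform of w(ζ) at δ is N w_δ(ζ), and
that of w(-ζ) at -δ is -N w_δ(-ζ). Parseval then says that the sum equals its own negative. -/
theorem sum_wInt_mul_self (hτ : 0 < τ.im) (hζ : oddTheta τ ζ ≠ 0) :
    ∑ β : Fin N × Fin N, wInt N ζ τ (finInt β) ζ * wInt N ζ τ (finInt β) (-ζ) = 0 := by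
  have hN : (N : ℂ) ≠ 0 := NeZero.ne _
  have hζ' : oddTheta τ (-ζ) ≠ 0 := by rw [oddTheta_neg]; exact neg_ne_zero.mpr hζ
  have h := parseval (N := N) (a := fun β => wInt N ζ τ β ζ) (b := fun β => wInt N ζ τ β (-ζ))
    (wInt_periodic ζ) 0
  simp only [fourier_wInt hτ hζ _ hζ, fourier_wInt hτ hζ _ hζ', chi_zero_left, one_mul,
    sub_zero] at h
  have h2 : ∀ δ : Fin N × Fin N,
      oddTheta τ ζ * thetaN N τ (finInt δ) (ζ + ζ / N) /
        (oddTheta τ ζ * thetaN N τ (finInt δ) (ζ / N)) *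
      (oddTheta τ (-ζ) * thetaN N τ (-finInt δ) (ζ + -ζ / N) /
        (oddTheta τ ζ * thetaN N τ (-finInt δ) (-ζ / N))) =
      -(N : ℂ) ^ 2 * (wInt N ζ τ (finInt δ) ζ * wInt N ζ τ (finInt δ) (-ζ)) := by
    intro δ
    have h3 := thetaN_neg (N := N) τ (finInt δ) (ζ / N)
    have h4 := thetaN_neg (N := N) τ (finInt δ) (-ζ + ζ / N)
    rw [show -(-ζ + ζ / N) = ζ + -ζ / N by ring] at h4
    rw [← neg_div] at h3
    rw [h3, h4, oddTheta_neg, wInt, wInt]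
    have h5 := thetaN_div_ne_zero (N := N) hτ hζ (finInt δ)
    have h6 := ePi_ne_zero (-(2 * (finInt δ).1 / N))
    generalize ePi (-(2 * (finInt δ).1 / N)) = k at *
    field_simp
  simp only [h2, ← Finset.mul_sum] at h
  have h7 : (2 * (N : ℂ) ^ 2) * ∑ β : Fin N × Fin N,
      wInt N ζ τ (finInt β) ζ * wInt N ζ τ (finInt β) (-ζ) = 0 := by
    linear_combination -h
  exact (mul_eq_zero.mp h7).resolve_left (mul_ne_zero two_ne_zero (pow_ne_zero _ hN))

/-- As functions of ξ both sides are even with the multipliers of θ². They agree at ξ = 0, where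
every w_β is 1/N, and at ξ = ζ, where both vanish; `OrderOne.eq_zero_of_even` does the rest. -/
theorem unitarity_wInt_diag (hτ : 0 < τ.im) (hζ : oddTheta τ ζ ≠ 0) (ξ : ℂ) :
    ∑ β : Fin N × Fin N, wInt N ζ τ (finInt β) ξ * wInt N ζ τ (finInt β) (-ξ) =
      oddTheta τ (ζ + ξ) * oddTheta τ (ζ - ξ) / oddTheta τ ζ ^ 2 := by
  have hN : (N : ℂ) ≠ 0 := NeZero.ne _
  have hO := (orderOne_thetaChar hτ).2
  have hdθ := differentiable_oddTheta hτ
  have hdw : ∀ β, Differentiable ℂ (wInt N ζ τ β) := fun β =>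
    ((differentiable_thetaN hτ β).comp (differentiable_id.add_const _)).div_const _
  have b1 : ∀ v, oddTheta τ (v + 1) = -oddTheta τ v := hO.add_one
  have b2 : ∀ v, oddTheta τ (v + τ) = thetaMult τ v * oddTheta τ v := hO.add_tau
  have b0 : oddTheta τ 0 = 0 := hO.zero
  set D : ℂ → ℂ := fun ξ =>
    (∑ β : Fin N × Fin N, wInt N ζ τ (finInt β) ξ * wInt N ζ τ (finInt β) (-ξ)) -
      oddTheta τ (ζ + ξ) * oddTheta τ (ζ - ξ) / oddTheta τ ζ ^ 2 with hD
  have key := hO.eq_zero_of_even (D := D) (oddTheta_neg τ) (x := ζ) ?_ ?_ ?_ ?_ ?_ hζ ?_ ξ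
  · exact sub_eq_zero.mp key
  · refine Differentiable.sub (Differentiable.fun_sum fun β _ =>
      (hdw _).mul ((hdw _).comp differentiable_neg)) ?_
    exact ((hdθ.comp (differentiable_id.const_add ζ)).mul
      (hdθ.comp (differentiable_id.const_sub ζ))).div_const _
  · intro v
    simp only [hD]
    congr 1
    · refine Finset.sum_congr rfl fun β _ => ?_
      have h1 := wInt_add_one (N := N) (ζ := ζ) (τ := τ) (finInt β) (-(v + 1))
      rw [show -(v + 1) + 1 = -v by ring] at h1
      rw [wInt_add_one, h1]
      ring
    · have h1 := b1 (ζ - (v + 1))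
      rw [show ζ - (v + 1) + 1 = ζ - v by ring] at h1
      rw [← add_assoc, b1, h1]
      ring
  · intro v
    have hM : ∀ x, thetaMult τ (v + x) = thetaMult τ v ^ 2 * thetaMult τ (-(v + τ) + x) := by
      intro x
      simp only [thetaMult, sq, ← ePi_add]
      rw [ePi_eq_iff]
      -- The two exponents differ by 2, a period of e^{iπx}.
      exact ⟨1, by push_cast; ring⟩
    simp only [hD, mul_sub, Finset.mul_sum]
    congr 1
    · refine Finset.sum_congr rfl fun β _ => ?_
      have h1 := wInt_add_tau (N := N) (ζ := ζ) (τ := τ) (finInt β) (-(v + τ))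
      rw [show -(v + τ) + τ = -v by ring] at h1
      rw [wInt_add_tau, h1, hM]
      ring
    · have h1 := b2 (ζ - (v + τ))
      rw [show ζ - (v + τ) + τ = ζ - v by ring] at h1
      rw [← add_assoc, b2, h1, show ζ - (v + τ) = -(v + τ) + ζ by ring, add_comm ζ v, hM]
      ring
  · intro v
    simp only [hD, neg_neg, sub_neg_eq_add, ← sub_eq_add_neg]
    congr 1
    · exact Finset.sum_congr rfl fun β _ => mul_comm _ _
    · rw [mul_comm]
  · simp only [hD, neg_zero, add_zero, sub_zero]
    have h1 : ∀ β : Fin N × Fin N, wInt N ζ τ (finInt β) 0 = (N : ℂ)⁻¹ := fun β => by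
      have := thetaN_div_ne_zero (N := N) hτ hζ (finInt β)
      rw [wInt, zero_add]
      field_simp
    simp only [h1]
    rw [Finset.sum_const, Finset.card_univ, Fintype.card_prod, Fintype.card_fin]
    have e1 : (N : ℂ) ^ 2 * (N : ℂ)⁻¹ ^ 2 = 1 := by rw [← mul_pow, mul_inv_cancel₀ hN, one_pow]
    field_simp
    linear_combination e1
  · simp only [hD]
    rw [sum_wInt_mul_self hτ hζ, sub_self, b0]
    ring

/-- The arguments s - Nζ and -s are chosen so that the theta quotients in the two Fourier transforms
are reciprocal at every δ. Their product is then independent of δ, and orthogonality of characters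
leaves only γ = 0. -/
theorem crossing_wInt (hτ : 0 < τ.im) (hζ : oddTheta τ ζ ≠ 0) {s : ℂ} (hs : oddTheta τ s ≠ 0)
    (hs' : oddTheta τ (s - N * ζ) ≠ 0) (γ : Fin N × Fin N) :
    ∑ β : Fin N × Fin N,
      wInt N ζ τ (finInt β - finInt γ) (s - N * ζ) * wInt N ζ τ (finInt β) (-s) =
    if γ = 0 then oddTheta τ (s - N * ζ) * oddTheta τ (-s) / oddTheta τ ζ ^ 2 else 0 := by
  have hN : (N : ℂ) ≠ 0 := NeZero.ne _
  have hsn : oddTheta τ (-s) ≠ 0 := by rw [oddTheta_neg]; exact neg_ne_zero.mpr hs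
  have h := parseval (N := N) (a := fun β => wInt N ζ τ β (s - N * ζ))
    (b := fun β => wInt N ζ τ β (-s)) (wInt_periodic _) (finInt γ)
  simp only [fourier_wInt hτ hζ _ hs', fourier_wInt hτ hζ _ hsn] at h
  have h2 : ∀ δ : Fin N × Fin N,
      oddTheta τ (s - N * ζ) * thetaN N τ (finInt δ) (ζ + (s - N * ζ) / N) /
        (oddTheta τ ζ * thetaN N τ (finInt δ) ((s - N * ζ) / N)) *
      (oddTheta τ (-s) * thetaN N τ (-finInt δ) (ζ + -s / N) /
        (oddTheta τ ζ * thetaN N τ (-finInt δ) (-s / N))) =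
      oddTheta τ (s - N * ζ) * oddTheta τ (-s) / oddTheta τ ζ ^ 2 := by
    intro δ
    have h3 := thetaN_neg (N := N) τ (finInt δ) (s / N)
    have h4 := thetaN_neg (N := N) τ (finInt δ) ((s - N * ζ) / N)
    have e1 : (s - N * ζ) / N = s / N - ζ := by field_simp
    rw [show -((s - N * ζ) / N) = ζ + -s / N by rw [e1]; ring] at h4
    rw [← neg_div] at h3
    have h5 := thetaN_div_ne_zero (N := N) hτ hs (finInt δ)
    have h7 := thetaN_div_ne_zero (N := N) hτ hs' (finInt δ)
    rw [h3, h4, show ζ + (s - N * ζ) / N = s / N by rw [e1]; ring]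
    have h6 := ePi_ne_zero (-(2 * (finInt δ).1 / N))
    generalize ePi (-(2 * (finInt δ).1 / N)) = k at *
    generalize thetaN N τ (finInt δ) (s / N) = x at *
    generalize thetaN N τ (finInt δ) ((s - N * ζ) / N) = y at *
    field_simp
  simp only [h2, ← Finset.sum_mul, sum_chi] at h
  refine mul_left_cancel₀ (pow_ne_zero 2 hN) (h.symm.trans ?_)
  split_ifs <;> ring

end

/-! ## Weyl pairs -/

section

variable {𝒢 : Type*} [Group 𝒢] {c G H : 𝒢}

/-- Conjugation by H multiplies G^l by c^l, hence conjugation by G^{-l} multiplies H by c^l; the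
centrality of c allows taking k-th powers. -/
theorem weyl_commutation (hc : ∀ x, Commute c x) (h : H * G = c * (G * H)) (k l : ℤ) :
    H ^ k * G ^ l = c ^ (k * l) * (G ^ l * H ^ k) := by
  have h1 : H * G * H⁻¹ = c * G := by rw [h]; group
  have h2 : H * G ^ l * H⁻¹ = c ^ l * G ^ l := by
    rw [← conj_zpow, h1, (hc G).mul_zpow]
  have h3 : G ^ (-l) * H * (G ^ (-l))⁻¹ = c ^ l * H := by
    have h4 : H * G ^ l = c ^ l * G ^ l * H := by rw [← h2]; group
    rw [zpow_neg, inv_inv, mul_assoc, h4, ((hc (G ^ l)).zpow_left l).eq]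
    group
  have h4 : G ^ (-l) * H ^ k * (G ^ (-l))⁻¹ = c ^ (k * l) * H ^ k := by
    rw [← conj_zpow, h3, ((hc H).zpow_left l).mul_zpow, ← zpow_mul, mul_comm l]
  calc H ^ k * G ^ l = G ^ l * (G ^ (-l) * H ^ k * (G ^ (-l))⁻¹) := by group
    _ = (G ^ l * c ^ (k * l)) * H ^ k := by rw [h4, mul_assoc]
    _ = c ^ (k * l) * (G ^ l * H ^ k) := by rw [← ((hc (G ^ l)).zpow_left _).eq, mul_assoc]

/-- The Weyl operators `G^{β₂} H^{β₁}`. -/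
def weyl (G H : 𝒢) (β : ℤ × ℤ) : 𝒢 := G ^ β.2 * H ^ β.1

theorem weyl_sub_mul_inv (hc : ∀ x, Commute c x) (h : H * G = c * (G * H)) (β γ : ℤ × ℤ) :
    weyl G H (β - γ) * (weyl G H β)⁻¹ = c ^ (β.2 * γ.1) * weyl G H (-γ) := by
  have h1 : weyl G H (β - γ) * (weyl G H β)⁻¹ =
      G ^ (β.2 - γ.2) * (H ^ (-γ.1) * G ^ (-β.2)) := by
    simp only [weyl, Prod.fst_sub, Prod.snd_sub]
    group
  rw [h1, weyl_commutation hc h, ← mul_assoc, ← ((hc _).zpow_left _).eq, mul_assoc, neg_mul_neg,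
    mul_comm γ.1]
  congr 1
  simp only [weyl, Prod.fst_neg, Prod.snd_neg]
  group

theorem weyl_sub_inv_mul (hc : ∀ x, Commute c x) (h : H * G = c * (G * H)) (β γ : ℤ × ℤ) :
    (weyl G H (β - γ))⁻¹ * weyl G H β = c ^ (-(β.1 * γ.2)) * (weyl G H (-γ))⁻¹ := by
  have h1 : (weyl G H (β - γ))⁻¹ * weyl G H β =
      H ^ γ.1 * (H ^ (-β.1) * G ^ γ.2) * H ^ β.1 := by
    simp only [weyl, Prod.fst_sub, Prod.snd_sub]
    group
  rw [h1, weyl_commutation hc h, ← mul_assoc, ← ((hc (H ^ γ.1)).zpow_left _).eq, neg_mul, mul_assoc,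
    mul_assoc]
  congr 1
  simp only [weyl, Prod.fst_neg, Prod.snd_neg]
  group

theorem weyl_inv_mul_sub (hc : ∀ x, Commute c x) (h : H * G = c * (G * H)) (β γ : ℤ × ℤ) :
    (weyl G H β)⁻¹ * weyl G H (β - γ) = c ^ (β.1 * γ.2) * weyl G H (-γ) := by
  have h1 := congrArg (·⁻¹) (weyl_sub_inv_mul hc h β γ)
  simp only [mul_inv_rev, inv_inv] at h1
  rw [h1, ((hc _).zpow_left _).eq, zpow_neg, inv_inv]

/-- For the pair of the R-matrix, HG is g^{1/2} h g^{1/2}; the phase found here compensates the one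
that w_β acquires under the shift by τ + 1. -/
theorem weyl_conj (hc : ∀ x, Commute c x) (h : H * G = c * (G * H)) (β : ℤ × ℤ) :
    (H * G) * weyl G H β * (H * G)⁻¹ = c ^ (β.2 - β.1) * weyl G H β := by
  have h1 := weyl_commutation hc h 1 β.2
  have h2 := weyl_commutation hc h β.1 1
  simp only [zpow_one, one_mul, mul_one] at h1 h2
  have h3 : G * H ^ β.1 = c ^ (-β.1) * (H ^ β.1 * G) := by
    rw [h2, zpow_neg, inv_mul_cancel_left]
  calc (H * G) * weyl G H β * (H * G)⁻¹ = (H * G ^ β.2) * (G * H ^ β.1) * G⁻¹ * H⁻¹ := by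
        simp only [weyl]; group
    _ = c ^ β.2 * (G ^ β.2 * H) * (c ^ (-β.1) * (H ^ β.1 * G)) * G⁻¹ * H⁻¹ := by rw [h1, h3]
    _ = c ^ β.2 * ((G ^ β.2 * H) * c ^ (-β.1)) * (H ^ β.1 * G) * G⁻¹ * H⁻¹ := by
        simp only [mul_assoc]
    _ = c ^ (β.2 - β.1) * weyl G H β := by
        rw [← ((hc (G ^ β.2 * H)).zpow_left _).eq, sub_eq_add_neg, zpow_add, weyl]
        group

end

/-! ## Sums over Weyl operators -/

section

variable {N : ℕ}

/-- The root of unity `ω = e^{2iπ/N}` as a scalar matrix. -/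
noncomputable def omegaUnit (N : ℕ) : (Matrix (Fin N) (Fin N) ℂ)ˣ :=
  Units.map (algebraMap ℂ (Matrix (Fin N) (Fin N) ℂ)).toMonoidHom
    (Units.mk0 (ePi (2 / N)) (ePi_ne_zero _))

theorem omegaUnit_commute (x : (Matrix (Fin N) (Fin N) ℂ)ˣ) : Commute (omegaUnit N) x := by
  refine Units.ext ?_
  exact Algebra.commutes _ _

theorem omegaUnit_zpow_mul (n : ℤ) (x : (Matrix (Fin N) (Fin N) ℂ)ˣ) :
    ((omegaUnit N ^ n * x : (Matrix (Fin N) (Fin N) ℂ)ˣ) : Matrix (Fin N) (Fin N) ℂ) =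
      ePi (2 * n / N) • (x : Matrix (Fin N) (Fin N) ℂ) := by
  rw [omegaUnit, ← map_zpow, Units.val_mul, Units.coe_map]
  have h : ((Units.mk0 (ePi (2 / N)) (ePi_ne_zero _) ^ n : ℂˣ) : ℂ) = ePi (2 * n / N) := by
    rw [Units.val_zpow_eq_zpow_val, Units.val_mk0, ← ePi_int_mul]
    congr 1
    ring
  rw [h, Algebra.smul_def]
  rfl

/-- A pair of invertible matrices with `H G = ω G H` and `G^N = H^N = 1`. -/
structure WeylPair (G H : (Matrix (Fin N) (Fin N) ℂ)ˣ) : Prop where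
  comm : H * G = omegaUnit N * (G * H)
  left : G ^ N = 1
  right : H ^ N = 1

/-- The operators `I_β ⊗ I_β⁻¹`. -/
noncomputable def weylKron (G H : (Matrix (Fin N) (Fin N) ℂ)ˣ) (β : ℤ × ℤ) :
    Matrix (Fin N × Fin N) (Fin N × Fin N) ℂ :=
  (weyl G H β).val ⊗ₖ ((weyl G H β)⁻¹).val

/-- The exchange of the two tensor factors. -/
def flip₂ {A : Type*} (X : Matrix (Fin N × Fin N) (Fin N × Fin N) A) :
    Matrix (Fin N × Fin N) (Fin N × Fin N) A := X.submatrix Prod.swap Prod.swap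

variable {G H : (Matrix (Fin N) (Fin N) ℂ)ˣ}

theorem WeylPair.weyl_periodic (hW : WeylPair G H) : LatticePeriodic N (weyl G H) := by
  refine ⟨fun β => ?_, fun β => ?_⟩
  · simp only [weyl, Prod.fst_add, Prod.snd_add, add_zero]
    rw [zpow_add, zpow_natCast, hW.right, mul_one]
  · simp only [weyl, Prod.fst_add, Prod.snd_add, add_zero]
    rw [zpow_add, zpow_natCast, hW.left, mul_one]

theorem WeylPair.weylKron_periodic (hW : WeylPair G H) : LatticePeriodic N (weylKron G H) := by
  refine ⟨fun β => ?_, fun β => ?_⟩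
  · rw [weylKron, hW.weyl_periodic.left, weylKron]
  · rw [weylKron, hW.weyl_periodic.right, weylKron]

theorem weylKron_zero : weylKron G H 0 = 1 := by
  simp [weylKron, weyl]

theorem WeylPair.mul_inv (hW : WeylPair G H) (β γ : ℤ × ℤ) :
    (weyl G H (β - γ)).val * ((weyl G H β)⁻¹).val =
      ePi (2 * (β.2 * γ.1 : ℤ) / N) • (weyl G H (-γ)).val := by
  rw [← Units.val_mul, weyl_sub_mul_inv omegaUnit_commute hW.comm, omegaUnit_zpow_mul]

theorem WeylPair.inv_mul (hW : WeylPair G H) (β γ : ℤ × ℤ) :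
    ((weyl G H (β - γ))⁻¹).val * (weyl G H β).val =
      ePi (2 * (-(β.1 * γ.2) : ℤ) / N) • ((weyl G H (-γ))⁻¹).val := by
  rw [← Units.val_mul, weyl_sub_inv_mul omegaUnit_commute hW.comm, omegaUnit_zpow_mul]

theorem WeylPair.inv_mul_sub (hW : WeylPair G H) (β γ : ℤ × ℤ) :
    ((weyl G H β)⁻¹).val * (weyl G H (β - γ)).val =
      ePi (2 * (β.1 * γ.2 : ℤ) / N) • (weyl G H (-γ)).val := by
  rw [← Units.val_mul, weyl_inv_mul_sub omegaUnit_commute hW.comm, omegaUnit_zpow_mul]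

theorem flip₂_weylKron (β : ℤ × ℤ) :
    flip₂ (weylKron G H β) = ((weyl G H β)⁻¹).val ⊗ₖ (weyl G H β).val := by
  ext ⟨a, b⟩ ⟨a', b'⟩
  simp only [flip₂, weylKron, Matrix.submatrix_apply, Matrix.kroneckerMap_apply, Prod.swap_prod_mk]
  exact mul_comm _ _

theorem flip₂_smul (r : ℂ) (X : Matrix (Fin N × Fin N) (Fin N × Fin N) ℂ) :
    flip₂ (r • X) = r • flip₂ X := rfl

theorem flip₂_sum {ι : Type*} (s : Finset ι)
    (X : ι → Matrix (Fin N × Fin N) (Fin N × Fin N) ℂ) :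
    flip₂ (∑ i ∈ s, X i) = ∑ i ∈ s, flip₂ (X i) := by
  ext x y
  simp [flip₂, Matrix.sum_apply]

/-- The two legs contribute ω^{β₂γ₁} and ω^{-β₁γ₂}, which together form the symplectic character. -/
theorem WeylPair.weylKron_mul_flip (hW : WeylPair G H) (β γ : ℤ × ℤ) :
    weylKron G H (β - γ) * flip₂ (weylKron G H β) = chi N β (-γ) • weylKron G H (-γ) := by
  rw [flip₂_weylKron, weylKron, ← Matrix.mul_kronecker_mul, hW.mul_inv, hW.inv_mul,
    Matrix.smul_kronecker, Matrix.kronecker_smul, smul_smul, ← ePi_add, weylKron, chi]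
  congr 2
  simp only [Prod.fst_neg, Prod.snd_neg]
  push_cast
  ring

/-- A combination of Weyl operators. -/
noncomputable def weylSum (G H : (Matrix (Fin N) (Fin N) ℂ)ˣ) (a : ℤ × ℤ → ℂ) :
    Matrix (Fin N × Fin N) (Fin N × Fin N) ℂ :=
  ∑ α : Fin N × Fin N, a (finInt α) • weylKron G H (finInt α)

theorem WeylPair.sum_eq_sum_sub (hW : WeylPair G H) {a : ℤ × ℤ → ℂ} (ha : LatticePeriodic N a)
    (β : ℤ × ℤ) : weylSum G H a =
      ∑ γ : Fin N × Fin N, a (β - finInt γ) • weylKron G H (β - finInt γ) := by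
  have h1 : LatticePeriodic N fun α => a α • weylKron G H α :=
    ⟨fun α => by rw [ha.left, hW.weylKron_periodic.left],
      fun α => by rw [ha.right, hW.weylKron_periodic.right]⟩
  have h2 : LatticePeriodic N fun α => a (α + β) • weylKron G H (α + β) :=
    ⟨fun α => by rw [add_right_comm, ha.left, hW.weylKron_periodic.left],
      fun α => by rw [add_right_comm, ha.right, hW.weylKron_periodic.right]⟩
  rw [weylSum, ← h1.sum_shift β, ← h2.sum_neg]
  refine Finset.sum_congr rfl fun γ _ => ?_
  rw [neg_add_eq_sub]

theorem WeylPair.unitarity (hW : WeylPair G H) {a b : ℤ × ℤ → ℂ} (ha : LatticePeriodic N a) :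
    weylSum G H a * flip₂ (weylSum G H b) =
      ∑ γ : Fin N × Fin N, (∑ β : Fin N × Fin N, chi N (finInt β) (-finInt γ) *
        (a (finInt β - finInt γ) * b (finInt β))) • weylKron G H (-finInt γ) := by
  conv_lhs => rw [weylSum.eq_1 G H b]
  rw [flip₂_sum, Finset.mul_sum]
  simp only [Finset.sum_smul]
  rw [Finset.sum_comm]
  refine Finset.sum_congr rfl fun β _ => ?_
  rw [hW.sum_eq_sum_sub ha (finInt β), Finset.sum_mul]
  refine Finset.sum_congr rfl fun γ _ => ?_
  rw [flip₂_smul, Matrix.smul_mul, Matrix.mul_smul, hW.weylKron_mul_flip, smul_smul, smul_smul]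
  congr 1
  ring

/-- This contraction is the product of the partial transposes in the first space. Transposing
reverses the order of multiplication in that leg, so the phases ω^{β₁γ₂} and ω^{-β₁γ₂} of the two
legs cancel. Unlike in `WeylPair.unitarity`, a plain correlation of a and b remains, which is the
form `parseval` handles. -/
theorem WeylPair.crossing (hW : WeylPair G H) {a b : ℤ × ℤ → ℂ} (ha : LatticePeriodic N a)
    (i j k l : Fin N) :
    ∑ x : Fin N, ∑ y : Fin N, weylSum G H a (x, i) (j, y) * flip₂ (weylSum G H b) (k, y) (x, l) =
      ∑ γ : Fin N × Fin N, (∑ β : Fin N × Fin N, a (finInt β - finInt γ) * b (finInt β)) *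
        weylKron G H (-finInt γ) (k, i) (j, l) := by
  have hterm : ∀ β γ : ℤ × ℤ, ∑ x : Fin N, ∑ y : Fin N,
      weylKron G H (β - γ) (x, i) (j, y) * flip₂ (weylKron G H β) (k, y) (x, l) =
      weylKron G H (-γ) (k, i) (j, l) := by
    intro β γ
    have e : ∑ x : Fin N, ∑ y : Fin N,
        weylKron G H (β - γ) (x, i) (j, y) * flip₂ (weylKron G H β) (k, y) (x, l) =
        (((weyl G H β)⁻¹).val * (weyl G H (β - γ)).val) k j *
          (((weyl G H (β - γ))⁻¹).val * (weyl G H β).val) i l := by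
      rw [Matrix.mul_apply, Matrix.mul_apply, Finset.sum_mul_sum]
      refine Finset.sum_congr rfl fun x _ => Finset.sum_congr rfl fun y _ => ?_
      rw [flip₂_weylKron, weylKron, Matrix.kroneckerMap_apply, Matrix.kroneckerMap_apply]
      ring
    rw [e, hW.inv_mul_sub, hW.inv_mul, weylKron, Matrix.kroneckerMap_apply, Matrix.smul_apply,
      Matrix.smul_apply, smul_mul_smul_comm, ← ePi_add]
    have : 2 * ((β.1 * γ.2 : ℤ) : ℂ) / N + 2 * ((-(β.1 * γ.2) : ℤ) : ℂ) / N = 0 := by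
      push_cast
      ring
    rw [this, ePi_zero, one_smul]
  have hb : ∀ x y : Fin N, weylSum G H a (x, i) (j, y) * flip₂ (weylSum G H b) (k, y) (x, l) =
      ∑ β : Fin N × Fin N, ∑ γ : Fin N × Fin N, a (finInt β - finInt γ) * b (finInt β) *
        (weylKron G H (finInt β - finInt γ) (x, i) (j, y) *
          flip₂ (weylKron G H (finInt β)) (k, y) (x, l)) := by
    intro x y
    conv_lhs => rw [weylSum.eq_1 G H b]
    rw [flip₂_sum, Matrix.sum_apply, Finset.mul_sum]
    refine Finset.sum_congr rfl fun β _ => ?_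
    rw [hW.sum_eq_sum_sub ha (finInt β), Matrix.sum_apply, Finset.sum_mul]
    refine Finset.sum_congr rfl fun γ _ => ?_
    rw [flip₂_smul, Matrix.smul_apply, Matrix.smul_apply, smul_eq_mul, smul_eq_mul]
    ring
  simp only [hb]
  simp only [Finset.sum_mul]
  calc _ = ∑ β : Fin N × Fin N, ∑ γ : Fin N × Fin N, ∑ x : Fin N, ∑ y : Fin N,
        a (finInt β - finInt γ) * b (finInt β) *
        (weylKron G H (finInt β - finInt γ) (x, i) (j, y) *
          flip₂ (weylKron G H (finInt β)) (k, y) (x, l)) := by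
        simp only [Finset.sum_comm (s := (Finset.univ : Finset (Fin N)))
          (t := (Finset.univ : Finset (Fin N × Fin N)))]
    _ = _ := by
        rw [Finset.sum_comm]
        refine Finset.sum_congr rfl fun γ _ => Finset.sum_congr rfl fun β _ => ?_
        simp only [← Finset.mul_sum]
        rw [hterm]

theorem WeylPair.conj (hW : WeylPair G H) (β : ℤ × ℤ) :
    ((H * G).val ⊗ₖ (1 : Matrix (Fin N) (Fin N) ℂ)) * weylKron G H β *
      (((H * G)⁻¹).val ⊗ₖ (1 : Matrix (Fin N) (Fin N) ℂ)) =
      ePi (2 * (β.2 - β.1 : ℤ) / N) • weylKron G H β := by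
  rw [weylKron, ← Matrix.mul_kronecker_mul, ← Matrix.mul_kronecker_mul, one_mul, mul_one,
    ← Units.val_mul, ← Units.val_mul, weyl_conj omegaUnit_commute hW.comm, omegaUnit_zpow_mul,
    Matrix.smul_kronecker]

end

/-! ## The Weyl pair of the elliptic `R`-matrix -/

section

variable {N : ℕ}

theorem isUnit_gHalf_det : IsUnit (gHalf N).det := by
  rw [gHalf, Matrix.det_diagonal, isUnit_iff_ne_zero]
  exact Finset.prod_ne_zero_iff.mpr fun i _ => pow_ne_zero _ (ePi_ne_zero _)

theorem gMat_eq : gMat N = gHalf N * gHalf N := by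
  rw [gMat, gHalf, Matrix.diagonal_mul_diagonal]
  congr 1
  funext i
  rw [← mul_pow, ← ePi_add]
  congr 2
  ring

/-- The invertible matrix `g^{1/2}`. -/
noncomputable def gHalfUnit (N : ℕ) : (Matrix (Fin N) (Fin N) ℂ)ˣ :=
  Matrix.nonsingInvUnit (gHalf N) isUnit_gHalf_det

theorem hMat_pow_apply [NeZero N] (k : ℕ) (i j : Fin N) :
    (hMat N ^ k) i j = if j = i + k • 1 then 1 else 0 := by
  induction k generalizing i j with
  | zero => simp [Matrix.one_apply, eq_comm]
  | succ k ih =>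
    have h1 : ∀ i j : Fin N, hMat N i j = if j = i + 1 then 1 else 0 := by
      intro i j
      rw [hMat, Matrix.of_apply]
      refine if_congr ?_ rfl rfl
      rw [Fin.ext_iff, Fin.val_add, Fin.val_one', Nat.add_mod_mod]
    rw [pow_succ', Matrix.mul_apply, Finset.sum_eq_single (i + 1)]
    · rw [h1, if_pos rfl, one_mul, ih, add_smul, one_smul, add_assoc, add_comm (1 : Fin N)]
    · intro l _ hl
      rw [h1, if_neg hl, zero_mul]
    · intro h
      exact absurd (Finset.mem_univ _) h

theorem hMat_apply [NeZero N] (i j : Fin N) : hMat N i j = if j = i + 1 then 1 else 0 := by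
  simpa using hMat_pow_apply 1 i j

theorem hMat_pow [NeZero N] : hMat N ^ N = 1 := by
  ext i j
  rw [hMat_pow_apply, Matrix.one_apply]
  have h := card_nsmul_eq_zero (x := (1 : Fin N))
  rw [Fintype.card_fin] at h
  rw [h, add_zero]
  exact if_congr eq_comm rfl rfl

/-- The invertible matrix `h`. -/
noncomputable def hUnit (N : ℕ) [NeZero N] : (Matrix (Fin N) (Fin N) ℂ)ˣ :=
  Units.ofPowEqOne (hMat N) N hMat_pow (NeZero.ne N)

theorem ePi_two_div_pow [NeZero N] : ePi (2 / N) ^ N = 1 := by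
  rw [← ePi_nat_mul, mul_div_cancel₀ _ (NeZero.ne (N : ℂ)), ePi_two]

theorem hMat_mul_gMat [NeZero N] : hMat N * gMat N = ePi (2 / N) • (gMat N * hMat N) := by
  ext i j
  rw [gMat, Matrix.mul_diagonal, Matrix.smul_apply, Matrix.diagonal_mul, hMat_apply, smul_eq_mul]
  split_ifs with h
  · subst h
    rw [Fin.val_add, Fin.val_one', Nat.add_mod_mod, one_mul, mul_one, ← pow_succ',
      ← pow_eq_pow_mod _ ePi_two_div_pow]
  · ring

/-- The invertible matrix `g`. -/
noncomputable def gUnit (N : ℕ) : (Matrix (Fin N) (Fin N) ℂ)ˣ := gHalfUnit N * gHalfUnit N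

/-- The invertible matrix `g^{1/2} h g^{-1/2}`. -/
noncomputable def hConj (N : ℕ) [NeZero N] : (Matrix (Fin N) (Fin N) ℂ)ˣ :=
  gHalfUnit N * hUnit N * (gHalfUnit N)⁻¹

theorem val_gUnit : (gUnit N).val = gMat N := gMat_eq.symm

theorem val_hConj_mul_gUnit [NeZero N] : (hConj N * gUnit N).val = twist N := by
  have h : hConj N * gUnit N = gHalfUnit N * hUnit N * gHalfUnit N := by
    rw [hConj, gUnit]
    group
  rw [h]
  rfl

theorem val_hConj_mul_gUnit_inv [NeZero N] : ((hConj N * gUnit N)⁻¹).val = (twist N)⁻¹ := by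
  rw [Matrix.coe_units_inv, val_hConj_mul_gUnit]

theorem weylPair_conj [NeZero N] : WeylPair (gUnit N) (hConj N) := by
  refine ⟨?_, ?_, ?_⟩
  · have h : hUnit N * gUnit N = omegaUnit N * (gUnit N * hUnit N) := by
      have h1 := omegaUnit_zpow_mul (N := N) 1 (gUnit N * hUnit N)
      refine Units.ext ?_
      rw [zpow_one] at h1
      rw [h1, Units.val_mul, Units.val_mul, val_gUnit, Int.cast_one, mul_one]
      exact hMat_mul_gMat
    have h2 := (omegaUnit_commute (gHalfUnit N)).eq
    calc hConj N * gUnit N = gHalfUnit N * (hUnit N * gUnit N) * (gHalfUnit N)⁻¹ := by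
          rw [hConj, gUnit]; group
      _ = gHalfUnit N * omegaUnit N * (gUnit N * hUnit N) * (gHalfUnit N)⁻¹ := by
          rw [h]; simp only [mul_assoc]
      _ = omegaUnit N * (gUnit N * hConj N) := by
          rw [← h2, hConj, gUnit]; group
  · refine Units.ext ?_
    rw [Units.val_pow_eq_pow_val, val_gUnit, gMat, Matrix.diagonal_pow, Units.val_one,
      ← Matrix.diagonal_one]
    congr 1
    funext i
    rw [Pi.pow_apply, pow_right_comm, ePi_two_div_pow, one_pow]
  · have h : hUnit N ^ N = 1 := Units.ext (by
      rw [Units.val_pow_eq_pow_val]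
      exact hMat_pow)
    rw [hConj, conj_pow, h]
    group

/-- Since g^{1/2} commutes with g, the gauge transformation affects h only. -/
theorem gauge_weyl [NeZero N] (α : Fin N × Fin N) :
    weyl (gUnit N) (hConj N) (finInt α) =
      gHalfUnit N * weyl (gUnit N) (hUnit N) (finInt α) * (gHalfUnit N)⁻¹ := by
  have hc : Commute (gHalfUnit N) (gUnit N) := by
    rw [gUnit]
    exact (Commute.refl _).mul_right (Commute.refl _)
  rw [weyl, weyl, hConj, conj_zpow, ← mul_assoc, ← mul_assoc, ← mul_assoc,
    (hc.zpow_right _).eq]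

theorem val_weyl [NeZero N] (α : Fin N × Fin N) :
    (weyl (gUnit N) (hUnit N) (finInt α)).val = iMat N α := by
  rw [weyl, finInt, zpow_natCast, zpow_natCast, Units.val_mul, Units.val_pow_eq_pow_val,
    Units.val_pow_eq_pow_val, val_gUnit, iMat]
  rfl

/-- The scalar prefactor of `R̂`. -/
noncomputable def rhoHat (N : ℕ) (ζ τ ξ : ℂ) : ℂ :=
  tauN N ζ (ζ / 2 - ξ) * (ePi (ξ * (2 / N - 2)) * invKappa N (ePi ζ) (ePi (2 * τ)) (ePi ξ ^ 2)
      * (oddTheta τ ζ / oddTheta τ (ξ + ζ)))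

/-- Separates R̂ into a scalar and a Weyl sum for the gauged pair; from here on the operator part
and the scalar part are treated independently. -/
theorem rHat_eq [NeZero N] (ζ τ ξ : ℂ) : rHat N ζ τ ξ =
    rhoHat N ζ τ ξ • weylSum (gUnit N) (hConj N) fun β => wInt N ζ τ β ξ := by
  rw [rHat, rMat, rTilde, rhoHat, Matrix.mul_smul, Matrix.smul_mul, smul_smul]
  congr 1
  rw [Finset.mul_sum, Finset.sum_mul, weylSum]
  refine Finset.sum_congr rfl fun α _ => ?_
  rw [Matrix.mul_smul, Matrix.smul_mul, wFun_eq_wInt, weylKron, gauge_weyl, conj_inv,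
    ← Matrix.mul_kronecker_mul, ← Matrix.mul_kronecker_mul]
  simp only [Units.val_mul]
  rw [val_weyl, Matrix.coe_units_inv (weyl _ _ _), val_weyl, Matrix.coe_units_inv]
  rfl

end

/-! ## Double infinite products -/

theorem summable_qPoch₂ (z : ℂ) {p Q : ℂ} (hp : ‖p‖ < 1) (hQ : ‖Q‖ < 1) :
    Summable fun n : ℕ × ℕ => ‖-(z * p ^ n.1 * Q ^ n.2)‖ := by
  have h := ((summable_geometric_of_lt_one (norm_nonneg _) hp).mul_left ‖z‖).mul_of_nonneg
    (summable_geometric_of_lt_one (norm_nonneg _) hQ) (fun n => by positivity)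
    (fun n => by positivity)
  simpa only [norm_neg, norm_mul, norm_pow] using h

theorem multipliable_qPoch₂ (z : ℂ) {p Q : ℂ} (hp : ‖p‖ < 1) (hQ : ‖Q‖ < 1) :
    Multipliable fun n : ℕ × ℕ => (1 - z * p ^ n.1 * Q ^ n.2) := by
  simpa only [sub_eq_add_neg] using multipliable_one_add_of_summable (summable_qPoch₂ z hp hQ)

theorem qPoch₂_ne_zero {z p Q : ℂ} (hp : ‖p‖ < 1) (hQ : ‖Q‖ < 1)
    (h : ∀ m n : ℕ, z * p ^ m * Q ^ n ≠ 1) : qPoch₂ z p Q ≠ 0 := by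
  simp only [qPoch₂, sub_eq_add_neg]
  refine tprod_one_add_ne_zero_of_summable (fun n => ?_) (summable_qPoch₂ z hp hQ)
  rw [← sub_eq_add_neg]
  exact sub_ne_zero.mpr (h n.1 n.2).symm

theorem hasProd_qPoch₂ (z : ℂ) {p Q : ℂ} (hp : ‖p‖ < 1) (hQ : ‖Q‖ < 1) :
    HasProd (fun m : ℕ => qPoch (z * p ^ m) Q) (qPoch₂ z p Q) :=
  (multipliable_qPoch₂ z hp hQ).hasProd.prod_fiberwise fun m =>
    (multipliable_qPoch (z * p ^ m) hQ).hasProd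

theorem qPoch₂_step_left (z : ℂ) {p Q : ℂ} (hp : ‖p‖ < 1) (hQ : ‖Q‖ < 1) :
    qPoch₂ z p Q = qPoch z Q * qPoch₂ (z * p) p Q := by
  have e : (fun m : ℕ => qPoch (z * p * p ^ m) Q) = fun m : ℕ => qPoch (z * p ^ (m + 1)) Q :=
    funext fun n => by rw [pow_succ', mul_assoc]
  have h := hasProd_qPoch₂ (z * p) hp hQ
  rw [e] at h
  have h2 := tprod_eq_zero_mul' (f := fun m : ℕ => qPoch (z * p ^ m) Q) h.multipliable
  rw [(hasProd_qPoch₂ z hp hQ).tprod_eq, h.tprod_eq, pow_zero, mul_one] at h2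
  exact h2

theorem qPoch₂_comm (z p Q : ℂ) : qPoch₂ z p Q = qPoch₂ z Q p := by
  rw [qPoch₂, qPoch₂, ← (Equiv.prodComm ℕ ℕ).tprod_eq]
  exact tprod_congr fun n => by
    simp only [Equiv.prodComm_apply, Prod.fst_swap, Prod.snd_swap]
    ring

theorem qPoch₂_step_right (z : ℂ) {p Q : ℂ} (hp : ‖p‖ < 1) (hQ : ‖Q‖ < 1) :
    qPoch₂ z p Q = qPoch z p * qPoch₂ (z * Q) p Q := by
  rw [qPoch₂_comm, qPoch₂_step_left z hQ hp, qPoch₂_comm]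

/-! ## Nondegenerate values and the factor `κ` -/

/-- `X` is not in `q^{2ℤ} p^ℤ`. -/
def Nondegenerate (q p X : ℂ) : Prop := ∀ a b : ℤ, X ≠ q ^ (2 * a) * p ^ b

namespace Nondegenerate

variable {q p X : ℂ}

theorem inv (h : Nondegenerate q p X) : Nondegenerate q p X⁻¹ := fun a b hab =>
  h (-a) (-b) (by
    rw [mul_neg, zpow_neg, zpow_neg, ← mul_inv, ← hab, inv_inv])

theorem mul (h : Nondegenerate q p X) (hq : q ≠ 0) (hp : p ≠ 0) (a b : ℤ) :
    Nondegenerate q p (q ^ (2 * a) * p ^ b * X) := fun a' b' hab =>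
  h (a' - a) (b' - b) (by
    rw [mul_sub, zpow_sub₀ hq, zpow_sub₀ hp]
    have := zpow_ne_zero (2 * a) hq
    have := zpow_ne_zero b hp
    field_simp
    linear_combination hab)

theorem bigTheta_ne_zero (h : Nondegenerate q p X) (hq : q ≠ 0) (hq1 : ‖q‖ < 1) {N : ℕ}
    (hN : N ≠ 0) : bigTheta (q ^ (2 * N)) X ≠ 0 := by
  refine EllipticAlgebra.bigTheta_ne_zero ?_ (pow_ne_zero _ hq) fun n hn => h (N * n) 0 ?_
  · rw [norm_pow]
    exact pow_lt_one₀ (norm_nonneg _) hq1 (by omega)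
  · rw [hn, zpow_zero, mul_one, ← zpow_natCast, ← zpow_mul]
    push_cast
    ring_nf

theorem bigTheta_ne_zero' (h : Nondegenerate q p X) (hp : p ≠ 0) (hp1 : ‖p‖ < 1) :
    bigTheta p X ≠ 0 := by
  refine EllipticAlgebra.bigTheta_ne_zero hp1 hp fun n hn => h 0 n ?_
  rw [hn, mul_zero, zpow_zero, one_mul]

theorem qPoch_ne_zero (h : Nondegenerate q p X) (hq : q ≠ 0) (hq1 : ‖q‖ < 1) {N : ℕ}
    (hN : N ≠ 0) : qPoch X (q ^ (2 * N)) ≠ 0 :=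
  left_ne_zero_of_mul (left_ne_zero_of_mul (h.bigTheta_ne_zero hq hq1 hN))

theorem qPoch_ne_zero' (h : Nondegenerate q p X) (hp : p ≠ 0) (hp1 : ‖p‖ < 1) :
    qPoch X p ≠ 0 :=
  left_ne_zero_of_mul (left_ne_zero_of_mul (h.bigTheta_ne_zero' hp hp1))

theorem qPoch₂_ne_zero (h : Nondegenerate q p X) (hq1 : ‖q‖ < 1)
    (hp1 : ‖p‖ < 1) {N : ℕ} (hN : N ≠ 0) : qPoch₂ X p (q ^ (2 * N)) ≠ 0 := by
  refine EllipticAlgebra.qPoch₂_ne_zero hp1 ?_ fun m n hmn => h (-(N * n)) (-m) ?_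
  · rw [norm_pow]
    exact pow_lt_one₀ (norm_nonneg _) hq1 (by omega)
  · rw [mul_neg, zpow_neg, zpow_neg, ← mul_inv, zpow_natCast]
    refine eq_inv_of_mul_eq_one_left ?_
    rw [← hmn, ← pow_mul]
    norm_cast
    ring

end Nondegenerate

section Kappa

variable {N : ℕ} {q p X : ℂ}

/-- Inverting X interchanges numerator and denominator; nondegeneracy keeps all eight products away
from 0. -/
theorem invKappa_mul_inv (hN : N ≠ 0) (hq : q ≠ 0) (hq1 : ‖q‖ < 1) (hp : p ≠ 0) (hp1 : ‖p‖ < 1)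
    (h : Nondegenerate q p X) : invKappa N q p X * invKappa N q p X⁻¹ = 1 := by
  have hn : ∀ (Y z : ℂ) (_ : Nondegenerate q p Y) (a b : ℤ), z = q ^ (2 * a) * p ^ b * Y →
      qPoch₂ z p (q ^ (2 * N)) ≠ 0 := fun Y z hY a b hz => by
    rw [hz]
    exact (hY.mul hq hp a b).qPoch₂_ne_zero hq1 hp1 hN
  have e1 : q ^ (2 * (N : ℤ)) = q ^ (2 * N) := by norm_cast
  have e2 : q ^ (2 * ((N : ℤ) - 1)) = q ^ (2 * N - 2) := by
    rw [← zpow_natCast, Nat.cast_sub (by omega)]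
    push_cast
    ring_nf
  have e3 : q ^ (2 * (1 : ℤ)) = q ^ 2 := by norm_cast
  have hx : ∀ Y, Nondegenerate q p Y → qPoch₂ (q ^ (2 * N) * Y) p (q ^ (2 * N)) ≠ 0 ∧
      qPoch₂ (q ^ 2 * Y) p (q ^ (2 * N)) ≠ 0 ∧ qPoch₂ (p * Y) p (q ^ (2 * N)) ≠ 0 ∧
      qPoch₂ (p * q ^ (2 * N - 2) * Y) p (q ^ (2 * N)) ≠ 0 := fun Y hY =>
    ⟨hn Y _ hY N 0 (by rw [e1]; simp), hn Y _ hY 1 0 (by rw [e3]; simp),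
      hn Y _ hY 0 1 (by simp), hn Y _ hY (N - 1) 1 (by rw [e2]; simp [mul_comm])⟩
  obtain ⟨a1, a2, a3, a4⟩ := hx X h
  obtain ⟨b1, b2, b3, b4⟩ := hx X⁻¹ h.inv
  rw [invKappa, invKappa, inv_inv, div_mul_div_comm, div_eq_one_iff_eq (by positivity)]
  ring

/-- Each double product moves by one step in p and sheds one simple product of base q^{2N}; the
eight simple products pair up into four theta functions. -/
theorem invKappa_mul_p (hN : N ≠ 0) (hq : q ≠ 0) (hq1 : ‖q‖ < 1) (hp : p ≠ 0) (hp1 : ‖p‖ < 1)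
    (hX : X ≠ 0) (h : Nondegenerate q p X) :
    invKappa N q p (p * X) = invKappa N q p X *
      (bigTheta (q ^ (2 * N)) (p * X) * bigTheta (q ^ (2 * N)) X⁻¹ /
        (bigTheta (q ^ (2 * N)) (q ^ 2 * X) * bigTheta (q ^ (2 * N)) (q ^ 2 * (p * X)⁻¹))) := by
  have hn : ∀ (Y z : ℂ) (_ : Nondegenerate q p Y) (a b : ℤ), z = q ^ (2 * a) * p ^ b * Y →
      qPoch₂ z p (q ^ (2 * N)) ≠ 0 ∧ qPoch z (q ^ (2 * N)) ≠ 0 := fun Y z hY a b hz => by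
    rw [hz]
    exact ⟨(hY.mul hq hp a b).qPoch₂_ne_zero hq1 hp1 hN,
      (hY.mul hq hp a b).qPoch_ne_zero hq hq1 hN⟩
  have e1 : q ^ (2 * (N : ℤ)) = q ^ (2 * N) := by norm_cast
  have e2 : q ^ (2 * ((N : ℤ) - 1)) = q ^ (2 * N - 2) := by
    rw [← zpow_natCast, Nat.cast_sub (by omega)]
    push_cast
    ring_nf
  have e3 : q ^ (2 * (1 : ℤ)) = q ^ 2 := by norm_cast
  have hQ1 : ‖q ^ (2 * N)‖ < 1 := by
    rw [norm_pow]
    exact pow_lt_one₀ (norm_nonneg _) hq1 (by omega)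
  have hr : q ^ (2 * N) = q ^ (2 * N - 2) * q ^ 2 := by
    rw [← pow_add]
    congr 1
    omega
  have hi := h.inv
  have hpX : (p * X)⁻¹ = p⁻¹ * X⁻¹ := mul_inv _ _
  have hqq := qPoch_self_ne_zero hQ1
  have b1 := (hn X⁻¹ (q ^ 2 * X⁻¹) hi 1 0 (by rw [e3]; simp)).1
  have b2 := (hn X (q ^ (2 * N) * X * p) h N 1 (by rw [e1]; simp only [zpow_ofNat]; ring)).1
  have b2' := (hn X (q ^ (2 * N) * X) h N 0 (by rw [e1]; simp)).2
  have b3 := (hn X⁻¹ (p * q ^ (2 * N - 2) * X⁻¹) hi (N - 1) 1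
    (by rw [e2]; simp only [zpow_ofNat]; ring)).1
  have b4 := (hn X (p * X * p) h 0 2 (by simp only [mul_zero, zpow_ofNat]; ring)).1
  have b4' := (hn X (p * X) h 0 1 (by simp)).2
  have b5 := (hn X⁻¹ (q ^ 2 * (p * X)⁻¹) hi 1 (-1)
    (by rw [e3, hpX]; simp only [zpow_ofNat, zpow_neg]; ring)).2
  have b6 := (hn X⁻¹ (q ^ (2 * N - 2) * X⁻¹) hi (N - 1) 0 (by rw [e2]; simp)).2
  have b7 := (hn X (q ^ 2 * X) h 1 0 (by rw [e3]; simp)).2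
  have b8 := (hn X (p * q ^ (2 * N - 2) * X) h (N - 1) 1
    (by rw [e2]; simp only [zpow_ofNat]; ring)).2
  have st := fun z => qPoch₂_step_left z hp1 hQ1
  have s1 := st (q ^ (2 * N) * (p * X)⁻¹)
  have s2 := st (q ^ 2 * X)
  have s3 := st (p * (p * X)⁻¹)
  have s4 := st (p * q ^ (2 * N - 2) * X)
  have s5 := st (q ^ (2 * N) * X)
  have s6 := st (q ^ 2 * (p * X)⁻¹)
  have s7 := st (p * X)
  have s8 := st (p * q ^ (2 * N - 2) * (p * X)⁻¹)
  have t1 : q ^ (2 * N) * (p * X)⁻¹ * p = q ^ (2 * N) * X⁻¹ := by field_simp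
  have t2 : p * (p * X)⁻¹ * p = p * X⁻¹ := by field_simp
  have t3 : q ^ 2 * (p * X)⁻¹ * p = q ^ 2 * X⁻¹ := by field_simp
  have t4 : p * q ^ (2 * N - 2) * (p * X)⁻¹ * p = p * q ^ (2 * N - 2) * X⁻¹ := by field_simp
  have t5 : p * (p * X)⁻¹ = X⁻¹ := by field_simp
  have t6 : p * q ^ (2 * N - 2) * (p * X)⁻¹ = q ^ (2 * N - 2) * X⁻¹ := by field_simp
  rw [t1] at s1
  rw [t2, t5] at s3
  rw [t3] at s6
  rw [t4, t6] at s8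
  have u1 : q ^ 2 * (p * X) = q ^ 2 * X * p := by ring
  have u2 : p * q ^ (2 * N - 2) * (p * X) = p * q ^ (2 * N - 2) * X * p := by ring
  have u3 : q ^ (2 * N) * (p * X) = q ^ (2 * N) * X * p := by ring
  have u4 : p * (p * X) = p * X * p := by ring
  -- The exponent 2N - 2 in κ is what makes the simple products with q² and with q^{2N-2} the two
  -- halves of one theta function.
  have v1 : q ^ (2 * N) * (q ^ 2 * X)⁻¹ = q ^ (2 * N - 2) * X⁻¹ := by rw [hr]; field_simp
  have v2 : q ^ (2 * N) * (q ^ 2 * (p * X)⁻¹)⁻¹ = p * q ^ (2 * N - 2) * X := by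
    rw [hr]; field_simp
  rw [invKappa, invKappa, bigTheta, bigTheta, bigTheta, bigTheta, inv_inv, v1, v2, u1, u2, u3, u4,
    t5, t6, s1, s2, s3, s4, s5, s6, s7, s8]
  clear s1 s2 s3 s4 s5 s6 s7 s8 st hn
  generalize qPoch₂ (q ^ 2 * X * p) p (q ^ (2 * N)) = A at *
  generalize qPoch₂ (q ^ 2 * X⁻¹) p (q ^ (2 * N)) = A1 at *
  generalize qPoch₂ (q ^ (2 * N) * X * p) p (q ^ (2 * N)) = A2 at *
  generalize qPoch₂ (p * q ^ (2 * N - 2) * X⁻¹) p (q ^ (2 * N)) = A3 at *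
  generalize qPoch₂ (p * X * p) p (q ^ (2 * N)) = A4 at *
  generalize qPoch (q ^ (2 * N) * X) (q ^ (2 * N)) = C1 at *
  generalize qPoch (p * X) (q ^ (2 * N)) = C2 at *
  generalize qPoch (q ^ 2 * (p * X)⁻¹) (q ^ (2 * N)) = C3 at *
  generalize qPoch (q ^ (2 * N - 2) * X⁻¹) (q ^ (2 * N)) = C4 at *
  generalize qPoch (q ^ 2 * X) (q ^ (2 * N)) = C5 at *
  generalize qPoch (p * q ^ (2 * N - 2) * X) (q ^ (2 * N)) = C6 at *
  generalize qPoch (q ^ (2 * N)) (q ^ (2 * N)) = C7 at *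
  field_simp

/-- The same telescoping in the direction q^{2N}, which leaves theta functions of nome p instead. -/
theorem invKappa_div_Q (hN : N ≠ 0) (hq : q ≠ 0) (hq1 : ‖q‖ < 1) (hp : p ≠ 0) (hp1 : ‖p‖ < 1)
    (hX : X ≠ 0) (h : Nondegenerate q p X) :
    invKappa N q p (X * (q ^ (2 * N))⁻¹) = invKappa N q p X *
      (bigTheta p (q ^ 2 * X * (q ^ (2 * N))⁻¹) * bigTheta p (q ^ 2 * X⁻¹) /
        (bigTheta p (q ^ (2 * N) * X⁻¹) * bigTheta p X)) := by
  have hn : ∀ (Y z : ℂ) (_ : Nondegenerate q p Y) (a b : ℤ), z = q ^ (2 * a) * p ^ b * Y →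
      qPoch₂ z p (q ^ (2 * N)) ≠ 0 ∧ qPoch z p ≠ 0 := fun Y z hY a b hz => by
    rw [hz]
    exact ⟨(hY.mul hq hp a b).qPoch₂_ne_zero hq1 hp1 hN,
      (hY.mul hq hp a b).qPoch_ne_zero' hp hp1⟩
  have e1 : q ^ (2 * (N : ℤ)) = q ^ (2 * N) := by norm_cast
  have e1' : q ^ (2 * (-N : ℤ)) = (q ^ (2 * N))⁻¹ := by rw [mul_neg, zpow_neg, e1]
  have e2 : q ^ (2 * ((N : ℤ) - 1)) = q ^ (2 * N - 2) := by
    rw [← zpow_natCast, Nat.cast_sub (by omega)]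
    push_cast
    ring_nf
  have e3 : q ^ (2 * (1 : ℤ)) = q ^ 2 := by norm_cast
  have hQ1 : ‖q ^ (2 * N)‖ < 1 := by
    rw [norm_pow]
    exact pow_lt_one₀ (norm_nonneg _) hq1 (by omega)
  have hr : q ^ (2 * N) = q ^ (2 * N - 2) * q ^ 2 := by
    rw [← pow_add]
    congr 1
    omega
  have hQ : q ^ (2 * N) ≠ 0 := pow_ne_zero _ hq
  have hi := h.inv
  have hqq := qPoch_self_ne_zero hp1
  have b1 := hn X (q ^ (2 * N) * X) h N 0 (by rw [e1]; simp)
  have b2 := hn X⁻¹ (q ^ 2 * X⁻¹ * q ^ (2 * N)) hi (N + 1) 0 (by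
    rw [mul_add, zpow_add₀ hq, e1, e3]; simp only [zpow_ofNat]; ring)
  have b2' := hn X⁻¹ (q ^ 2 * X⁻¹) hi 1 0 (by rw [e3]; simp)
  have b3 := hn X (p * X) h 0 1 (by simp)
  have b4 := hn X⁻¹ (p * q ^ (2 * N - 2) * X⁻¹) hi (N - 1) 1
    (by rw [e2]; simp only [zpow_ofNat]; ring)
  have b4' := hn X⁻¹ (p * q ^ (2 * N - 2) * X⁻¹ * q ^ (2 * N)) hi (N - 1 + N) 1 (by
    rw [mul_add, zpow_add₀ hq, e2, e1]; simp only [zpow_ofNat]; ring)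
  have b5 := hn X⁻¹ (q ^ (2 * N) * X⁻¹) hi N 0 (by rw [e1]; simp)
  have b6 := hn X⁻¹ (p * X⁻¹) hi 0 1 (by simp)
  have b7 := hn X X h 0 0 (by simp)
  have b8 := hn X (p * (X * (q ^ (2 * N))⁻¹)) h (-N) 1 (by rw [e1']; simp only [zpow_ofNat]; ring)
  have st := fun z => qPoch₂_step_right z hp1 hQ1
  have s1 := st (q ^ (2 * N) * X⁻¹)
  have s2 := st (q ^ 2 * (X * (q ^ (2 * N))⁻¹))
  have s3 := st (p * X⁻¹)
  have s4 := st (p * q ^ (2 * N - 2) * (X * (q ^ (2 * N))⁻¹))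
  have s5 := st X
  have s6 := st (q ^ 2 * X⁻¹)
  have s7 := st (p * (X * (q ^ (2 * N))⁻¹))
  have s8 := st (p * q ^ (2 * N - 2) * X⁻¹)
  have t2 : q ^ 2 * (X * (q ^ (2 * N))⁻¹) * q ^ (2 * N) = q ^ 2 * X := by field_simp
  have t4 : p * q ^ (2 * N - 2) * (X * (q ^ (2 * N))⁻¹) * q ^ (2 * N) =
    p * q ^ (2 * N - 2) * X := by field_simp
  have t7 : p * (X * (q ^ (2 * N))⁻¹) * q ^ (2 * N) = p * X := by field_simp
  rw [t2] at s2
  rw [t4] at s4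
  rw [t7] at s7
  have u0 : (X * (q ^ (2 * N))⁻¹)⁻¹ = X⁻¹ * q ^ (2 * N) := by rw [mul_inv, inv_inv]
  have u1 : q ^ (2 * N) * (X⁻¹ * q ^ (2 * N)) = q ^ (2 * N) * X⁻¹ * q ^ (2 * N) := by ring
  have u2 : p * (X⁻¹ * q ^ (2 * N)) = p * X⁻¹ * q ^ (2 * N) := by ring
  have u3 : q ^ (2 * N) * (X * (q ^ (2 * N))⁻¹) = X := by field_simp
  have u4 : q ^ 2 * (X⁻¹ * q ^ (2 * N)) = q ^ 2 * X⁻¹ * q ^ (2 * N) := by ring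
  have u5 : p * q ^ (2 * N - 2) * (X⁻¹ * q ^ (2 * N)) =
    p * q ^ (2 * N - 2) * X⁻¹ * q ^ (2 * N) := by ring
  have v0 : q ^ 2 * X * (q ^ (2 * N))⁻¹ = q ^ 2 * (X * (q ^ (2 * N))⁻¹) := by ring
  have v1 : p * (q ^ 2 * (X * (q ^ (2 * N))⁻¹))⁻¹ = p * q ^ (2 * N - 2) * X⁻¹ := by
    rw [hr]; field_simp
  have v2 : p * (q ^ 2 * X⁻¹)⁻¹ = p * q ^ (2 * N - 2) * (X * (q ^ (2 * N))⁻¹) := by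
    rw [hr]; field_simp
  have v3 : p * (q ^ (2 * N) * X⁻¹)⁻¹ = p * (X * (q ^ (2 * N))⁻¹) := by field_simp
  have u6 : qPoch₂ (q ^ (2 * N) * X) p (q ^ (2 * N)) = qPoch₂ (X * q ^ (2 * N)) p (q ^ (2 * N)) := by
    rw [mul_comm]
  have b1' := b1.1
  rw [u6] at b1'
  rw [invKappa, invKappa, bigTheta, bigTheta, bigTheta, bigTheta, u0, u1, u2, u3, u4, u5, u6, v0,
    v1, v2, v3, s1, s2, s3, s4, s5, s6, s7, s8]
  replace b2 := b2.1
  replace b2' := b2'.2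
  replace b5 := b5.2
  replace b6 := b6.2
  replace b7 := b7.2
  replace b8 := b8.2
  replace b4' := b4'.1
  replace b4 := b4.2
  replace b3 := b3.1
  clear s1 s2 s3 s4 s5 s6 s7 s8 st hn b1
  generalize qPoch₂ (X * q ^ (2 * N)) p (q ^ (2 * N)) = A at *
  generalize qPoch₂ (q ^ 2 * X⁻¹ * q ^ (2 * N)) p (q ^ (2 * N)) = A1 at *
  generalize qPoch₂ (p * q ^ (2 * N - 2) * X⁻¹ * q ^ (2 * N)) p (q ^ (2 * N)) = A2 at *
  generalize qPoch₂ (p * X) p (q ^ (2 * N)) = A3 at *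
  generalize qPoch (q ^ (2 * N) * X⁻¹) p = C1 at *
  generalize qPoch (q ^ 2 * X⁻¹) p = C2 at *
  generalize qPoch (p * X⁻¹) p = C3 at *
  generalize qPoch (p * q ^ (2 * N - 2) * X⁻¹) p = C4 at *
  generalize qPoch (p * (X * (q ^ (2 * N))⁻¹)) p = C5 at *
  generalize qPoch X p = C6 at *
  generalize qPoch p p = C7 at *
  field_simp

end Kappa

/-! ## The scalar factor of `R̂` -/

section

variable {N : ℕ} {ζ τ ξ : ℂ}

theorem ePi_sq (ξ : ℂ) : ePi ξ ^ 2 = ePi (2 * ξ) := by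
  rw [← ePi_nat_mul]
  norm_num

theorem Nondegenerate.oddTheta_ne_zero (hτ : 0 < τ.im)
    (h : Nondegenerate (ePi ζ) (ePi (2 * τ)) (ePi ξ ^ 2)) (n : ℤ) :
    oddTheta τ (ξ + n * ζ) ≠ 0 := fun h0 => by
  obtain ⟨a, b, hab⟩ := (oddTheta_eq_zero_iff _ hτ).mp h0
  refine h (-n) b ?_
  rw [ePi_sq, ← ePi_int_mul, ← ePi_int_mul, ← ePi_add, ePi_eq_iff]
  exact ⟨a, by push_cast; linear_combination 2 * hab⟩

theorem oddTheta_ne_zero_of_sq_ne (hτ : 0 < τ.im)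
    (hR : ∀ k : ℤ, ePi ζ ^ 2 ≠ ePi (2 * τ) ^ k) : oddTheta τ ζ ≠ 0 := fun h0 => by
  obtain ⟨a, b, hab⟩ := (oddTheta_eq_zero_iff _ hτ).mp h0
  refine hR b ?_
  rw [ePi_sq, ← ePi_int_mul, ePi_eq_iff]
  exact ⟨a, by linear_combination 2 * hab⟩

theorem oddTheta_add_int (hτ : 0 < τ.im) (v : ℂ) (n : ℤ) :
    oddTheta τ (v + n) = (-1) ^ n * oddTheta τ v := by
  have h1 : ∀ v, oddTheta τ (v + 1) = -oddTheta τ v := (orderOne_thetaChar hτ).2.add_one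
  induction n using Int.induction_on with
  | zero => simp
  | succ n ih =>
    rw [Int.cast_add, Int.cast_one, ← add_assoc, h1, ih, zpow_add₀ (by norm_num), zpow_one]
    ring
  | pred n ih =>
    have h2 := h1 (v + ((-(n : ℤ) - 1 : ℤ) : ℂ))
    rw [show v + ((-(n : ℤ) - 1 : ℤ) : ℂ) + 1 = v + ((-(n : ℤ) : ℤ) : ℂ) by push_cast; ring, ih] at h2
    rw [zpow_sub₀ (by norm_num), zpow_one]
    linear_combination h2

/-- The ratio of the shifted and of the unshifted `R̂`, as a function of `Z = z²`. -/
noncomputable def shiftFactor (N : ℕ) (ζ Z : ℂ) : ℂ :=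
  ePi (ζ * (2 - 2 / N)) *
    (bigTheta (ePi ζ ^ (2 * N)) Z * bigTheta (ePi ζ ^ (2 * N)) Z⁻¹ /
      (bigTheta (ePi ζ ^ (2 * N)) (ePi ζ ^ 2 * Z) * bigTheta (ePi ζ ^ (2 * N)) (ePi ζ ^ 2 * Z⁻¹)))

theorem norm_ePi_pow_lt_one (hζ : 0 < ζ.im) (hN : N ≠ 0) : ‖ePi ζ ^ (2 * N)‖ < 1 := by
  rw [norm_pow]
  exact pow_lt_one₀ (norm_nonneg _) (norm_ePi_lt_one hζ) (by omega)

/-- The multipliers of the four theta functions cancel. Thus U takes the same value at s and at s -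
Nζ, so the crossing shift is invisible to it. -/
theorem shiftFactor_mul (hζ : 0 < ζ.im) (hN : N ≠ 0) {Z : ℂ} (hZ : Z ≠ 0) :
    shiftFactor N ζ (ePi ζ ^ (2 * N) * Z) = shiftFactor N ζ Z := by
  have hQ1 := norm_ePi_pow_lt_one (N := N) hζ hN
  have hq := ePi_ne_zero ζ
  have hQ : ePi ζ ^ (2 * N) ≠ 0 := pow_ne_zero _ hq
  have h0 : bigTheta (ePi ζ ^ (2 * N)) (ePi ζ ^ (2 * N) * Z)⁻¹ =
      -(ePi ζ ^ (2 * N) * Z)⁻¹ * (-Z⁻¹ * bigTheta (ePi ζ ^ (2 * N)) Z) := by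
    rw [bigTheta_inv hQ1 (mul_ne_zero hQ hZ), bigTheta_mul_self hQ1 hQ hZ]
  have h1 : bigTheta (ePi ζ ^ (2 * N)) (ePi ζ ^ 2 * (ePi ζ ^ (2 * N) * Z)) =
      -(ePi ζ ^ 2 * Z)⁻¹ * bigTheta (ePi ζ ^ (2 * N)) (ePi ζ ^ 2 * Z) := by
    rw [mul_left_comm, bigTheta_mul_self hQ1 hQ (mul_ne_zero (pow_ne_zero _ hq) hZ)]
  have h2 : bigTheta (ePi ζ ^ (2 * N)) (ePi ζ ^ 2 * Z⁻¹) =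
      -(ePi ζ ^ 2 * (ePi ζ ^ (2 * N) * Z)⁻¹)⁻¹ *
        bigTheta (ePi ζ ^ (2 * N)) (ePi ζ ^ 2 * (ePi ζ ^ (2 * N) * Z)⁻¹) := by
    rw [← bigTheta_mul_self hQ1 hQ (by positivity)]
    congr 1
    field_simp
  rw [shiftFactor, shiftFactor, h0, h1, h2, bigTheta_mul_self hQ1 hQ hZ, bigTheta_inv hQ1 hZ]
  generalize bigTheta (ePi ζ ^ (2 * N)) Z = A
  generalize bigTheta (ePi ζ ^ (2 * N)) (ePi ζ ^ 2 * Z) = B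
  generalize bigTheta (ePi ζ ^ (2 * N)) (ePi ζ ^ 2 * (ePi ζ ^ (2 * N) * Z)⁻¹) = C
  field_simp

theorem shiftFactor_ne_zero (hζ : 0 < ζ.im) (hN : N ≠ 0) {p Z : ℂ} (hp : p ≠ 0)
    (h : Nondegenerate (ePi ζ) p Z) : shiftFactor N ζ Z ≠ 0 := by
  have hq := ePi_ne_zero ζ
  have hθ : ∀ {Y}, Nondegenerate (ePi ζ) p Y → bigTheta (ePi ζ ^ (2 * N)) Y ≠ 0 := fun hY =>
    hY.bigTheta_ne_zero hq (norm_ePi_lt_one hζ) hN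
  have hm : ∀ {Y}, Nondegenerate (ePi ζ) p Y → Nondegenerate (ePi ζ) p (ePi ζ ^ 2 * Y) :=
    fun hY => by simpa using hY.mul hq hp 1 0
  exact mul_ne_zero (ePi_ne_zero _) (div_ne_zero (mul_ne_zero (hθ h) (hθ h.inv))
    (mul_ne_zero (hθ (hm h)) (hθ (hm h.inv))))

/-- The fractional powers of z in τ_N and in R̃ cancel, leaving only a power of q; the rest of the
prefactor, apart from the odd theta function, depends on z². -/
theorem rhoHat_eq (N : ℕ) (ζ τ ξ : ℂ) : rhoHat N ζ τ ξ = ePi (ζ * (1 / N - 1)) *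
    (bigTheta (ePi ζ ^ (2 * N)) (ePi ζ ^ 2 * (ePi ξ ^ 2)⁻¹) /
      bigTheta (ePi ζ ^ (2 * N)) (ePi ξ ^ 2)) *
    invKappa N (ePi ζ) (ePi (2 * τ)) (ePi ξ ^ 2) * (oddTheta τ ζ / oddTheta τ (ξ + ζ)) := by
  have h1 : ePi (ζ / 2 - ξ) ^ 2 = ePi ζ * (ePi ξ ^ 2)⁻¹ := by
    rw [ePi_sq, ePi_sq, ← ePi_neg, ← ePi_add]
    congr 1
    ring
  have h2 : ePi ζ * (ePi ζ * (ePi ξ ^ 2)⁻¹) = ePi ζ ^ 2 * (ePi ξ ^ 2)⁻¹ := by ring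
  have h3 : ePi ζ * (ePi ζ * (ePi ξ ^ 2)⁻¹)⁻¹ = ePi ξ ^ 2 := by
    have := ePi_ne_zero ζ
    have := ePi_ne_zero ξ
    field_simp
  have h4 : ePi (ζ * (1 / N - 1)) = ePi ((ζ / 2 - ξ) * (2 / N - 2)) * ePi (ξ * (2 / N - 2)) := by
    rw [← ePi_add]
    congr 1
    ring
  rw [rhoHat, tauN, h1, h2, h3, h4]
  ring

theorem rhoHat_mul_neg (hζ : 0 < ζ.im) (hτ : 0 < τ.im) (hN : N ≠ 0)
    (h : Nondegenerate (ePi ζ) (ePi (2 * τ)) (ePi ξ ^ 2)) :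
    rhoHat N ζ τ ξ * rhoHat N ζ τ (-ξ) * (oddTheta τ (ζ + ξ) * oddTheta τ (ζ - ξ)) =
      (shiftFactor N ζ (ePi ξ ^ 2))⁻¹ * oddTheta τ ζ ^ 2 := by
  have hτ2 : 0 < (2 * τ).im := by simpa using hτ
  have hκ := invKappa_mul_inv hN (ePi_ne_zero ζ) (norm_ePi_lt_one hζ) (ePi_ne_zero _)
    (norm_ePi_lt_one hτ2) h
  have hi : ePi (-ξ) ^ 2 = (ePi ξ ^ 2)⁻¹ := by rw [ePi_neg, inv_pow]
  have t1 : oddTheta τ (ξ + ζ) ≠ 0 := by simpa using h.oddTheta_ne_zero hτ 1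
  have t2 : oddTheta τ (-ξ + ζ) ≠ 0 := by
    have := h.inv
    rw [← hi] at this
    simpa using this.oddTheta_ne_zero hτ 1
  have he : ePi (ζ * (2 - 2 / N)) = (ePi (ζ * (1 / N - 1)) * ePi (ζ * (1 / N - 1)))⁻¹ := by
    rw [← ePi_add, ← ePi_neg]
    congr 1
    ring
  have k5 := left_ne_zero_of_mul (hκ.trans_ne one_ne_zero)
  have k6 := ePi_ne_zero (ζ * (1 / N - 1))
  rw [rhoHat_eq, rhoHat_eq, hi, inv_inv, shiftFactor, he, add_comm ζ ξ,
    show ζ - ξ = -ξ + ζ by ring, eq_inv_of_mul_eq_one_right hκ]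
  generalize invKappa N (ePi ζ) (ePi (2 * τ)) (ePi ξ ^ 2) = K at *
  generalize ePi (ζ * (1 / N - 1)) = a at *
  generalize bigTheta (ePi ζ ^ (2 * N)) (ePi ζ ^ 2 * (ePi ξ ^ 2)⁻¹) = A
  generalize bigTheta (ePi ζ ^ (2 * N)) (ePi ζ ^ 2 * ePi ξ ^ 2) = B
  generalize bigTheta (ePi ζ ^ (2 * N)) (ePi ξ ^ 2) = D
  generalize bigTheta (ePi ζ ^ (2 * N)) (ePi ξ ^ 2)⁻¹ = E
  generalize oddTheta τ (ξ + ζ) = t at *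
  generalize oddTheta τ (-ξ + ζ) = t' at *
  field_simp

/-- The multiplier at ξ + ζ/N is the part common to all w_β, and the one at ξ + ζ comes from the
denominator of ρ; their ratio q^{2-2/N} is the constant in `shiftFactor`. The remaining theta
functions come from κ. -/
theorem rhoHat_add_tau (hζ : 0 < ζ.im) (hτ : 0 < τ.im) (hN : N ≠ 0)
    (h : Nondegenerate (ePi ζ) (ePi (2 * τ)) (ePi ξ ^ 2)) :
    rhoHat N ζ τ (ξ + (τ + 1)) * -thetaMult τ (ξ + ζ / N) =
      shiftFactor N ζ (ePi ξ ^ 2) * rhoHat N ζ τ ξ := by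
  have hτ2 : 0 < (2 * τ).im := by simpa using hτ
  have hq := ePi_ne_zero ζ
  have hp := ePi_ne_zero (2 * τ)
  have hX : ePi ξ ^ 2 ≠ 0 := pow_ne_zero _ (ePi_ne_zero ξ)
  have hκ := invKappa_mul_p hN hq (norm_ePi_lt_one hζ) hp (norm_ePi_lt_one hτ2) hX h
  have hθ : ∀ {Y}, Nondegenerate (ePi ζ) (ePi (2 * τ)) Y → bigTheta (ePi ζ ^ (2 * N)) Y ≠ 0 :=
    fun hY => hY.bigTheta_ne_zero hq (norm_ePi_lt_one hζ) hN
  have hpX : Nondegenerate (ePi ζ) (ePi (2 * τ)) (ePi (2 * τ) * ePi ξ ^ 2) := by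
    simpa using h.mul hq hp 0 1
  have d1 := hθ h
  have d2 := hθ hpX
  have d3 : bigTheta (ePi ζ ^ (2 * N)) (ePi ζ ^ 2 * (ePi (2 * τ) * ePi ξ ^ 2)⁻¹) ≠ 0 :=
    hθ (by simpa only [mul_one, zpow_zero, zpow_ofNat, pow_zero] using hpX.inv.mul hq hp 1 0)
  have d4 : bigTheta (ePi ζ ^ (2 * N)) (ePi ζ ^ 2 * (ePi ξ ^ 2)⁻¹) ≠ 0 :=
    hθ (by simpa only [mul_one, zpow_zero, zpow_ofNat, pow_zero] using h.inv.mul hq hp 1 0)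
  have d5 : bigTheta (ePi ζ ^ (2 * N)) (ePi ζ ^ 2 * (ePi ξ ^ 2)) ≠ 0 :=
    hθ (by simpa only [mul_one, zpow_zero, zpow_ofNat, pow_zero] using h.mul hq hp 1 0)
  have e1 : ePi (ξ + (τ + 1)) ^ 2 = ePi (2 * τ) * ePi ξ ^ 2 := by
    rw [ePi_sq, ePi_sq, ← ePi_add, ePi_eq_iff]
    exact ⟨1, by push_cast; ring⟩
  have e2 : oddTheta τ (ξ + (τ + 1) + ζ) = -thetaMult τ (ξ + ζ) * oddTheta τ (ξ + ζ) := by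
    have hO := (orderOne_thetaChar hτ).2
    have h1 : ∀ v, oddTheta τ (v + 1) = -oddTheta τ v := hO.add_one
    have h2 : ∀ v, oddTheta τ (v + τ) = thetaMult τ v * oddTheta τ v := hO.add_tau
    rw [show ξ + (τ + 1) + ζ = ξ + ζ + τ + 1 by ring, h1, h2]
    ring
  have e3 : thetaMult τ (ξ + ζ / N) = ePi (ζ * (2 - 2 / N)) * thetaMult τ (ξ + ζ) := by
    rw [thetaMult, thetaMult, ← ePi_add]
    congr 1
    ring
  have t1 : oddTheta τ (ξ + ζ) ≠ 0 := by simpa using h.oddTheta_ne_zero hτ 1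
  have t2 : thetaMult τ (ξ + ζ) ≠ 0 := ePi_ne_zero _
  rw [rhoHat_eq, rhoHat_eq, e1, e2, e3, hκ, shiftFactor]
  generalize bigTheta (ePi ζ ^ (2 * N)) (ePi (2 * τ) * ePi ξ ^ 2) = A at *
  generalize bigTheta (ePi ζ ^ (2 * N)) (ePi ζ ^ 2 * (ePi (2 * τ) * ePi ξ ^ 2)⁻¹) = B at *
  generalize bigTheta (ePi ζ ^ (2 * N)) (ePi ζ ^ 2 * (ePi ξ ^ 2)⁻¹) = C at *
  generalize bigTheta (ePi ζ ^ (2 * N)) (ePi ζ ^ 2 * ePi ξ ^ 2) = D at *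
  generalize bigTheta (ePi ζ ^ (2 * N)) (ePi ξ ^ 2) = E at *
  generalize bigTheta (ePi ζ ^ (2 * N)) (ePi ξ ^ 2)⁻¹ = G at *
  generalize thetaMult τ (ξ + ζ) = H at *
  generalize oddTheta τ (ξ + ζ) = I at *
  field_simp

/-- The nome-p theta functions created by κ under Z ↦ q^{-2N}Z cancel against the odd theta
functions once these are written as products; the unknown constant of proportionality cancels too.
-/
theorem rhoHat_crossing (hζ : 0 < ζ.im) (hτ : 0 < τ.im) (hN : N ≠ 0)
    (h : Nondegenerate (ePi ζ) (ePi (2 * τ)) (ePi ξ ^ 2)) (hθ : oddTheta τ ζ ≠ 0) :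
    rhoHat N ζ τ (ξ - N * ζ) * rhoHat N ζ τ (-ξ) *
      (oddTheta τ (ξ - N * ζ) * oddTheta τ (-ξ) / oddTheta τ ζ ^ 2) =
      (shiftFactor N ζ (ePi ξ ^ 2))⁻¹ := by
  have hτ2 : 0 < (2 * τ).im := by simpa using hτ
  have hq := ePi_ne_zero ζ
  have hp := ePi_ne_zero (2 * τ)
  have hp1 := norm_ePi_lt_one hτ2
  have hX : ePi ξ ^ 2 ≠ 0 := pow_ne_zero _ (ePi_ne_zero ξ)
  have hQ : ePi ζ ^ (2 * N) ≠ 0 := pow_ne_zero _ hq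
  have hQ1 := norm_ePi_pow_lt_one (N := N) hζ hN
  have hκ := invKappa_mul_inv hN hq (norm_ePi_lt_one hζ) hp hp1 h
  have hκQ := invKappa_div_Q hN hq (norm_ePi_lt_one hζ) hp hp1 hX h
  have hi : ePi (-ξ) ^ 2 = (ePi ξ ^ 2)⁻¹ := by rw [ePi_neg, inv_pow]
  have hs : ePi (ξ - N * ζ) ^ 2 = ePi ξ ^ 2 * (ePi ζ ^ (2 * N))⁻¹ := by
    rw [ePi_sub, ePi_nat_mul, div_pow, ← pow_mul, mul_comm N, div_eq_mul_inv]
  -- in terms of the multiplicative theta function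
  obtain ⟨⟨C, hC, hCθ⟩, -⟩ := orderOne_thetaChar hτ
  replace hCθ : ∀ v, oddTheta τ v = C * (ePi (-v) * bigTheta (ePi (2 * τ)) (ePi v ^ 2)) :=
    fun v => by rw [ePi_sq]; exact hCθ v
  have ee : ePi (-(ξ - N * ζ)) * ePi (-(-ξ)) =
      ePi ζ ^ 2 * (ePi (-(ξ - N * ζ + ζ)) * ePi (-(-ξ + ζ))) := by
    rw [ePi_sq, ← ePi_add, ← ePi_add, ← ePi_add]
    congr 1
    ring
  have s1 : ePi (ξ - N * ζ + ζ) ^ 2 = ePi ζ ^ 2 * ePi ξ ^ 2 * (ePi ζ ^ (2 * N))⁻¹ := by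
    rw [ePi_add, mul_pow, hs]
    ring
  have s2 : ePi (-ξ + ζ) ^ 2 = ePi ζ ^ 2 * (ePi ξ ^ 2)⁻¹ := by
    rw [ePi_add, mul_pow, hi]
    ring
  have nz1 : oddTheta τ (ξ - N * ζ + ζ) ≠ 0 := by
    have := h.oddTheta_ne_zero hτ (1 - N)
    rwa [show ξ + ((1 - N : ℤ) : ℂ) * ζ = ξ - N * ζ + ζ by push_cast; ring] at this
  have nz2 : oddTheta τ (-ξ + ζ) ≠ 0 := by
    have := h.inv
    rw [← hi] at this
    simpa using this.oddTheta_ne_zero hτ 1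
  have hQQ : ePi ζ ^ (2 * (N : ℤ)) = ePi ζ ^ (2 * N) := by norm_cast
  have hQX : Nondegenerate (ePi ζ) (ePi (2 * τ)) (ePi ζ ^ (2 * N) * (ePi ξ ^ 2)⁻¹) := by
    simpa only [zpow_zero, mul_one, hQQ] using h.inv.mul hq hp N 0
  have nz3 := hQX.bigTheta_ne_zero' hp hp1
  have nz4 := h.bigTheta_ne_zero' hp hp1
  have i1 : bigTheta (ePi (2 * τ)) (ePi ξ ^ 2 * (ePi ζ ^ (2 * N))⁻¹) =
      -(ePi ξ ^ 2 * (ePi ζ ^ (2 * N))⁻¹) *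
        bigTheta (ePi (2 * τ)) (ePi ζ ^ (2 * N) * (ePi ξ ^ 2)⁻¹) := by
    rw [show ePi ξ ^ 2 * (ePi ζ ^ (2 * N))⁻¹ = (ePi ζ ^ (2 * N) * (ePi ξ ^ 2)⁻¹)⁻¹ by
      rw [mul_inv, inv_inv, mul_comm]]
    exact bigTheta_inv hp1 (mul_ne_zero hQ (inv_ne_zero hX))
  have i2 := bigTheta_inv hp1 hX
  have i3 : bigTheta (ePi ζ ^ (2 * N)) (ePi ξ ^ 2) =
      -(ePi ξ ^ 2 * (ePi ζ ^ (2 * N))⁻¹)⁻¹ *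
        bigTheta (ePi ζ ^ (2 * N)) (ePi ξ ^ 2 * (ePi ζ ^ (2 * N))⁻¹) := by
    rw [← bigTheta_mul_self hQ1 hQ (mul_ne_zero hX (inv_ne_zero hQ))]
    congr 1
    field_simp
  have i4 : bigTheta (ePi ζ ^ (2 * N)) (ePi ζ ^ 2 * (ePi ξ ^ 2 * (ePi ζ ^ (2 * N))⁻¹)⁻¹) =
      -(ePi ζ ^ 2 * (ePi ξ ^ 2)⁻¹)⁻¹ *
        bigTheta (ePi ζ ^ (2 * N)) (ePi ζ ^ 2 * (ePi ξ ^ 2)⁻¹) := by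
    rw [← bigTheta_mul_self hQ1 hQ (mul_ne_zero (pow_ne_zero _ hq) (inv_ne_zero hX))]
    congr 1
    field_simp
  have he : ePi (ζ * (2 - 2 / N)) = (ePi (ζ * (1 / N - 1)) * ePi (ζ * (1 / N - 1)))⁻¹ := by
    rw [← ePi_add, ← ePi_neg]
    congr 1
    ring
  have nzX : bigTheta (ePi ζ ^ (2 * N)) (ePi ξ ^ 2 * (ePi ζ ^ (2 * N))⁻¹) ≠ 0 := by
    refine right_ne_zero_of_mul (a := -(ePi ξ ^ 2 * (ePi ζ ^ (2 * N))⁻¹)⁻¹) ?_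
    rw [← i3]
    exact h.bigTheta_ne_zero hq (norm_ePi_lt_one hζ) hN
  have hθθ : oddTheta τ (ξ - N * ζ) * oddTheta τ (-ξ) = ePi ζ ^ 2 * (ePi ζ ^ (2 * N))⁻¹ *
      (bigTheta (ePi (2 * τ)) (ePi ζ ^ (2 * N) * (ePi ξ ^ 2)⁻¹) * bigTheta (ePi (2 * τ)) (ePi ξ ^ 2)) *
      (C * ePi (-(ξ - N * ζ + ζ)) * (C * ePi (-(-ξ + ζ)))) := by
    rw [hCθ (ξ - N * ζ), hCθ (-ξ), hs, hi, i1, i2]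
    linear_combination (exp := 1) C ^ 2 * (ePi ζ ^ (2 * N))⁻¹ *
      (bigTheta (ePi (2 * τ)) (ePi ζ ^ (2 * N) * (ePi ξ ^ 2)⁻¹) * bigTheta (ePi (2 * τ)) (ePi ξ ^ 2))
      * ((ePi ξ ^ 2) * (ePi ξ ^ 2)⁻¹) * ee + C ^ 2 * (ePi ζ ^ (2 * N))⁻¹ *
      (bigTheta (ePi (2 * τ)) (ePi ζ ^ (2 * N) * (ePi ξ ^ 2)⁻¹) * bigTheta (ePi (2 * τ)) (ePi ξ ^ 2))
      * (ePi ζ ^ 2 * (ePi (-(ξ - N * ζ + ζ)) * ePi (-(-ξ + ζ)))) * mul_inv_cancel₀ hX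
  have hθ1 := hCθ (ξ - N * ζ + ζ)
  have hθ2 := hCθ (-ξ + ζ)
  rw [s1] at hθ1
  rw [s2] at hθ2
  have k5 := left_ne_zero_of_mul (hκ.trans_ne one_ne_zero)
  have k6 := ePi_ne_zero (ζ * (1 / N - 1))
  rw [hθ1] at nz1
  rw [hθ2] at nz2
  rw [rhoHat_eq, rhoHat_eq, hi, hs, inv_inv, shiftFactor, he, hκQ, i4, i3, hθθ,
    eq_inv_of_mul_eq_one_right hκ, hθ1, hθ2]
  have k1 := right_ne_zero_of_mul (right_ne_zero_of_mul nz1)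
  have k2 := right_ne_zero_of_mul (right_ne_zero_of_mul nz2)
  have k3 := left_ne_zero_of_mul (right_ne_zero_of_mul nz1)
  have k4 := left_ne_zero_of_mul (right_ne_zero_of_mul nz2)
  clear i1 i2 i3 i4 hθθ hθ1 hθ2 nz1 nz2 hQX hκ hκQ he hQQ s1 s2 ee hCθ hi hs h hQ1 hp1 hτ2
  generalize invKappa N (ePi ζ) (ePi (2 * τ)) (ePi ξ ^ 2) = K at *
  generalize ePi (ζ * (1 / N - 1)) = a at *
  generalize bigTheta (ePi ζ ^ (2 * N)) (ePi ζ ^ 2 * (ePi ξ ^ 2)⁻¹) = A at *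
  generalize bigTheta (ePi ζ ^ (2 * N)) (ePi ζ ^ 2 * ePi ξ ^ 2) = B at *
  generalize bigTheta (ePi ζ ^ (2 * N)) (ePi ξ ^ 2 * (ePi ζ ^ (2 * N))⁻¹) = D at *
  generalize bigTheta (ePi ζ ^ (2 * N)) (ePi ξ ^ 2)⁻¹ = E at *
  generalize bigTheta (ePi (2 * τ)) (ePi ζ ^ (2 * N) * (ePi ξ ^ 2)⁻¹) = F at *
  generalize bigTheta (ePi (2 * τ)) (ePi ξ ^ 2) = G at *
  generalize bigTheta (ePi (2 * τ)) (ePi ζ ^ 2 * ePi ξ ^ 2 * (ePi ζ ^ (2 * N))⁻¹) = H at *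
  generalize bigTheta (ePi (2 * τ)) (ePi ζ ^ 2 * (ePi ξ ^ 2)⁻¹) = I at *
  generalize oddTheta τ ζ = t at *
  generalize ePi (-(ξ - N * ζ + ζ)) = u at *
  generalize ePi (-(-ξ + ζ)) = v at *
  generalize ePi ζ ^ (2 * N) = Q at *
  field_simp

end

/-! ## The properties of `R̂` -/

section

variable {N : ℕ} {ζ τ ξ : ℂ}

theorem weylSum_smul {G H : (Matrix (Fin N) (Fin N) ℂ)ˣ} (c : ℂ) (a : ℤ × ℤ → ℂ) :
    weylSum G H (fun β => c * a β) = c • weylSum G H a := by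
  simp only [weylSum, Finset.smul_sum, smul_smul]

theorem finInt_zero [NeZero N] : finInt (0 : Fin N × Fin N) = 0 := by
  ext <;> simp [finInt]

theorem rHat_mul_flip [NeZero N] (hζ : 0 < ζ.im) (hτ : 0 < τ.im) (hθ : oddTheta τ ζ ≠ 0)
    (h : Nondegenerate (ePi ζ) (ePi (2 * τ)) (ePi ξ ^ 2)) :
    rHat N ζ τ ξ * flip₂ (rHat N ζ τ (-ξ)) = (shiftFactor N ζ (ePi ξ ^ 2))⁻¹ • 1 := by
  rw [rHat_eq, rHat_eq, flip₂_smul, Matrix.smul_mul, Matrix.mul_smul, smul_smul,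
    weylPair_conj.unitarity (wInt_periodic ξ), Finset.sum_eq_single 0]
  · have h1 : ∀ β : ℤ × ℤ, chi N β 0 = 1 := fun β => by simp [chi, ePi_zero]
    simp only [finInt_zero, neg_zero, sub_zero, h1, one_mul]
    rw [unitarity_wInt_diag hτ hθ, weylKron_zero, smul_smul, mul_div_assoc',
      rhoHat_mul_neg hζ hτ (NeZero.ne N) h, mul_div_cancel_right₀ _ (pow_ne_zero _ hθ)]
  · intro γ _ hγ
    rw [unitarity_wInt_off hτ hθ hγ, zero_smul]
  · intro h0
    exact absurd (Finset.mem_univ _) h0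

theorem rHat_crossing [NeZero N] (hζ : 0 < ζ.im) (hτ : 0 < τ.im) (hθ : oddTheta τ ζ ≠ 0)
    (h : Nondegenerate (ePi ζ) (ePi (2 * τ)) (ePi ξ ^ 2)) (i j k l : Fin N) :
    ∑ x : Fin N, ∑ y : Fin N,
      rHat N ζ τ (ξ - N * ζ) (x, i) (j, y) * flip₂ (rHat N ζ τ (-ξ)) (k, y) (x, l) =
    (shiftFactor N ζ (ePi ξ ^ 2))⁻¹ * (1 : Matrix (Fin N × Fin N) (Fin N × Fin N) ℂ) (k, i) (j, l) := by
  have h0 : oddTheta τ ξ ≠ 0 := by simpa using h.oddTheta_ne_zero hτ 0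
  have h1 : oddTheta τ (ξ - N * ζ) ≠ 0 := by
    have := h.oddTheta_ne_zero hτ (-N)
    rwa [show ξ + ((-N : ℤ) : ℂ) * ζ = ξ - N * ζ by push_cast; ring] at this
  have h2 := weylPair_conj.crossing (b := fun β => wInt N ζ τ β (-ξ))
    (wInt_periodic (N := N) (ζ := ζ) (τ := τ) (ξ - N * ζ)) i j k l
  simp only [crossing_wInt hτ hθ h0 h1] at h2
  rw [Finset.sum_eq_single (0 : Fin N × Fin N)] at h2
  · rw [if_pos rfl, finInt_zero, neg_zero, weylKron_zero] at h2
    simp only [rHat_eq, flip₂_smul, Matrix.smul_apply, smul_eq_mul]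
    rw [← rhoHat_crossing hζ hτ (NeZero.ne N) h hθ, mul_assoc, ← h2, Finset.mul_sum]
    simp only [Finset.mul_sum]
    exact Finset.sum_congr rfl fun x _ => Finset.sum_congr rfl fun y _ => by ring
  · intro γ _ hγ
    rw [if_neg hγ, zero_mul]
  · intro h0
    exact absurd (Finset.mem_univ _) h0

theorem wInt_add_shift [NeZero N] (β : ℤ × ℤ) (ξ : ℂ) :
    wInt N ζ τ β (ξ + (τ + 1)) =
      -thetaMult τ (ξ + ζ / N) * ePi (2 * (β.1 - β.2 : ℤ) / N) * wInt N ζ τ β ξ := by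
  rw [← add_assoc, wInt_add_one, wInt_add_tau,
    show (2 : ℂ) * (β.1 - β.2 : ℤ) / N = 2 * β.1 / N + -(2 * β.2 / N) by push_cast; ring, ePi_add]
  ring

theorem rhoHat_mul_wInt_add_shift [NeZero N] (hζ : 0 < ζ.im) (hτ : 0 < τ.im)
    (h : Nondegenerate (ePi ζ) (ePi (2 * τ)) (ePi ξ ^ 2)) (β : ℤ × ℤ) :
    rhoHat N ζ τ (ξ + (τ + 1)) * wInt N ζ τ β (ξ + (τ + 1)) =
      shiftFactor N ζ (ePi ξ ^ 2) * ePi (2 * (β.1 - β.2 : ℤ) / N) *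
        (rhoHat N ζ τ ξ * wInt N ζ τ β ξ) := by
  rw [wInt_add_shift]
  linear_combination ePi (2 * (β.1 - β.2 : ℤ) / N) * wInt N ζ τ β ξ *
    rhoHat_add_tau hζ hτ (NeZero.ne N) h

/-- Under the shift, w_β picks up ω^{β₁-β₂} besides a scalar independent of β, and conjugation by
the twist multiplies I_β by the inverse phase. -/
theorem twist_conj_rHat [NeZero N] (hζ : 0 < ζ.im) (hτ : 0 < τ.im)
    (h : Nondegenerate (ePi ζ) (ePi (2 * τ)) (ePi ξ ^ 2)) :
    (twist N ⊗ₖ (1 : Matrix (Fin N) (Fin N) ℂ)) * rHat N ζ τ (ξ + (τ + 1)) *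
      ((twist N)⁻¹ ⊗ₖ (1 : Matrix (Fin N) (Fin N) ℂ)) =
      shiftFactor N ζ (ePi ξ ^ 2) • rHat N ζ τ ξ := by
  rw [rHat_eq, rHat_eq, ← weylSum_smul, ← weylSum_smul, ← weylSum_smul, weylSum, weylSum,
    Finset.mul_sum, Finset.sum_mul]
  refine Finset.sum_congr rfl fun α _ => ?_
  rw [Matrix.mul_smul, Matrix.smul_mul, ← val_hConj_mul_gUnit_inv, ← val_hConj_mul_gUnit,
    weylPair_conj.conj, smul_smul, rhoHat_mul_wInt_add_shift hζ hτ h]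
  congr 1
  have he : ePi (2 * ((finInt α).1 - (finInt α).2 : ℤ) / N) *
      ePi (2 * ((finInt α).2 - (finInt α).1 : ℤ) / N) = 1 := by
    rw [← ePi_add, ← ePi_zero]
    congr 1
    push_cast
    ring
  linear_combination shiftFactor N ζ (ePi ξ ^ 2) * (rhoHat N ζ τ ξ * wInt N ζ τ (finInt α) ξ) * he

theorem ePi_add_nat_mul_sq (ξ τ : ℂ) (n : ℕ) :
    ePi (ξ + n * (τ + 1)) ^ 2 = ePi ξ ^ 2 * ePi (2 * τ) ^ n := by
  rw [ePi_sq, ePi_sq, ← ePi_nat_mul, ← ePi_add, ePi_eq_iff]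
  exact ⟨n, by push_cast; ring⟩

theorem rhoHat_mul_wInt_add_nat_mul [NeZero N] (hζ : 0 < ζ.im) (hτ : 0 < τ.im)
    (h : Nondegenerate (ePi ζ) (ePi (2 * τ)) (ePi ξ ^ 2)) (β : ℤ × ℤ) (n : ℕ) :
    rhoHat N ζ τ (ξ + n * (τ + 1)) * wInt N ζ τ β (ξ + n * (τ + 1)) =
      (∏ k ∈ Finset.range n, shiftFactor N ζ (ePi ξ ^ 2 * ePi (2 * τ) ^ k)) *
        ePi (2 * (β.1 - β.2 : ℤ) / N) ^ n * (rhoHat N ζ τ ξ * wInt N ζ τ β ξ) := by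
  induction n with
  | zero => simp
  | succ n ih =>
    have h1 : Nondegenerate (ePi ζ) (ePi (2 * τ)) (ePi (ξ + n * (τ + 1)) ^ 2) := by
      rw [ePi_add_nat_mul_sq, mul_comm (ePi ξ ^ 2)]
      simpa using h.mul (ePi_ne_zero _) (ePi_ne_zero _) 0 n
    rw [Nat.cast_succ, add_mul, one_mul, ← add_assoc, rhoHat_mul_wInt_add_shift hζ hτ h1, ih,
      ePi_add_nat_mul_sq, Finset.prod_range_succ, pow_succ]
    ring

/-- After a multiple of N shifts the phases are N-th powers of N-th roots of unity, so no
conjugation is needed. -/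
theorem rHat_add_nat_mul [NeZero N] (hζ : 0 < ζ.im) (hτ : 0 < τ.im)
    (h : Nondegenerate (ePi ζ) (ePi (2 * τ)) (ePi ξ ^ 2)) (m : ℕ) :
    rHat N ζ τ (ξ + (N * m : ℕ) * (τ + 1)) =
      (∏ k ∈ Finset.range (N * m), shiftFactor N ζ (ePi ξ ^ 2 * ePi (2 * τ) ^ k)) •
        rHat N ζ τ ξ := by
  rw [rHat_eq, rHat_eq, ← weylSum_smul, ← weylSum_smul, ← weylSum_smul]
  congr 1
  funext β
  have hN : (N : ℂ) ≠ 0 := NeZero.ne _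
  have he : ePi (2 * (β.1 - β.2 : ℤ) / N) ^ (N * m) = 1 := by
    rw [pow_mul, ← ePi_nat_mul, mul_div_cancel₀ _ hN, ePi_two_mul_int, one_pow]
  rw [rhoHat_mul_wInt_add_nat_mul hζ hτ h, he, mul_one]

theorem wInt_add_int [NeZero N] (β : ℤ × ℤ) (ξ : ℂ) (n : ℤ) :
    wInt N ζ τ β (ξ + n) = (-1) ^ n * ePi (2 * β.1 / N) ^ n * wInt N ζ τ β ξ := by
  have h1 := fun ξ => wInt_add_one (N := N) (ζ := ζ) (τ := τ) β ξ
  have h0 := ePi_ne_zero (2 * β.1 / N)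
  induction n using Int.induction_on with
  | zero => simp
  | succ n ih =>
    rw [Int.cast_add, Int.cast_one, ← add_assoc, h1, ih, zpow_add₀ (by norm_num), zpow_add₀ h0,
      zpow_one, zpow_one]
    ring
  | pred n ih =>
    have h2 := h1 (ξ + ((-(n : ℤ) - 1 : ℤ) : ℂ))
    rw [show ξ + ((-(n : ℤ) - 1 : ℤ) : ℂ) + 1 = ξ + ((-(n : ℤ) : ℤ) : ℂ) by push_cast; ring, ih] at h2
    rw [zpow_sub₀ (by norm_num), zpow_sub₀ h0, zpow_one, zpow_one]
    field_simp
    linear_combination h2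

/-- The sign (-1)^{Nn} of w_β cancels against that of the odd theta function in the denominator of
ρ, and the phase of w_β is an N-th power. -/
theorem rHat_add_int_mul [NeZero N] (hτ : 0 < τ.im) (ξ : ℂ) (n : ℤ) :
    rHat N ζ τ (ξ + N * n) = rHat N ζ τ ξ := by
  have hN : (N : ℂ) ≠ 0 := NeZero.ne _
  have hm : ((-1 : ℂ) ^ (N * n : ℤ)) * (-1 : ℂ) ^ (N * n : ℤ) = 1 := by
    rw [← mul_zpow]
    norm_num
  have hx : ePi (ξ + (N * n : ℤ)) ^ 2 = ePi ξ ^ 2 := by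
    rw [ePi_sq, ePi_sq, ePi_eq_iff]
    exact ⟨N * n, by push_cast; ring⟩
  have ht : oddTheta τ (ξ + (N * n : ℤ) + ζ) = (-1) ^ (N * n : ℤ) * oddTheta τ (ξ + ζ) := by
    rw [add_right_comm, oddTheta_add_int hτ]
  rw [show ξ + (N : ℂ) * n = ξ + ((N * n : ℤ) : ℂ) by push_cast; ring, rHat_eq, rHat_eq,
    ← weylSum_smul, ← weylSum_smul]
  congr 1
  funext β
  have he : ePi (2 * β.1 / N) ^ (N * n : ℤ) = 1 := by
    rw [zpow_mul, zpow_natCast, ← ePi_nat_mul, mul_div_cancel₀ _ hN, ePi_two_mul_int, one_zpow]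
  rw [wInt_add_int, he, mul_one, rhoHat_eq, rhoHat_eq, hx, ht]
  generalize (-1 : ℂ) ^ (N * n : ℤ) = s at *
  have hs : s⁻¹ * s = 1 := inv_mul_cancel₀ (left_ne_zero_of_mul (hm.trans_ne one_ne_zero))
  rw [div_eq_mul_inv (oddTheta τ ζ), div_eq_mul_inv (oddTheta τ ζ), mul_inv]
  linear_combination ePi (ζ * (1 / N - 1)) *
    (bigTheta (ePi ζ ^ (2 * N)) (ePi ζ ^ 2 * (ePi ξ ^ 2)⁻¹) /
      bigTheta (ePi ζ ^ (2 * N)) (ePi ξ ^ 2)) *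
    invKappa N (ePi ζ) (ePi (2 * τ)) (ePi ξ ^ 2) * (oddTheta τ ζ * (oddTheta τ (ξ + ζ))⁻¹) *
    wInt N ζ τ β ξ * hs

/-! ## Genericity -/

theorem Generic.neg {c u : ℂ} (h : Generic ζ τ c u) : Generic ζ τ c (-u) := fun a b d hab =>
  h (-a) (-b) (-d) (by
    rw [mul_neg, zpow_neg, zpow_neg, zpow_neg, ← mul_inv, ← mul_inv, ← hab, ePi_neg, inv_pow,
      inv_inv])

theorem Generic.add {c u v : ℂ} (h : Generic ζ τ c u) (a b d : ℤ)
    (hv : ePi v ^ 2 = ePi ζ ^ (2 * a) * ePi (2 * τ) ^ b * ePi (2 * (τ - c * ζ)) ^ d) :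
    Generic ζ τ c (u + v) := fun a' b' d' hab =>
  h (a' - a) (b' - b) (d' - d) (by
    rw [mul_sub, zpow_sub₀ (ePi_ne_zero _), zpow_sub₀ (ePi_ne_zero _), zpow_sub₀ (ePi_ne_zero _)]
    rw [ePi_add, mul_pow, hv] at hab
    have h1 := zpow_ne_zero (2 * a) (ePi_ne_zero ζ)
    have h2 := zpow_ne_zero b (ePi_ne_zero (2 * τ))
    have h3 := zpow_ne_zero d (ePi_ne_zero (2 * (τ - c * ζ)))
    field_simp
    linear_combination hab)

theorem Generic.add_shift {c u : ℂ} (h : Generic ζ τ c u) : Generic ζ τ c (u + (τ + 1)) :=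
  h.add 0 1 0 (by
    rw [mul_zero, zpow_zero, zpow_zero, zpow_one, one_mul, mul_one, ePi_sq, ePi_eq_iff]
    exact ⟨1, by push_cast; ring⟩)

/-- Because q^{2c} = p/p*, the shift by cζ stays within the excluded group. -/
theorem Generic.add_level {c u : ℂ} (h : Generic ζ τ c u) : Generic ζ τ c (u + c * ζ) :=
  h.add 0 1 (-1) (by
    rw [mul_zero, zpow_zero, zpow_neg, zpow_one, zpow_one, one_mul, ← ePi_neg, ← ePi_add, ePi_sq]
    congr 1
    ring)

theorem Generic.nondegenerate {c u : ℂ} (h : Generic ζ τ c u) :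
    Nondegenerate (ePi ζ) (ePi (2 * τ)) (ePi u ^ 2) := fun a b hab =>
  h a b 0 (by rw [hab, zpow_zero, mul_one])

theorem Generic.nondegenerate_star {c u : ℂ} (h : Generic ζ τ c u) :
    Nondegenerate (ePi ζ) (ePi (2 * (τ - c * ζ))) (ePi u ^ 2) := fun a b hab =>
  h a 0 b (by rw [hab, zpow_zero, mul_one])

end

/-! ## The structure function on the surface -/

section

variable {N : ℕ} {ζ τ : ℂ}

/-- The prefactor q^{2M(N-1)} is distributed as q^{2-2/N} over the NM factors, each of which becomes
a value of `shiftFactor`. -/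
theorem structF_natCast [NeZero N] (ζ p : ℂ) (m : ℕ) (x : ℂ) :
    structF N (ePi ζ) p m x =
      ∏ k ∈ Finset.range (N * m), shiftFactor N ζ ((x ^ 2)⁻¹ * (p ^ k)⁻¹) := by
  have hN : (N : ℂ) ≠ 0 := NeZero.ne _
  have hc : ePi ζ ^ (2 * (m : ℤ) * ((N : ℤ) - 1)) = ePi (ζ * (2 - 2 / N)) ^ (N * m) := by
    rw [← ePi_int_mul, ← ePi_nat_mul]
    congr 1
    push_cast
    field_simp
  rw [structF, if_pos (Int.natCast_nonneg m), Int.natAbs_natCast, hc]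
  simp only [shiftFactor]
  rw [Finset.prod_mul_distrib, Finset.prod_const, Finset.card_range]
  congr 1
  refine Finset.prod_congr rfl fun k _ => ?_
  rw [mul_inv, inv_inv, inv_inv]
  congr 3 <;> ring

theorem structF_neg_natCast [NeZero N] (ζ p : ℂ) {m : ℕ} (hm : 0 < m) (x : ℂ) :
    structF N (ePi ζ) p (-m) x =
      (∏ k ∈ Finset.range (N * m), shiftFactor N ζ ((x ^ 2)⁻¹ * p ^ (k + 1)))⁻¹ := by
  have hN : (N : ℂ) ≠ 0 := NeZero.ne _
  have hc : ePi ζ ^ (-(2 * (m : ℤ) * ((N : ℤ) - 1))) = (ePi (ζ * (2 - 2 / N)) ^ (N * m))⁻¹ := by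
    rw [zpow_neg, ← ePi_int_mul, ← ePi_nat_mul]
    congr 2
    push_cast
    field_simp
  have hI : Finset.Icc 1 (N * m) = Finset.Ico (0 + 1) (N * m + 1) := by
    ext k
    simp only [Finset.mem_Icc, Finset.mem_Ico]
    omega
  rw [structF, if_neg (by omega), abs_neg, Int.natAbs_neg, Int.natAbs_natCast, Nat.abs_cast, hc, hI,
    ← Finset.prod_Ico_add', ← Finset.range_eq_Ico]
  simp only [shiftFactor]
  rw [Finset.prod_mul_distrib, Finset.prod_const, Finset.card_range, mul_inv,
    ← Finset.prod_inv_distrib]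
  congr 1
  refine Finset.prod_congr rfl fun k _ => ?_
  rw [inv_div, mul_inv, inv_inv]
  congr 3 <;> ring

/-- The equation between 2/N-th powers fixes NM(τ + 1) modulo Nℤ, the periods of R̂ found in
`rHat_add_int_mul`. -/
theorem OnSurface.exists_int [NeZero N] {M : ℤ} {c : ℂ} (h : OnSurface N M ζ τ c) :
    ∃ n : ℤ, (N : ℂ) * M * (τ + 1) = -(c + N) * ζ + N * n := by
  have hN : (N : ℂ) ≠ 0 := NeZero.ne _
  have h2 := h.2
  rw [← ePi_int_mul, ePi_eq_iff] at h2
  obtain ⟨n, hn⟩ := h2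
  refine ⟨n, ?_⟩
  push_cast at hn
  field_simp at hn
  linear_combination hn

/-- By the surface equation, s - Nζ and s + cζ are joined by N|M| shifts by τ + 1 up to a period. V
collects the values of U along the chain, and the two outer factors of U move the window of the
product by one, which gives F. -/
theorem rHat_crossing_shift [NeZero N] (hζ : 0 < ζ.im) (hτ : 0 < τ.im) {M : ℤ} {c s : ℂ}
    (h : OnSurface N M ζ τ c) (hs : Generic ζ τ c s) {x : ℂ} (hx : (x ^ 2)⁻¹ = ePi s ^ 2) :
    ∃ V : ℂ, rHat N ζ τ (s - N * ζ) = V • rHat N ζ τ (s + c * ζ) ∧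
      shiftFactor N ζ (ePi s ^ 2) * V * (shiftFactor N ζ (ePi (s + c * ζ) ^ 2))⁻¹ =
        structF N (ePi ζ) (ePi (2 * τ)) M x := by
  have hN : N ≠ 0 := NeZero.ne N
  obtain ⟨n, hn⟩ := h.exists_int
  have hp := ePi_ne_zero (2 * τ)
  have hne : ∀ {Z}, Nondegenerate (ePi ζ) (ePi (2 * τ)) Z → ∀ k : ℕ,
      shiftFactor N ζ (Z * ePi (2 * τ) ^ k) ≠ 0 := fun {Z} hZ k =>
    shiftFactor_ne_zero hζ hN hp (by
      rw [mul_comm Z]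
      simpa only [mul_zero, zpow_zero, one_mul, zpow_natCast] using
        hZ.mul (ePi_ne_zero ζ) hp 0 k)
  have hQ : ∀ u : ℂ, ePi ζ ^ (2 * N) * ePi (u - N * ζ) ^ 2 = ePi u ^ 2 := fun u => by
    rw [mul_comm 2 N, pow_mul, ← mul_pow, ← ePi_nat_mul, ← ePi_add]
    congr 2
    ring
  -- Moves the outer value of U from s to s - Nζ, one end of the chain of shifts.
  rw [← hQ s, shiftFactor_mul hζ hN (pow_ne_zero _ (ePi_ne_zero _))]
  obtain ⟨m, rfl | rfl⟩ := M.eq_nat_or_neg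
  · have e1 : s - N * ζ = s + c * ζ + (N * m : ℕ) * (τ + 1) + N * (-n : ℤ) := by
      push_cast at hn ⊢
      linear_combination -hn
    have hu := hs.add_level.nondegenerate
    have e2 : ePi (s - N * ζ) ^ 2 = ePi (s + c * ζ) ^ 2 * ePi (2 * τ) ^ (N * m) := by
      rw [← ePi_add_nat_mul_sq, ePi_sq, ePi_sq, ePi_eq_iff]
      exact ⟨N * -n, by rw [e1]; push_cast; ring⟩
    refine ⟨∏ k ∈ Finset.range (N * m),
      shiftFactor N ζ (ePi (s + c * ζ) ^ 2 * ePi (2 * τ) ^ k), ?_, ?_⟩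
    · rw [e1, rHat_add_int_mul hτ, rHat_add_nat_mul hζ hτ hu]
    · rw [structF_natCast, e2, mul_comm (shiftFactor _ _ _), ← Finset.prod_range_succ,
        Finset.prod_range_succ', pow_zero, mul_one,
        mul_inv_cancel_right₀ (by simpa using hne hu 0), ← Finset.prod_range_reflect]
      refine Finset.prod_congr rfl fun k hk => ?_
      have hk' : N * m = N * m - 1 - k + 1 + k := by
        have := Finset.mem_range.mp hk
        omega
      have h3 : ePi s ^ 2 * (ePi (2 * τ) ^ k)⁻¹ =
          ePi ζ ^ (2 * N) * (ePi (s + c * ζ) ^ 2 * ePi (2 * τ) ^ (N * m - 1 - k + 1)) := by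
        rw [← hQ s, e2, hk', pow_add _ _ k, ← hk']
        field_simp
      rw [hx, h3, shiftFactor_mul hζ hN
        (mul_ne_zero (pow_ne_zero _ (ePi_ne_zero _)) (pow_ne_zero _ hp))]
  · have e1 : s + c * ζ = s - N * ζ + (N * m : ℕ) * (τ + 1) + N * n := by
      push_cast at hn ⊢
      linear_combination hn
    have hu : Nondegenerate (ePi ζ) (ePi (2 * τ)) (ePi (s - N * ζ) ^ 2) := by
      have h3 := hs.nondegenerate.mul (ePi_ne_zero ζ) hp (-N) 0
      have h4 : ePi ζ ^ (2 * -(N : ℤ)) = (ePi ζ ^ (2 * N))⁻¹ := by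
        rw [mul_neg, zpow_neg]
        norm_cast
      rwa [h4, zpow_zero, mul_one, ← hQ s, inv_mul_cancel_left₀ (pow_ne_zero _ (ePi_ne_zero _))]
        at h3
    have e2 : ePi (s + c * ζ) ^ 2 = ePi (s - N * ζ) ^ 2 * ePi (2 * τ) ^ (N * m) := by
      rw [← ePi_add_nat_mul_sq, ePi_sq, ePi_sq, ePi_eq_iff]
      exact ⟨N * n, by rw [e1]; push_cast; ring⟩
    refine ⟨(∏ k ∈ Finset.range (N * m),
      shiftFactor N ζ (ePi (s - N * ζ) ^ 2 * ePi (2 * τ) ^ k))⁻¹, ?_, ?_⟩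
    · rw [e1, rHat_add_int_mul hτ, rHat_add_nat_mul hζ hτ hu, smul_smul, inv_mul_cancel₀, one_smul]
      exact Finset.prod_ne_zero_iff.mpr fun k _ => hne hu k
    · rw [e2, mul_assoc, ← mul_inv, ← Finset.prod_range_succ, Finset.prod_range_succ', pow_zero,
        mul_one, mul_inv, mul_comm, inv_mul_cancel_right₀ (by simpa using hne hu 0)]
      -- The case split also admits M = -0, which belongs to the other branch of `structF`.
      obtain rfl | hm := Nat.eq_zero_or_pos m
      · simp [structF]
      · rw [structF_neg_natCast _ _ hm, hx]
        congr 1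
        refine Finset.prod_congr rfl fun k _ => ?_
        rw [← hQ s, mul_assoc, shiftFactor_mul hζ hN
          (mul_ne_zero (pow_ne_zero _ (ePi_ne_zero _)) (pow_ne_zero _ hp))]

end

/-! ## Exchange of the transfer operator with `L` -/

section

variable {N : ℕ} {A : Type*} [Ring A]

theorem leg₁_mul (X Y : Matrix (Fin N) (Fin N) A) : leg₁ (X * Y) = leg₁ X * leg₁ Y := by
  ext ⟨a, b⟩ ⟨a', b'⟩
  simp [leg₁, Matrix.mul_apply, Fintype.sum_prod_type, Matrix.one_apply]

theorem leg₁_one : leg₁ (1 : Matrix (Fin N) (Fin N) A) = 1 := Matrix.one_kronecker_one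

variable [Algebra ℂ A]

theorem scal_mul {n : Type*} [Fintype n] (X Y : Matrix n n ℂ) :
    scal A (X * Y) = scal A X * scal A Y := Matrix.map_mul

theorem scal_smul {n : Type*} (r : ℂ) (X : Matrix n n ℂ) : scal A (r • X) = r • scal A X := by
  ext i j
  simp [scal, Algebra.smul_def]

theorem scal_one {n : Type*} [DecidableEq n] : scal A (1 : Matrix n n ℂ) = 1 := by
  simp [scal]

theorem leg₁_scal (X : Matrix (Fin N) (Fin N) ℂ) :
    leg₁ (scal A X) = scal A (X ⊗ₖ (1 : Matrix (Fin N) (Fin N) ℂ)) := by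
  ext ⟨a, b⟩ ⟨a', b'⟩
  simp only [leg₁, scal, Matrix.kroneckerMap_apply, Matrix.map_apply, Matrix.one_apply]
  split_ifs <;> simp

theorem leg₁_scal_mul_leg₂ (X : Matrix (Fin N) (Fin N) ℂ) (Y : Matrix (Fin N) (Fin N) A) :
    leg₁ (scal A X) * leg₂ Y = leg₂ Y * leg₁ (scal A X) := by
  ext ⟨a, b⟩ ⟨a', b'⟩
  simp [leg₁, leg₂, scal, Matrix.mul_apply, Fintype.sum_prod_type, Matrix.one_apply,
    Algebra.commutes]

/-- The entries of S and T are scalars, so in the partial trace over the first leg they can be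
gathered on either side of the entry of D; the hypothesis on S and T says that their partial
transposes multiply to 1, which leaves Tr D. -/
theorem trace_mul_apply_of_exchange {S T : Matrix (Fin N × Fin N) (Fin N × Fin N) ℂ}
    {D Y : Matrix (Fin N) (Fin N) A} {f : ℂ}
    (hST : ∀ i j k l : Fin N, ∑ x : Fin N, ∑ y : Fin N, S (x, i) (j, y) * T (k, y) (x, l) =
      (1 : Matrix (Fin N × Fin N) (Fin N × Fin N) ℂ) (k, i) (j, l))
    (h : scal A S * leg₁ D * scal A T * leg₂ Y = f • (leg₂ Y * leg₁ D)) (i l : Fin N) :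
    D.trace * Y i l = f • (Y i l * D.trace) := by
  have h1 : ∑ x : Fin N, (scal A S * leg₁ D * scal A T * leg₂ Y) (x, i) (x, l) =
      D.trace * Y i l := by
    have h3 : ∀ x : Fin N, (scal A S * leg₁ D * scal A T * leg₂ Y) (x, i) (x, l) =
        ∑ b : Fin N, ∑ k : Fin N, ∑ j : Fin N, ∑ y : Fin N,
          (S (x, i) (j, y) * T (k, y) (x, b)) • (D j k * Y b l) := by
      intro x
      have a1 : ∀ k y : Fin N, (scal A S * leg₁ D) (x, i) (k, y) =
          ∑ j : Fin N, S (x, i) (j, y) • D j k := fun k y => by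
        simp [leg₁, scal, Matrix.mul_apply, Fintype.sum_prod_type, Matrix.one_apply,
          Algebra.smul_def]
      have a2 : ∀ b : Fin N, (scal A S * leg₁ D * scal A T) (x, i) (x, b) =
          ∑ k : Fin N, ∑ j : Fin N, ∑ y : Fin N,
            (S (x, i) (j, y) * T (k, y) (x, b)) • D j k := fun b => by
        rw [Matrix.mul_apply, Fintype.sum_prod_type]
        refine Finset.sum_congr rfl fun k _ => ?_
        rw [Finset.sum_comm]
        refine Finset.sum_congr rfl fun y _ => ?_
        rw [a1, Finset.sum_mul]
        refine Finset.sum_congr rfl fun j _ => ?_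
        rw [scal, Matrix.map_apply, ← Algebra.commutes, ← Algebra.smul_def, smul_smul, mul_comm]
      have a3 : (scal A S * leg₁ D * scal A T * leg₂ Y) (x, i) (x, l) =
          ∑ b : Fin N, (scal A S * leg₁ D * scal A T) (x, i) (x, b) * Y b l := by
        rw [Matrix.mul_apply, Fintype.sum_prod_type, Finset.sum_comm]
        simp [leg₂, Matrix.one_apply]
      rw [a3]
      refine Finset.sum_congr rfl fun b _ => ?_
      rw [a2]
      simp only [Finset.sum_mul, smul_mul_assoc]
    simp only [h3]
    have h4 : ∀ b k j : Fin N, ∑ x : Fin N, ∑ y : Fin N,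
        (S (x, i) (j, y) * T (k, y) (x, b)) • (D j k * Y b l) =
        if k = j ∧ i = b then D j k * Y b l else 0 := fun b k j => by
      simp only [← Finset.sum_smul]
      rw [hST, Matrix.one_apply]
      simp only [Prod.mk.injEq, ite_smul, one_smul, zero_smul]
    rw [Finset.sum_comm]
    calc _ = ∑ b : Fin N, ∑ k : Fin N, ∑ j : Fin N,
        if k = j ∧ i = b then D j k * Y b l else 0 := by
          refine Finset.sum_congr rfl fun b _ => ?_
          rw [Finset.sum_comm]
          refine Finset.sum_congr rfl fun k _ => ?_
          rw [Finset.sum_comm]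
          exact Finset.sum_congr rfl fun j _ => h4 b k j
      _ = D.trace * Y i l := by
          simp [ite_and, Matrix.trace, Finset.sum_mul]
  have h2 : ∑ x : Fin N, (leg₂ Y * leg₁ D) (x, i) (x, l) = Y i l * D.trace := by
    simp [leg₁, leg₂, Matrix.mul_apply, Fintype.sum_prod_type, Matrix.one_apply, Matrix.trace,
      Finset.mul_sum]
  rw [← h1, h]
  simp only [Matrix.smul_apply]
  rw [← Finset.smul_sum, h2]

theorem conj_exchange {R : Type*} [Monoid R] {t t' r r' x y : R} (h1 : t' * t = 1)
    (ht : t * y = y * t) (ht' : t' * y = y * t') (h : r * x * y = y * x * r') :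
    t * r * t' * (t * x * t') * y = y * (t * x * t') * (t * r' * t') :=
  calc t * r * t' * (t * x * t') * y = t * r * (t' * t) * x * (t' * y) := by simp only [mul_assoc]
    _ = t * (r * x * y) * t' := by rw [h1, ht', mul_one]; simp only [mul_assoc]
    _ = t * y * x * r' * t' := by rw [h]; simp only [mul_assoc]
    _ = y * t * x * (t' * t) * r' * t' := by rw [h1, ht, mul_one]
    _ = y * (t * x * t') * (t * r' * t') := by simp only [mul_assoc]

/-- Passes from an exchange relation for k to one for its inverse b: insert k b = 1 to the right of
y, apply the relation backwards and cancel r. -/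
theorem inverse_exchange {R : Type*} [Monoid R] {r r' v v' k b y : R} (h1 : v * r = 1)
    (h2 : r' * v' = 1) (hb : b * k = 1) (hb' : k * b = 1) (h : r * k * y = y * k * r') :
    b * v * y = y * v' * b :=
  calc b * v * y = b * v * (y * k * (r' * v')) * b := by
        rw [h2, mul_one, mul_assoc (b * v), mul_assoc y, hb', mul_one]
    _ = b * v * (y * k * r') * v' * b := by simp only [mul_assoc]
    _ = b * (v * r) * k * y * v' * b := by rw [← h]; simp only [mul_assoc]
    _ = y * v' * b := by rw [h1, mul_one, hb, one_mul]

theorem tOp_mul_apply [NeZero N] {ζ τ c : ℂ} {M : ℤ} (hζ : 0 < ζ.im) (hτ : 0 < τ.im)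
    (hτs : 0 < (τ - c * ζ).im) (hθ : oddTheta τ ζ ≠ 0) (hθs : oddTheta (τ - c * ζ) ζ ≠ 0)
    (hsurf : OnSurface N M ζ τ c) {L : ℂ → Matrix (Fin N) (Fin N) A} (hL : ∀ ξ, IsUnit (L ξ))
    (hex : ∀ ξ η, Generic ζ τ c (ξ - η) →
      scal A (rHat N ζ τ (ξ - η)) * leg₁ (L ξ) * leg₂ (L η) =
        leg₂ (L η) * leg₁ (L ξ) * scal A (rHatStar N ζ τ c (ξ - η)))
    {ξ η : ℂ} (hgen : Generic ζ τ c (η - ξ)) (i j : Fin N) :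
    tOp ζ τ c L ξ * L η i j =
      structF N (ePi ζ) (ePi (2 * τ)) M (ePi (η - ξ)) • (L η i j * tOp ζ τ c L ξ) := by
  -- The argument s governs L⁻(ξ) against L(η), and u = s + cζ governs L(ξ + cζ) against L(η).
  obtain ⟨s, hs⟩ : ∃ s, s = ξ - η := ⟨_, rfl⟩
  have hg : Generic ζ τ c s := by
    rw [hs, ← neg_sub]
    exact hgen.neg
  obtain ⟨u, hu⟩ : ∃ u, u = s + c * ζ := ⟨_, rfl⟩
  have hgu : Generic ζ τ c u := hu ▸ hg.add_level
  have hN : N ≠ 0 := NeZero.ne N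
  have hx : (ePi (η - ξ) ^ 2)⁻¹ = ePi s ^ 2 := by
    rw [← inv_pow, ← ePi_neg, neg_sub, hs]
  obtain ⟨V, hV, hF⟩ := rHat_crossing_shift hζ hτ hsurf hg hx
  rw [← hu] at hV hF
  have hX := shiftFactor_ne_zero hζ hN (ePi_ne_zero _) hg.nondegenerate
  have hY := shiftFactor_ne_zero hζ hN (ePi_ne_zero _) hgu.nondegenerate
  set lX := shiftFactor N ζ (ePi s ^ 2)
  set lY := shiftFactor N ζ (ePi u ^ 2)
  set R := rHat N ζ τ
  set Rs := rHat N ζ (τ - c * ζ)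
  have hdet : IsUnit (twist N).det := by
    rw [← val_hConj_mul_gUnit]
    exact (Matrix.isUnit_iff_isUnit_det _).mp (hConj N * gUnit N).isUnit
  -- the two exchange relations
  set P := L (ξ + c * ζ)
  set K := lMinus τ L ξ with hK
  have e1 : scal A (R u) * leg₁ P * leg₂ (L η) = leg₂ (L η) * leg₁ P * scal A (Rs u) := by
    have h := hex (ξ + c * ζ) η
    rw [show ξ + c * ζ - η = u by rw [hu, hs]; ring] at h
    exact h hgu
  have e2 : scal A (lX • R s) * leg₁ K * leg₂ (L η) =
      leg₂ (L η) * leg₁ K * scal A (lY • Rs u) := by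
    have h := hex (ξ + (τ + 1)) η
    rw [show ξ + (τ + 1) - η = s + (τ + 1) by rw [hs]; ring] at h
    replace h := h hg.add_shift
    have h1 := twist_conj_rHat hζ hτ hg.nondegenerate (N := N)
    have h2 := twist_conj_rHat hζ hτs hgu.nondegenerate_star (N := N)
    -- The key coincidence: the shifted argument is one quasi-period of R̂ beyond s and one
    -- quasi-period of R̂* beyond u. Thus the right-hand matrix becomes R̂*(u), as in `e1`.
    rw [show u + (τ - c * ζ + 1) = s + (τ + 1) by rw [hu]; ring] at h2
    have ht : leg₁ (scal A (twist N)⁻¹) * leg₁ (scal A (twist N)) = 1 := by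
      rw [← leg₁_mul, ← scal_mul, Matrix.nonsing_inv_mul _ hdet, scal_one, leg₁_one]
    rw [← h1, ← h2, hK, lMinus]
    simp only [scal_mul, leg₁_mul, ← leg₁_scal]
    exact conj_exchange ht (leg₁_scal_mul_leg₂ _ _) (leg₁_scal_mul_leg₂ _ _) h
  -- unitarity
  have u1 : (lX • R s) * flip₂ (R (-s)) = 1 := by
    rw [Matrix.smul_mul, rHat_mul_flip hζ hτ hθ hg.nondegenerate, smul_smul, mul_inv_cancel₀ hX,
      one_smul]
  have u2 : (lY • Rs u) * flip₂ (Rs (-u)) = 1 := by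
    rw [Matrix.smul_mul, rHat_mul_flip hζ hτs hθs hgu.nondegenerate_star, smul_smul,
      mul_inv_cancel₀ hY, one_smul]
  -- Unitarity gives a right inverse; for square complex matrices it is also a left inverse, which
  -- is the side needed here.
  have v1 : scal A (flip₂ (R (-s))) * scal A (lX • R s) = 1 := by
    rw [← scal_mul, mul_eq_one_comm.mp u1, scal_one]
  have v2 : scal A (lY • Rs u) * scal A (flip₂ (Rs (-u))) = 1 := by
    rw [← scal_mul, u2, scal_one]
  -- the inverse of `K`
  have hKu : IsUnit K := by
    have t1 : IsUnit (scal A (twist N)) := isUnit_iff_exists.mpr ⟨scal A (twist N)⁻¹,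
      by rw [← scal_mul, Matrix.mul_nonsing_inv _ hdet, scal_one],
      by rw [← scal_mul, Matrix.nonsing_inv_mul _ hdet, scal_one]⟩
    have t2 : IsUnit (scal A (twist N)⁻¹) := isUnit_iff_exists.mpr ⟨scal A (twist N),
      by rw [← scal_mul, Matrix.nonsing_inv_mul _ hdet, scal_one],
      by rw [← scal_mul, Matrix.mul_nonsing_inv _ hdet, scal_one]⟩
    exact (t1.mul (hL _)).mul t2
  set B := Ring.inverse K with hB
  have b1 : leg₁ B * leg₁ K = 1 := by
    rw [← leg₁_mul, Ring.inverse_mul_cancel _ hKu, leg₁_one]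
  have b2 : leg₁ K * leg₁ B = 1 := by
    rw [← leg₁_mul, Ring.mul_inverse_cancel _ hKu, leg₁_one]
  have e3 := inverse_exchange v1 v2 b1 b2 e2
  have ht : tOp ζ τ c L ξ = (P * B).trace := by
    rw [tOp, lPlus, add_assoc, add_halves]
  rw [ht]
  refine trace_mul_apply_of_exchange (S := (lX * V) • R u) (T := flip₂ (R (-s))) ?_ ?_ i j
  · intro i j k l
    have h := rHat_crossing hζ hτ hθ hg.nondegenerate i j k l
    -- The surface enters here: R̂(u) stands in for R̂(s - Nζ), so that crossing applies under the
    -- trace.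
    have hS : (lX * V) • R u = lX • R (s - N * ζ) := by
      rw [hV, smul_smul]
    rw [hS]
    simp only [Matrix.smul_apply, smul_eq_mul, mul_assoc, ← Finset.mul_sum]
    rw [h, mul_inv_cancel_left₀ hX]
  · rw [scal_smul, leg₁_mul, ← hF]
    have v3 : scal A (Rs u) * scal A (flip₂ (Rs (-u))) = lY⁻¹ • 1 := by
      rw [← v2, scal_smul, smul_mul_assoc, smul_smul, inv_mul_cancel₀ hY, one_smul]
    calc ((lX * V) • scal A (R u)) * (leg₁ P * leg₁ B) * scal A (flip₂ (R (-s))) * leg₂ (L η)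
        = (lX * V) • (scal A (R u) * leg₁ P *
            (leg₁ B * scal A (flip₂ (R (-s))) * leg₂ (L η))) := by
          simp only [smul_mul_assoc, mul_assoc]
      _ = (lX * V) • (scal A (R u) * leg₁ P * leg₂ (L η) * scal A (flip₂ (Rs (-u))) * leg₁ B) := by
          rw [e3]
          simp only [mul_assoc]
      _ = (lX * V) • (leg₂ (L η) * leg₁ P * (scal A (Rs u) * scal A (flip₂ (Rs (-u)))) *
            leg₁ B) := by
          rw [e1]
          simp only [mul_assoc]
      _ = (lX * V * lY⁻¹) • (leg₂ (L η) * (leg₁ P * leg₁ B)) := by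
          rw [v3, mul_smul_comm, mul_one, smul_mul_assoc, smul_smul, mul_assoc (leg₂ _)]

end

/-! ## The elliptic quantum algebras -/

section

variable {N : ℕ} {A B : Type*} [Ring A] [Algebra ℂ A] [Ring B] [Algebra ℂ B]

theorem map_leg₁ (f : A →ₐ[ℂ] B) (X : Matrix (Fin N) (Fin N) A) :
    (leg₁ X).map f = leg₁ (X.map f) := by
  ext ⟨a, b⟩ ⟨a', b'⟩
  simp [leg₁, Matrix.one_apply, apply_ite f]

theorem map_leg₂ (f : A →ₐ[ℂ] B) (X : Matrix (Fin N) (Fin N) A) :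
    (leg₂ X).map f = leg₂ (X.map f) := by
  ext ⟨a, b⟩ ⟨a', b'⟩
  simp [leg₂, Matrix.one_apply, apply_ite f]

theorem map_scal {n : Type*} (f : A →ₐ[ℂ] B) (X : Matrix n n ℂ) :
    (scal A X).map f = scal B X := by
  ext a b
  simp [scal]

theorem map_exchange (f : A →ₐ[ℂ] B) {R R' : Matrix (Fin N × Fin N) (Fin N × Fin N) ℂ}
    {X Y : Matrix (Fin N) (Fin N) A}
    (h : (scal A R * leg₁ X * leg₂ Y).map f = (leg₂ Y * leg₁ X * scal A R').map f) :
    scal B R * leg₁ (X.map f) * leg₂ (Y.map f) =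
      leg₂ (Y.map f) * leg₁ (X.map f) * scal B R' := by
  simpa only [Matrix.map_mul, map_leg₁, map_leg₂, map_scal] using h

end

section

variable {N : ℕ} {ζ τ c : ℂ}

theorem glL_exchange (ξ η : ℂ) (h : Generic ζ τ c (ξ - η)) :
    scal _ (rHat N ζ τ (ξ - η)) * leg₁ (glL N ζ τ c ξ) * leg₂ (glL N ζ τ c η) =
      leg₂ (glL N ζ τ c η) * leg₁ (glL N ζ τ c ξ) * scal _ (rHatStar N ζ τ c (ξ - η)) := by
  refine map_exchange (RingQuot.mkAlgHom ℂ (RelGL N ζ τ c)) ?_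
  ext a b
  exact RingQuot.mkAlgHom_rel ℂ (RelGL.exchange ξ η h a b)

theorem isUnit_glL (ξ : ℂ) : IsUnit (glL N ζ τ c ξ) := by
  refine isUnit_iff_exists.mpr ⟨(freeLinv N ξ).map (RingQuot.mkAlgHom ℂ (RelGL N ζ τ c)), ?_, ?_⟩
  · rw [glL, ← Matrix.map_mul]
    ext i j
    rw [Matrix.map_apply, RingQuot.mkAlgHom_rel ℂ (RelGL.mul_inv ξ i j), Matrix.one_apply,
      Matrix.one_apply]
    split_ifs <;> simp
  · rw [glL, ← Matrix.map_mul]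
    ext i j
    rw [Matrix.map_apply, RingQuot.mkAlgHom_rel ℂ (RelGL.inv_mul ξ i j), Matrix.one_apply,
      Matrix.one_apply]
    split_ifs <;> simp

theorem slL_exchange (ξ η : ℂ) (h : Generic ζ τ c (ξ - η)) :
    scal (EllSL N ζ τ c) (rHat N ζ τ (ξ - η)) * leg₁ (slL N ζ τ c ξ) * leg₂ (slL N ζ τ c η) =
      leg₂ (slL N ζ τ c η) * leg₁ (slL N ζ τ c ξ) *
        scal (EllSL N ζ τ c) (rHatStar N ζ τ c (ξ - η)) := by
  have h1 := map_exchange (A := EllGL N ζ τ c) (B := EllSL N ζ τ c) (X := glL N ζ τ c ξ)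
    (Y := glL N ζ τ c η) (R := rHat N ζ τ (ξ - η)) (R' := rHatStar N ζ τ c (ξ - η))
    (RingQuot.mkAlgHom ℂ (RelSL N ζ τ c)) (by rw [glL_exchange ξ η h])
  exact h1

theorem isUnit_slL (ξ : ℂ) : IsUnit (slL N ζ τ c ξ) :=
  (isUnit_glL ξ).map (RingQuot.mkAlgHom ℂ (RelSL N ζ τ c)).toRingHom.mapMatrix

end

end EllipticAlgebra

/-! ### The theorem for both algebras -/

theorem theorem4 (N : ℕ) (hN : 2 ≤ N) (M : ℤ) (ζ τ c : ℂ)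
    -- convergence: `|q| < 1`, `|p| < 1`, `|p*| < 1` with `p* = p q^{-2c}`
    (hζ : 0 < ζ.im) (hτ : 0 < τ.im) (hτs : 0 < (τ - c * ζ).im)
    -- `R̂` and `R̂*` are defined: `q² ∉ p^ℤ` and `q² ∉ (p*)^ℤ`
    (hR : ∀ k : ℤ, EllipticAlgebra.ePi ζ ^ 2 ≠ EllipticAlgebra.ePi (2 * τ) ^ k)
    (hRs : ∀ k : ℤ, EllipticAlgebra.ePi ζ ^ 2 ≠ EllipticAlgebra.ePi (2 * (τ - c * ζ)) ^ k)
    (hsurf : EllipticAlgebra.OnSurface N M ζ τ c) :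
    (∀ ξ η : ℂ, EllipticAlgebra.Generic ζ τ c (η - ξ) → ∀ i j : Fin N,
      EllipticAlgebra.tOp ζ τ c (EllipticAlgebra.slL N ζ τ c) ξ
          * EllipticAlgebra.slL N ζ τ c η i j
        = EllipticAlgebra.structF N (EllipticAlgebra.ePi ζ) (EllipticAlgebra.ePi (2 * τ)) M
            (EllipticAlgebra.ePi (η - ξ)) •
          (EllipticAlgebra.slL N ζ τ c η i j
            * EllipticAlgebra.tOp ζ τ c (EllipticAlgebra.slL N ζ τ c) ξ)) ∧
    (∀ ξ η : ℂ, EllipticAlgebra.Generic ζ τ c (η - ξ) → ∀ i j : Fin N,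
      EllipticAlgebra.tOp ζ τ c (EllipticAlgebra.glL N ζ τ c) ξ
          * EllipticAlgebra.glL N ζ τ c η i j
        = EllipticAlgebra.structF N (EllipticAlgebra.ePi ζ) (EllipticAlgebra.ePi (2 * τ)) M
            (EllipticAlgebra.ePi (η - ξ)) •
          (EllipticAlgebra.glL N ζ τ c η i j
            * EllipticAlgebra.tOp ζ τ c (EllipticAlgebra.glL N ζ τ c) ξ)) := by
  have : NeZero N := ⟨by omega⟩
  -- That q² avoids the powers of p, respectively p*, means that ζ is not a zero of the odd theta
  -- function; hence the denominators of the w_β do not vanish.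
  have hθ := EllipticAlgebra.oddTheta_ne_zero_of_sq_ne hτ hR
  have hθs := EllipticAlgebra.oddTheta_ne_zero_of_sq_ne hτs hRs
  exact ⟨fun ξ η hgen => EllipticAlgebra.tOp_mul_apply hζ hτ hτs hθ hθs hsurf
      EllipticAlgebra.isUnit_slL EllipticAlgebra.slL_exchange hgen,
    fun ξ η hgen => EllipticAlgebra.tOp_mul_apply hζ hτ hτs hθ hθs hsurf
      EllipticAlgebra.isUnit_glL EllipticAlgebra.glL_exchange hgen⟩
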